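/- **Notation.** For $k\ge 0$, $d_k(n)$ is the number of ordered ways of writing $n\ge 1$ as a product of $k$ positive integers (so $d_0(n)=1$ if $n=1$ and $0$ otherwise), and for $l\ge1$, $0<A\le 1$, $d_l(n,A)=\sum_{q\mid n,\ q\le n^A}d_{l-1}(q)$. For $k,g\ge 1$, a real number $0<\theta\le 1$ is an exponent of distribution for $d_k$ and $g$ if for every $\epsilon>0$ there is a $\delta>0$ such that, for all $x\ge 1$, all $1\le q\le x^{\theta-\epsilon}$ and all residue classes $a\not\equiv 0\pmod q$ with $(a,q)=g$, $$\sum_{\substack{n\le x\\ n\equiv a\,(q)}}d_k(n)=\frac1{\phi(q/g)}\operatorname*{Res}_{s=1}\Big(\frac{x^s}{s}\sum_{(n,q)=g}\frac{d_k(n)}{n^s}\Big)+O\Big(\frac{x^{1-\delta}}{\phi(q/g)}\Big),$$ the implied constant depending on $\epsilon,\delta,k,g$ only. For $j\ge 0$ define $a_r(j)$ by $(s-1)^j\zeta(s)^j=\sum_{r\ge0}\frac{a_r(j)}{r!}(s-1)^r$ and put $c_n(j)=\sum_{r=0}^n\frac{(-1)^{n-r}a_r(j)}{r!}$. For $h,k,l\ge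 1$ with $h=\prod p^{\gamma}$ put, for $(s,w)$ near $(1,0)$, $$C_{k,l}(s,w)=\prod_p\Big((1-p^{-w-1})^{l-1}+\frac{(1-p^{-s})^k}{1-p^{-1}}-\frac{(1-p^{-s})^k(1-p^{-w-1})^{l-1}}{1-p^{-1}}\Big),$$ $$f_{h,k,l}(s,w)=\prod_{p\mid h}\frac{(1-p^{-1})\sum_{\alpha=0}^{\gamma}d_{l-1}(p^\alpha)\sum_{\beta\ge\alpha}d_k(p^\beta)p^{-\beta s-\alpha w}+d_k(p^\gamma)\,p^{\gamma(1-s)}\sum_{\alpha>\gamma}d_{l-1}(p^\alpha)p^{-\alpha(w+1)}}{(1-p^{-1})(1-p^{-s})^{-k}+(1-p^{-w-1})^{1-l}-1},$$ $$G_{i,j}=\frac{\partial^i}{\partial s^i}\frac{\partial^j}{\partial w^j}\,C_{k,l}(s,w)f_{h,k,l}(s,w)\Big|_{s=1,\,w=0},$$ and let $$C_{k,l}=\prod_p\Big((1-p^{-1})^{l-1}+(1-p^{-1})^{k-1}-(1-p^{-1})^{k+l-2}\Big),$$ $$f_{k,l}(h)=\prod_{p\mid h}\frac{(1-p^{-1})\sum_{\alpha=0}^{\gamma}d_{l-1}(p^\alpha)\sum_{\beta\ge\alpha}d_k(p^\beta)p^{-\beta}+d_k(p^\gamma)\sum_{\alpha>\gamma}d_{l-1}(p^\alpha)p^{-\alpha}}{(1-p^{-1})^{1-k}+(1-p^{-1})^{1-l}-1}.$$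 For $m<k$, $n<l$ put $$b_{m,n}=\sum_{i=0}^{k-1-m}\sum_{j=0}^{l-1-n}\frac{a_{l-1-n-j}(l-1)\,c_{k-1-m-i}(k)}{(l-1-n-j)!}\,\frac{G_{i,j}}{i!\,j!},$$ and for $0\le m<k+l-2$, writing $(y)_j=y(y-1)\cdots(y-j+1)$, put $$a_m=(-1)^m\sum_{j=0}^{k-1}\ \sum_{\substack{t,v\ge 0\\ t+v\le j+l-2-m}}\frac{(-A)^{l-1-t-v}\,a_v(l-1)\,(v+t+1-l)_j}{v!\,t!}\sum_{i=j}^{k-1}\binom ij\frac{c_{k-1-i}(k)}{i!}\,G_{i-j,t}.$$ **Theorem 3.** Let $h,k,l\ge 1$ be fixed integers, let $\theta_k$ be an exponent of distribution for $d_k$ and $g$ for every $g\ge 1$, and let $0<A<\theta_k$. Put $$P_{A,h,k,l}(X)=\sum_{m=0}^{k-1}\sum_{n=0}^{l-1}\frac{A^n b_{m,n}}{m!\,n!}X^{m+n}+\sum_{m=0}^{k+l-3}\frac{a_m}{m!}X^m .$$ Then $P_{A,h,k,l}$ has real coefficients, degree $k+l-2$ and leading coefficient $\dfrac{A^{l-1}C_{k,l}f_{k,l}(h)}{(k-1)!\,(l-1)!}$,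 and there is a $\delta>0$ such that $$\sum_{n\le x}d_k(n+h)\,d_l(n,A)=x\,P_{A,h,k,l}(\log x)+O\big(x^{1-\delta}\big)\qquad(x\to\infty).$$ -/

import Mathlib

open Filter Topology Asymptotics Polynomial
open scoped Nat

namespace AdditiveDivisor

noncomputable section

/-- The general divisor function `d_k`: the `k`-fold Dirichlet convolution of the constant
function `1`, so that `d_k(n)` is the number of ordered ways of writing `n ≥ 1` as a product of
`k` positive integers (`d_0` is the indicator function of `n = 1`). -/
def d (k n : ℕ) : ℕ := (ArithmeticFunction.zeta ^ k) n

/-- The partial divisor function `d_l(n, A)`, the sum of `d_{l-1}(q)` over the divisors `q` of `n`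
with `q ≤ n ^ A`. -/
def dPartial (l : ℕ) (A : ℝ) (n : ℕ) : ℕ :=
  ∑ q ∈ n.divisors.filter (fun q : ℕ => (q : ℝ) ≤ (n : ℝ) ^ A), d (l - 1) q

/-! ### Exponents of distribution -/

/-- `R` is the residue at `c` of the meromorphic function `f`: if `f(z) = g(z) / (z - c) ^ (N + 1)`
near `c` with `g` analytic at `c`, the coefficient of `(z - c)⁻¹` in the Laurent expansion of `f`
is the `N`-th Taylor coefficient of `g`. -/
def HasResidueAt (f : ℂ → ℂ) (c R : ℂ) : Prop :=
  ∃ (N : ℕ) (g : ℂ → ℂ), AnalyticAt ℂ g c ∧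
    (∀ᶠ z in 𝓝[≠] c, f z = g z / (z - c) ^ (N + 1)) ∧ R = iteratedDeriv N g c / (N ! : ℂ)

/-- `F` continues the Dirichlet series `∑_{(n, q) = g} d_k(n) n ^ (-s)`, which converges absolutely
for `Re s > 1`, meromorphically to a neighbourhood of `s = 1`. Its germ at `1` is unique. -/
def IsContinuation (k g q : ℕ) (F : ℂ → ℂ) : Prop :=
  MeromorphicAt F 1 ∧
    ∀ s : ℂ, 1 < s.re → F s = LSeries (fun n => if n.gcd q = g then (d k n : ℂ) else 0) s

/-- `θ ∈ (0, 1]` is an exponent of distribution for `d_k` and the value `g` of the greatest common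
divisor: for every `ε > 0` there is a `δ > 0` such that, for all `q ≤ x ^ (θ - ε)` and all residue
classes `a ≢ 0 (mod q)` with `(a, q) = g`,
`∑_{n ≤ x, n ≡ a (q)} d_k(n) = Res_{s = 1} (x ^ s / s * ∑_{(n, q) = g} d_k(n) n ^ (-s)) / φ(q / g)
+ O(x ^ (1 - δ) / φ(q / g))`. The continuation `F` (as a germ at `1`) and the residue `R` exist and
are unique. -/
def IsExponentOfDistribution (g k : ℕ) (θ : ℝ) : Prop :=
  0 < θ ∧ θ ≤ 1 ∧
    ∀ ε : ℝ, 0 < ε → ∃ δ : ℝ, 0 < δ ∧ ∃ K : ℝ, ∀ x : ℝ, 1 ≤ x →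
      ∀ q : ℕ, 1 ≤ q → (q : ℝ) ≤ x ^ (θ - ε) →
        ∀ a : ℕ, a.gcd q = g → ¬ q ∣ a →
          ∀ (F : ℂ → ℂ) (R : ℂ), IsContinuation k g q F →
            HasResidueAt (fun s => (x : ℂ) ^ s / s * F s) 1 R →
              ‖((∑ n ∈ Finset.Icc 1 ⌊x⌋₊ with n ≡ a [MOD q], d k n : ℕ) : ℂ)
                  - R / (Nat.totient (q / g) : ℂ)‖
                ≤ K * (x ^ (1 - δ) / (Nat.totient (q / g) : ℝ))

/-! ### The constants in the leading coefficient -/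

/-- `C_{k,l}`. -/
def leadC (k l : ℕ) : ℝ :=
  ∏' p : Nat.Primes, ((1 - (p : ℝ)⁻¹) ^ (l - 1) + (1 - (p : ℝ)⁻¹) ^ (k - 1)
    - (1 - (p : ℝ)⁻¹) ^ (k + l - 2))

/-- `f_{k,l}(h)`. -/
def leadF (k l h : ℕ) : ℝ :=
  ∏ p ∈ h.primeFactors,
    ((1 - (p : ℝ)⁻¹) * (∑ α ∈ Finset.range (h.factorization p + 1), (d (l - 1) (p ^ α) : ℝ) *
          (∑' β : ℕ, (d k (p ^ (α + β)) : ℝ) * (p : ℝ)⁻¹ ^ (α + β)))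
        + (d k (p ^ h.factorization p) : ℝ) *
          (∑' β : ℕ, (d (l - 1) (p ^ (h.factorization p + 1 + β)) : ℝ) *
            (p : ℝ)⁻¹ ^ (h.factorization p + 1 + β)))
      / ((1 - (p : ℝ)⁻¹) ^ (1 - (k : ℤ)) + (1 - (p : ℝ)⁻¹) ^ (1 - (l : ℤ)) - 1)

/-! ### The explicit polynomial -/

/-- The entire function `(s - 1) ζ(s)`. -/
def zetaReg : ℂ → ℂ := Function.update (fun s => (s - 1) * riemannZeta s) 1 1

/-- `a_r(j)`, defined by `(s - 1) ^ j ζ(s) ^ j = ∑_r a_r(j) / r! * (s - 1) ^ r`. -/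
def aCoeff (r j : ℕ) : ℂ := iteratedDeriv r (fun s => zetaReg s ^ j) 1

/-- `c_n(j)`, the `n`-th Taylor coefficient of `(s - 1) ^ j ζ(s) ^ j / s` at `s = 1`. -/
def cCoeff (n j : ℕ) : ℂ := ∑ r ∈ Finset.range (n + 1), (-1) ^ (n - r) * aCoeff r j / (r ! : ℂ)

/-- The Euler product `C_{k,l}(s, w)`. -/
def eulerC (k l : ℕ) (s w : ℂ) : ℂ :=
  ∏' p : Nat.Primes, ((1 - (p : ℂ) ^ (-w - 1)) ^ (l - 1)
    + (1 - (p : ℂ) ^ (-s)) ^ k / (1 - (p : ℂ)⁻¹)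
    - (1 - (p : ℂ) ^ (-s)) ^ k * (1 - (p : ℂ) ^ (-w - 1)) ^ (l - 1) / (1 - (p : ℂ)⁻¹))

/-- The finite product `f_{h,k,l}(s, w)` over the primes dividing `h`. -/
def eulerF (h k l : ℕ) (s w : ℂ) : ℂ :=
  ∏ p ∈ h.primeFactors,
    ((1 - (p : ℂ)⁻¹) * (∑ α ∈ Finset.range (h.factorization p + 1), (d (l - 1) (p ^ α) : ℂ) *
          (∑' β : ℕ, (d k (p ^ (α + β)) : ℂ) * (p : ℂ) ^ (-((α : ℂ) + β) * s - α * w)))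
        + (d k (p ^ h.factorization p) : ℂ) * (p : ℂ) ^ ((h.factorization p : ℂ) * (1 - s)) *
          (∑' β : ℕ, (d (l - 1) (p ^ (h.factorization p + 1 + β)) : ℂ) *
            (p : ℂ) ^ (-((h.factorization p : ℂ) + 1 + β) * (w + 1))))
      / ((1 - (p : ℂ)⁻¹) * ((1 - (p : ℂ) ^ (-s)) ^ k)⁻¹
          + ((1 - (p : ℂ) ^ (-w - 1)) ^ (l - 1))⁻¹ - 1)

/-- The mixed derivative `∂_s^i ∂_w^j (C_{k,l}(s, w) f_{h,k,l}(s, w))` at `s = 1`, `w = 0`. -/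
def mixedDeriv (h k l i j : ℕ) : ℂ :=
  iteratedDeriv i (fun s => iteratedDeriv j (fun w => eulerC k l s w * eulerF h k l s w) 0) 1

/-- The coefficients `b_{h,k,l,m,n}`, for `m < k` and `n < l`. -/
def bCoeff (h k l m n : ℕ) : ℂ :=
  ∑ i ∈ Finset.range (k - m), ∑ j ∈ Finset.range (l - n),
    aCoeff (l - 1 - n - j) (l - 1) * cCoeff (k - 1 - m - i) k / ((l - 1 - n - j)! : ℂ)
      * (mixedDeriv h k l i j / ((i ! : ℂ) * (j ! : ℂ)))

/-- The coefficients `a_{A,h,k,l,m}`, for `m < k + l - 2`. Here `(descPochhammer ℂ j).eval y` is the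
falling factorial `y (y - 1) ⋯ (y - j + 1)`. -/
def secCoeff (A : ℝ) (h k l m : ℕ) : ℂ :=
  (-1) ^ m * ∑ j ∈ Finset.range k, ∑ t ∈ Finset.range (j + l), ∑ v ∈ Finset.range (j + l),
    if m + t + v + 2 ≤ j + l then
      (-(A : ℂ)) ^ ((l : ℤ) - 1 - t - v) * aCoeff v (l - 1) / ((v ! : ℂ) * (t ! : ℂ))
        * (descPochhammer ℂ j).eval ((v : ℂ) + t + 1 - l)
        * ∑ i ∈ Finset.Ico j k,
            (i.choose j : ℂ) * cCoeff (k - 1 - i) k / (i ! : ℂ) * mixedDeriv h k l (i - j) t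
    else 0

/-- The polynomial `P_{A,h,k,l}`. -/
def mainPoly (A : ℝ) (h k l : ℕ) : ℂ[X] :=
  (∑ m ∈ Finset.range k, ∑ n ∈ Finset.range l,
      C ((A : ℂ) ^ n * bCoeff h k l m n / ((m ! : ℂ) * (n ! : ℂ))) * X ^ (m + n))
    + ∑ m ∈ Finset.range (k + l - 2), C (secCoeff A h k l m / (m ! : ℂ)) * X ^ m

end

end AdditiveDivisor

/-! ### Functions that are polynomial in `log u` up to a power saving. -/

namespace AdditiveDivisor

open MeasureTheory Set Finset intervalIntegral

noncomputable section

/-! Since q ≤ n^A means n ≥ q^{1/A}, opening `dPartial` and interchanging the sums gives ∑_{q ≤ x^A}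
d_{l-1}(q) (D(x; q) - D(q^{1/A}; q)), up to O(h) terms at the shifted endpoints for each q. Here
D(y; q) is the sum of d_k(n) over n ≤ y with n ≡ h mod q (`sum_d_mul_dPartial_eq`,
`exists_shiftSum_sub_le`). Both values of y satisfy q ≤ y^A with A < θ, so the distribution
hypothesis replaces D(y; q) by y N_q(log y) with a power saving, and the errors can be summed
because ∑_{q ≤ u} d_{l-1}(q)/φ(q/(h,q)) ≪ u^ε. The hypothesis says nothing about q ∣ h, where the
class is 0; these finitely many q are handled unconditionally in `exists_residueSum_of_dvd`.

The polynomial N_q is a residue. The Dirichlet series of d_k over (n,q) = (h,q) is ζ(s)^k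
φ(q/(h,q))/q times a function `gcdFactor` that is multiplicative in q and entire in s
(`LSeries_gcd_eq`). Expanding at s = 1 separates q from log y (`C_mul_residuePoly`), and it remains
to sum d_{l-1}(q)/q against the Taylor coefficients of `gcdFactor` in s. For s near 1, d_{l-1} ·
`gcdFactor` is the convolution of d_{l-1} with `betaFn`, whose Dirichlet series converges absolutely
to the left of 1, uniformly in s. So the sums are polynomial in log u with an error uniform in s,
and Cauchy's estimate carries this to each Taylor coefficient (`exists_logAsymp_gcdTaylor`). The
Euler product identifies the series of `betaFn` at 1 + w with C_{k,l}(s,w) f_{h,k,l}(s,w), which is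
how the mixed derivatives enter (`mixedDeriv_eq`).

Partial summation over q then gives x P(log x) for any polynomial P with P + P' = ∑ (c_i + c_i')
Q_i(A·), where c_i is `cPoly` and Q_i is the polynomial of the i-th Taylor coefficient
(`exists_sum_mul_powEval_sub_le`). That the explicit polynomial satisfies this equation is
`mainPoly_add_derivative`.

No contour integration occurs. Asymptotics for d_k in a fixed residue class come from the hyperbola
method by induction on k (`powLog_dRes`), and the polynomials are then read off from the Dirichlet
series as w → 0+ (`LogAsymp.coeff_eq`). The coefficients are real because an asymptotic polynomial
is unique, and the degree is exact because the leading coefficient is built from positive Euler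
factors. -/

/-- The summatory function `u ↦ ∑_{1 ≤ n ≤ u} a(n)`. -/
def partialSum (a : ℕ → ℂ) (u : ℝ) : ℂ := ∑ n ∈ Finset.Icc 1 ⌊u⌋₊, a n

/-- `T(u) = P(log u) + O(u ^ (-δ))` for `u ≥ 1`. -/
def LogAsymp (T : ℝ → ℂ) (P : ℂ[X]) (δ : ℝ) : Prop :=
  ∃ K : ℝ, ∀ u : ℝ, 1 ≤ u → ‖T u - P.eval (Real.log u : ℂ)‖ ≤ K * u ^ (-δ)

/-- `T(u)` is a polynomial in `log u` up to a power saving error term. -/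
def PowLog (T : ℝ → ℂ) : Prop := ∃ (P : ℂ[X]) (δ : ℝ), 0 < δ ∧ LogAsymp T P δ

lemma exists_log_pow_le (n : ℕ) {ε : ℝ} (hε : 0 < ε) :
    ∃ K : ℝ, 0 ≤ K ∧ ∀ u : ℝ, 1 ≤ u → Real.log u ^ n ≤ K * u ^ ε := by
  -- The n-th power of log u ≤ u^η / η with η = ε / (n + 1); using n + 1 keeps η meaningful for n =
  -- 0.
  refine ⟨(((n : ℝ) + 1) / ε) ^ n, by positivity, fun u hu => ?_⟩
  have hn : (0 : ℝ) < n + 1 := by positivity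
  have h1 := Real.log_le_rpow_div (x := u) (by linarith) (div_pos hε hn)
  have h0 := Real.log_nonneg hu
  calc Real.log u ^ n ≤ (u ^ (ε / (n + 1)) / (ε / (n + 1))) ^ n := by gcongr
    _ = ((n + 1) / ε) ^ n * (u ^ (ε / (n + 1))) ^ n := by
        rw [← mul_pow]; congr 1; field_simp
    _ ≤ ((n + 1) / ε) ^ n * u ^ ε := by
        gcongr
        rw [← Real.rpow_natCast, ← Real.rpow_mul (by linarith)]
        apply Real.rpow_le_rpow_of_exponent_le hu
        rw [div_mul_eq_mul_div, div_le_iff₀ hn]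
        nlinarith

/-- The argument z is only bounded by log u, not equal to it, so that the estimate also covers κ log
t with u = t^κ, and log v for v < 1 with u = 1/v. -/
lemma exists_norm_eval_le (P : ℂ[X]) {ε : ℝ} (hε : 0 < ε) :
    ∃ K : ℝ, 0 ≤ K ∧ ∀ (u : ℝ) (z : ℂ), 1 ≤ u → ‖z‖ ≤ Real.log u → ‖P.eval z‖ ≤ K * u ^ ε := by
  induction P using Polynomial.induction_on' with
  | add p q hp hq =>
    obtain ⟨K, hK, h⟩ := hp
    obtain ⟨L, hL, h'⟩ := hq
    refine ⟨K + L, by positivity, fun u z hu hz => ?_⟩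
    rw [eval_add, add_mul]
    exact (norm_add_le _ _).trans (add_le_add (h u z hu hz) (h' u z hu hz))
  | monomial n c =>
    obtain ⟨K, hK, h⟩ := exists_log_pow_le n hε
    refine ⟨‖c‖ * K, by positivity, fun u z hu hz => ?_⟩
    rw [eval_monomial, norm_mul, norm_pow, mul_assoc]
    gcongr
    exact (pow_le_pow_left₀ (norm_nonneg _) hz n).trans (h u hu)

lemma norm_log_le {u : ℝ} (hu : 1 ≤ u) : ‖(Real.log u : ℂ)‖ ≤ Real.log u := by
  rw [Complex.norm_real, Real.norm_of_nonneg (Real.log_nonneg hu)]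

lemma LogAsymp.nonneg_const {T : ℝ → ℂ} {P : ℂ[X]} {δ : ℝ} (h : LogAsymp T P δ) :
    ∃ K : ℝ, 0 ≤ K ∧ ∀ u : ℝ, 1 ≤ u → ‖T u - P.eval (Real.log u : ℂ)‖ ≤ K * u ^ (-δ) := by
  obtain ⟨K, hK⟩ := h
  refine ⟨|K|, abs_nonneg _, fun u hu => (hK u hu).trans ?_⟩
  gcongr
  exact le_abs_self K

lemma LogAsymp.mono {T : ℝ → ℂ} {P : ℂ[X]} {δ δ' : ℝ} (h : LogAsymp T P δ) (hδ : δ' ≤ δ) :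
    LogAsymp T P δ' := by
  obtain ⟨K, hK0, hK⟩ := h.nonneg_const
  refine ⟨K, fun u hu => (hK u hu).trans ?_⟩
  gcongr

lemma LogAsymp.congr {T T' : ℝ → ℂ} {P : ℂ[X]} {δ : ℝ} (h : LogAsymp T P δ)
    (hT : ∀ u : ℝ, 1 ≤ u → T' u = T u) : LogAsymp T' P δ := by
  obtain ⟨K, hK⟩ := h
  exact ⟨K, fun u hu => by rw [hT u hu]; exact hK u hu⟩

lemma PowLog.congr {T T' : ℝ → ℂ} (h : PowLog T) (hT : ∀ u : ℝ, 1 ≤ u → T' u = T u) :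
    PowLog T' := by
  obtain ⟨P, δ, hδ, h⟩ := h
  exact ⟨P, δ, hδ, h.congr hT⟩

lemma LogAsymp.add {T T' : ℝ → ℂ} {P P' : ℂ[X]} {δ : ℝ} (h : LogAsymp T P δ)
    (h' : LogAsymp T' P' δ) : LogAsymp (fun u => T u + T' u) (P + P') δ := by
  obtain ⟨K, hK⟩ := h
  obtain ⟨K', hK'⟩ := h'
  refine ⟨K + K', fun u hu => ?_⟩
  rw [eval_add, add_mul, add_sub_add_comm]
  exact (norm_add_le _ _).trans (add_le_add (hK u hu) (hK' u hu))

lemma PowLog.add {T T' : ℝ → ℂ} (h : PowLog T) (h' : PowLog T') :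
    PowLog (fun u => T u + T' u) := by
  obtain ⟨P, δ, hδ, h⟩ := h
  obtain ⟨P', δ', hδ', h'⟩ := h'
  exact ⟨P + P', min δ δ', lt_min hδ hδ', (h.mono (min_le_left _ _)).add (h'.mono (min_le_right _ _))⟩

lemma LogAsymp.zero (δ : ℝ) : LogAsymp (fun _ => 0) 0 δ := ⟨0, by simp⟩

lemma PowLog.zero : PowLog (fun _ => 0) := ⟨0, 1, one_pos, LogAsymp.zero 1⟩

lemma PowLog.sum {ι : Type*} (s : Finset ι) {T : ι → ℝ → ℂ} (h : ∀ i ∈ s, PowLog (T i)) :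
    PowLog (fun u => ∑ i ∈ s, T i u) := by
  classical
  induction s using Finset.induction_on with
  | empty => simpa using PowLog.zero
  | insert i s hi ih =>
    simp only [Finset.sum_insert hi]
    exact (h i (by simp)).add (ih fun j hj => h j (by simp [hj]))

lemma LogAsymp.norm_le {T : ℝ → ℂ} {P : ℂ[X]} {δ : ℝ} (h : LogAsymp T P δ) (hδ : 0 ≤ δ)
    {ε : ℝ} (hε : 0 < ε) : ∃ K : ℝ, 0 ≤ K ∧ ∀ u : ℝ, 1 ≤ u → ‖T u‖ ≤ K * u ^ ε := by
  obtain ⟨K, hK0, hK⟩ := h.nonneg_const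
  obtain ⟨L, hL0, hL⟩ := exists_norm_eval_le P hε
  refine ⟨K + L, by positivity, fun u hu => ?_⟩
  calc ‖T u‖ = ‖(T u - P.eval (Real.log u : ℂ)) + P.eval (Real.log u : ℂ)‖ := by simp
    _ ≤ K * u ^ (-δ) + L * u ^ ε :=
        (norm_add_le _ _).trans (add_le_add (hK u hu) (hL u _ hu (norm_log_le hu)))
    _ ≤ (K + L) * u ^ ε := by
        rw [add_mul]; gcongr
        linarith

lemma PowLog.mul {T T' : ℝ → ℂ} (h : PowLog T) (h' : PowLog T') :
    PowLog (fun u => T u * T' u) := by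
  obtain ⟨P, δ, hδ, h⟩ := h
  obtain ⟨P', δ', hδ', h'⟩ := h'
  -- From T T' - P P' = T (T' - P') + (T - P) P': each error saves u^ε, and the other factor costs
  -- only u^{ε/2}.
  set ε := min δ δ' with hε
  have hε0 : 0 < ε := lt_min hδ hδ'
  have h1 := h.mono (min_le_left δ δ')
  have h2 := h'.mono (min_le_right δ δ')
  rw [← hε] at h1 h2
  obtain ⟨K, hK0, hK⟩ := h1.nonneg_const
  obtain ⟨K', hK0', hK'⟩ := h2.nonneg_const
  obtain ⟨L, hL0, hL⟩ := h1.norm_le hε0.le (half_pos hε0)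
  obtain ⟨L', hL0', hL'⟩ := exists_norm_eval_le P' (half_pos hε0)
  refine ⟨P * P', ε / 2, half_pos hε0, L * K' + K * L', fun u hu => ?_⟩
  have hu0 : 0 < u := by linarith
  have key : u ^ (ε / 2) * u ^ (-ε) = u ^ (-(ε / 2)) := by
    rw [← Real.rpow_add hu0]; congr 1; ring
  calc ‖T u * T' u - (P * P').eval (Real.log u : ℂ)‖
      = ‖T u * (T' u - P'.eval (Real.log u : ℂ))
          + (T u - P.eval (Real.log u : ℂ)) * P'.eval (Real.log u : ℂ)‖ := by
        rw [eval_mul]; congr 1; ring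
    _ ≤ (L * u ^ (ε / 2)) * (K' * u ^ (-ε)) + (K * u ^ (-ε)) * (L' * u ^ (ε / 2)) := by
        refine (norm_add_le _ _).trans ?_
        rw [norm_mul, norm_mul]
        have a1 := hL u hu
        have a2 := hK' u hu
        have a3 := hK u hu
        have a4 := hL' u _ hu (norm_log_le hu)
        gcongr
    _ = (L * K' + K * L') * u ^ (-(ε / 2)) := by rw [← key]; ring

lemma PowLog.eval_log (P : ℂ[X]) : PowLog (fun u => P.eval (Real.log u : ℂ)) :=
  ⟨P, 1, one_pos, 0, by simp⟩

lemma PowLog.const (c : ℂ) : PowLog (fun _ => c) := by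
  simpa using PowLog.eval_log (Polynomial.C c)

lemma PowLog.of_norm_le {T : ℝ → ℂ} {K δ : ℝ} (hδ : 0 < δ)
    (h : ∀ u : ℝ, 1 ≤ u → ‖T u‖ ≤ K * u ^ (-δ)) : PowLog T :=
  ⟨0, δ, hδ, K, by simpa using h⟩

lemma PowLog.comp_sqrt {T : ℝ → ℂ} (h : PowLog T) : PowLog (fun u => T (Real.sqrt u)) := by
  obtain ⟨P, δ, hδ, K, hK⟩ := h
  refine ⟨P.comp (Polynomial.C (1 / 2) * Polynomial.X), δ / 2, half_pos hδ, K, fun u hu => ?_⟩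
  have h1 := hK (Real.sqrt u) (Real.one_le_sqrt.mpr hu)
  have h2 : Real.log (Real.sqrt u) = 1 / 2 * Real.log u := by
    rw [Real.log_sqrt (by linarith)]; ring
  have h3 : Real.sqrt u ^ (-δ) = u ^ (-(δ / 2)) := by
    rw [Real.sqrt_eq_rpow, ← Real.rpow_mul (by linarith)]; congr 1; ring
  rw [h2, h3] at h1
  simpa [eval_comp] using h1

/-! ### Partial summation -/

/-- Partial summation formulas starting at 0 become available once the term n = 0 is set to zero. -/
lemma partialSum_eq_sum_Icc_zero (a : ℕ → ℂ) (u : ℝ) :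
    ∑ n ∈ Finset.Icc 0 ⌊u⌋₊, (if n = 0 then 0 else a n) = partialSum a u := by
  rw [partialSum, ← Finset.sum_subset (Finset.Icc_subset_Icc_left (Nat.zero_le 1))]
  · refine Finset.sum_congr rfl fun n hn => ?_
    rw [if_neg (by have := (Finset.mem_Icc.mp hn).1; omega)]
  · intro n hn hn'
    simp only [Finset.mem_Icc] at hn hn'
    rw [if_pos (by omega)]

lemma integrableOn_mul_partialSum (a : ℕ → ℂ) {f : ℝ → ℂ} {X : ℝ}
    (hf : ContinuousOn f (Set.Icc 1 X)) :
    IntegrableOn (fun t => f t * partialSum a t) (Set.Icc 1 X) := by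
  have := integrableOn_mul_sum_Icc (m := 0) (fun n => if n = 0 then 0 else a n) (a := 1) (b := X) zero_le_one
    (hf.integrableOn_compact isCompact_Icc)
  simpa only [partialSum_eq_sum_Icc_zero] using this

lemma intervalIntegrable_mul_partialSum (a : ℕ → ℂ) {f : ℝ → ℂ} {X : ℝ} (hX : 1 ≤ X)
    (hf : ContinuousOn f (Set.Icc 1 X)) :
    IntervalIntegrable (fun t => f t * partialSum a t) volume 1 X :=
  (intervalIntegrable_iff_integrableOn_Icc_of_le hX).mpr (integrableOn_mul_partialSum a hf)

/-- Partial summation. -/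
lemma sum_mul_sub_eq_integral (a : ℕ → ℂ) {f f' : ℝ → ℂ} {X : ℝ} (hX : 1 ≤ X)
    (hf : ∀ t ∈ Set.Icc 1 X, HasDerivAt f (f' t) t) (hf' : ContinuousOn f' (Set.Icc 1 X)) :
    ∑ n ∈ Finset.Icc 1 ⌊X⌋₊, a n * (f X - f n) = ∫ t in (1 : ℝ)..X, f' t * partialSum a t := by
  have hd : Set.EqOn (deriv f) f' (Set.Icc 1 X) := fun t ht => (hf t ht).deriv
  have h := sum_mul_eq_sub_integral_mul₀ (fun n => if n = 0 then 0 else a n) (if_pos rfl) X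
    (fun t ht => (hf t ht).differentiableAt)
    ((hf'.integrableOn_compact isCompact_Icc).congr_fun hd.symm measurableSet_Icc)
  have e1 : ∑ n ∈ Finset.Icc 0 ⌊X⌋₊, f n * (if n = 0 then 0 else a n)
      = partialSum (fun n => f n * a n) X := by
    rw [← partialSum_eq_sum_Icc_zero]
    exact Finset.sum_congr rfl fun n _ => by split_ifs <;> simp
  have e2 : ∫ t in Set.Ioc 1 X, deriv f t * ∑ k ∈ Finset.Icc 0 ⌊t⌋₊, (if k = 0 then 0 else a k)
      = ∫ t in (1 : ℝ)..X, f' t * partialSum a t := by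
    rw [integral_of_le hX]
    refine setIntegral_congr_fun measurableSet_Ioc fun t ht => ?_
    simp only [partialSum_eq_sum_Icc_zero, hd (Set.Ioc_subset_Icc_self ht)]
  rw [e1, e2, partialSum_eq_sum_Icc_zero] at h
  have : ∑ n ∈ Finset.Icc 1 ⌊X⌋₊, a n * (f X - f n)
      = f X * partialSum a X - partialSum (fun n => f n * a n) X := by
    rw [partialSum, partialSum, Finset.mul_sum, ← Finset.sum_sub_distrib]
    exact Finset.sum_congr rfl fun n _ => by ring
  rw [this, h]; ring

/-- A function that decays faster than `1 / t` has a convergent integral with a power saving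
tail. -/
lemma exists_integral_tail {E : ℝ → ℂ} {K δ : ℝ} (hδ : 0 < δ)
    (hint : ∀ X : ℝ, 1 ≤ X → IntegrableOn E (Set.Icc 1 X))
    (hE : ∀ t : ℝ, 1 ≤ t → ‖E t‖ ≤ K * t ^ (-1 - δ)) :
    ∃ c : ℂ, ∀ X : ℝ, 1 ≤ X → ‖(∫ t in (1 : ℝ)..X, E t) - c‖ ≤ K / δ * X ^ (-δ) := by
  have hg : ∀ X : ℝ, 1 ≤ X → IntegrableOn (fun t : ℝ => K * t ^ (-1 - δ)) (Set.Ioi X) := fun X hX =>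
    (integrableOn_Ioi_rpow_of_lt (by linarith) (by linarith)).const_mul K
  have hm : AEStronglyMeasurable E (volume.restrict (Set.Ioi 1)) := by
    have : Set.Ioi (1 : ℝ) ⊆ ⋃ n : ℕ, Set.Icc 1 ((n : ℝ) + 1) := fun t ht => by
      obtain ⟨n, hn⟩ := exists_nat_ge t
      exact Set.mem_iUnion.mpr ⟨n, (Set.mem_Ioi.mp ht).le, by linarith⟩
    refine AEStronglyMeasurable.mono_set this ?_
    rw [aestronglyMeasurable_iUnion_iff]
    exact fun n => (hint _ (by linarith [n.cast_nonneg (α := ℝ)])).aestronglyMeasurable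
  have hI : IntegrableOn E (Set.Ioi 1) := by
    refine Integrable.mono' (hg 1 le_rfl) hm ?_
    exact (ae_restrict_iff' measurableSet_Ioi).mpr (ae_of_all _ fun t ht => hE t (Set.mem_Ioi.mp ht).le)
  refine ⟨∫ t in Set.Ioi 1, E t, fun X hX => ?_⟩
  have hs : (∫ t in Set.Ioi 1, E t) = (∫ t in (1 : ℝ)..X, E t) + ∫ t in Set.Ioi X, E t := by
    rw [intervalIntegral.integral_interval_add_Ioi hI (hI.mono_set (Set.Ioi_subset_Ioi hX))]
  rw [hs, sub_add_cancel_left, norm_neg]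
  calc ‖∫ t in Set.Ioi X, E t‖ ≤ ∫ t in Set.Ioi X, K * t ^ (-1 - δ) := by
        refine norm_integral_le_of_norm_le (hg X hX) ?_
        exact (ae_restrict_iff' measurableSet_Ioi).mpr
          (ae_of_all _ fun t ht => hE t (hX.trans (Set.mem_Ioi.mp ht).le))
    _ = K / δ * X ^ (-δ) := by
        rw [MeasureTheory.integral_const_mul, integral_Ioi_rpow_of_lt (by linarith) (by linarith)]
        rw [show -1 - δ + 1 = -δ by ring]
        field_simp

lemma continuous_eval_mul_log (P : ℂ[X]) (κ : ℂ) {X : ℝ} :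
    ContinuousOn (fun t : ℝ => P.eval (κ * (Real.log t : ℂ))) (Set.Icc 1 X) := by
  refine P.continuous.comp_continuousOn (continuousOn_const.mul ?_)
  exact Complex.continuous_ofReal.comp_continuousOn
    (Real.continuousOn_log.mono fun t ht => by
      simp only [Set.mem_compl_iff, Set.mem_singleton_iff]; linarith [ht.1])

lemma hasDerivAt_ofReal_log {t : ℝ} (ht : t ≠ 0) :
    HasDerivAt (fun t : ℝ => (Real.log t : ℂ)) ((t : ℂ)⁻¹) t := by
  simpa using (Real.hasDerivAt_log ht).ofReal_comp

lemma exists_derivative_eq (P : ℂ[X]) : ∃ Q : ℂ[X], derivative Q = P := by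
  induction P using Polynomial.induction_on' with
  | add p q hp hq =>
    obtain ⟨p', rfl⟩ := hp
    obtain ⟨q', rfl⟩ := hq
    exact ⟨p' + q', by simp⟩
  | monomial n c =>
    refine ⟨monomial (n + 1) (c / (n + 1)), ?_⟩
    rw [derivative_monomial]
    have : (n : ℂ) + 1 ≠ 0 := by exact_mod_cast n.succ_ne_zero
    simp [this]

/-- With Q' = P, the function P(log t)/t integrates to Q(log X) - Q(0). The error is O(t^{-1-δ}), so
its integral tends to a constant with a power-saving tail. -/
lemma PowLog.integral_div {a : ℕ → ℂ} (h : PowLog (partialSum a)) :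
    PowLog (fun X => ∫ t in (1 : ℝ)..X, (t : ℂ)⁻¹ * partialSum a t) := by
  obtain ⟨P, δ, hδ, h⟩ := h
  obtain ⟨K, hK0, hK⟩ := h.nonneg_const
  obtain ⟨Q, rfl⟩ := exists_derivative_eq P
  have hc : ∀ X : ℝ, ContinuousOn (fun t : ℝ => (t : ℂ)⁻¹) (Set.Icc 1 X) := fun X =>
    Complex.continuous_ofReal.continuousOn.inv₀ fun t ht => by
      have : (0 : ℝ) < t := by linarith [ht.1]
      exact_mod_cast this.ne'
  have hcQ : ∀ X : ℝ, ContinuousOn (fun t : ℝ => (t : ℂ)⁻¹ * (derivative Q).eval (Real.log t : ℂ))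
      (Set.Icc 1 X) := fun X =>
    (hc X).mul (by simpa using continuous_eval_mul_log (derivative Q) 1)
  set E : ℝ → ℂ := fun t => (t : ℂ)⁻¹ * partialSum a t - (t : ℂ)⁻¹ * (derivative Q).eval (Real.log t : ℂ)
    with hE
  have hi : ∀ X : ℝ, 1 ≤ X → IntegrableOn E (Set.Icc 1 X) := fun X hX =>
    (integrableOn_mul_partialSum a (hc X)).sub ((hcQ X).integrableOn_compact isCompact_Icc)
  obtain ⟨c, hc'⟩ := exists_integral_tail hδ hi (K := K) fun t ht => by
    have ht0 : 0 < t := by linarith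
    rw [hE]
    simp only
    rw [← mul_sub, norm_mul, norm_inv, Complex.norm_real, Real.norm_of_nonneg ht0.le]
    calc t⁻¹ * ‖partialSum a t - (derivative Q).eval (Real.log t : ℂ)‖ ≤ t⁻¹ * (K * t ^ (-δ)) := by
          gcongr; exact hK t ht
      _ = K * t ^ (-1 - δ) := by
          rw [sub_eq_add_neg, Real.rpow_add ht0, Real.rpow_neg_one]; ring
  refine ⟨Q + Polynomial.C (c - Q.eval 0), δ, hδ, K / δ, fun X hX => ?_⟩
  have hmain : ∫ t in (1 : ℝ)..X, (t : ℂ)⁻¹ * (derivative Q).eval (Real.log t : ℂ)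
      = Q.eval (Real.log X : ℂ) - Q.eval 0 := by
    have := intervalIntegral.integral_eq_sub_of_hasDerivAt_of_le (a := 1) (b := X) hX
      (f := fun t : ℝ => Q.eval (Real.log t : ℂ))
      (f' := fun t : ℝ => (t : ℂ)⁻¹ * (derivative Q).eval (Real.log t : ℂ))
      (by simpa using continuous_eval_mul_log Q 1 (X := X)) (fun t ht => by
        have ht0 : t ≠ 0 := by linarith [ht.1]
        have := (Q.hasDerivAt (Real.log t : ℂ)).comp_of_eq t (hasDerivAt_ofReal_log ht0) rfl
        rw [mul_comm]
        exact this)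
      ((hcQ X).intervalIntegrable_of_Icc hX)
    simpa using this
  have hsplit : ∫ t in (1 : ℝ)..X, (t : ℂ)⁻¹ * partialSum a t
      = (∫ t in (1 : ℝ)..X, E t) + (Q.eval (Real.log X : ℂ) - Q.eval 0) := by
    rw [← hmain, ← intervalIntegral.integral_add]
    · simp [hE]
    · exact (intervalIntegrable_iff_integrableOn_Icc_of_le hX).mpr (hi X hX)
    · exact (hcQ X).intervalIntegrable_of_Icc hX
  beta_reduce
  rw [hsplit]
  convert! hc' X hX using 2
  simp
  ring

/-- Partial summation with f = log: the weighted sum is log X times the partial sum, minus the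
integral treated in `PowLog.integral_div`. -/
lemma PowLog.log_mul {a : ℕ → ℂ} (h : PowLog (partialSum a)) :
    PowLog (partialSum fun n => (Real.log n : ℂ) * a n) := by
  have h1 := ((PowLog.eval_log Polynomial.X).mul h).add ((PowLog.const (-1)).mul h.integral_div)
  refine h1.congr fun X hX => ?_
  have := sum_mul_sub_eq_integral a (f := fun t : ℝ => (Real.log t : ℂ))
    (f' := fun t : ℝ => (t : ℂ)⁻¹) hX
    (fun t ht => hasDerivAt_ofReal_log (by linarith [ht.1]))
    (Complex.continuous_ofReal.continuousOn.inv₀ fun t ht => by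
      have : (0 : ℝ) < t := by linarith [ht.1]
      exact_mod_cast this.ne')
  rw [← this, partialSum, partialSum, Polynomial.eval_X, neg_one_mul, ← sub_eq_add_neg,
    Finset.mul_sum, ← Finset.sum_sub_distrib]
  exact Finset.sum_congr rfl fun n _ => by ring

lemma PowLog.log_pow_mul {a : ℕ → ℂ} (h : PowLog (partialSum a)) (i : ℕ) :
    PowLog (partialSum fun n => (Real.log n : ℂ) ^ i * a n) := by
  induction i with
  | zero => simpa using h
  | succ i ih => simpa [pow_succ', mul_assoc] using ih.log_mul

/-! ### The Dirichlet hyperbola method. -/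

/-- The sums `∑_{n ≤ u} |a(n)|` are `O(u ^ ε)` for every `ε > 0`. -/
def SubPoly (a : ℕ → ℂ) : Prop :=
  ∀ ε : ℝ, 0 < ε → ∃ K : ℝ, 0 ≤ K ∧ ∀ u : ℝ, 1 ≤ u → ∑ n ∈ Finset.Icc 1 ⌊u⌋₊, ‖a n‖ ≤ K * u ^ ε

/-- Taylor's formula with divided derivatives; it separates log u from log i in Q(log(u/i)). -/
lemma eval_sub_eq_sum (Q : ℂ[X]) (L M : ℂ) :
    Q.eval (L - M)
      = ∑ n ∈ Finset.range (Q.natDegree + 1), (hasseDeriv n Q).eval L * (-M) ^ n := by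
  have h := taylor_eval L Q (-M)
  rw [show -M + L = L - M by ring] at h
  rw [← h, eval_eq_sum_range, natDegree_taylor]
  simp [taylor_coeff]

/-- Half of the Dirichlet hyperbola method. -/
lemma PowLog.sum_le_sqrt {a : ℕ → ℂ} {B : ℝ → ℂ} (ha : PowLog (partialSum a)) (ha' : SubPoly a)
    (hB : PowLog B) :
    PowLog (fun u => ∑ i ∈ Finset.Icc 1 ⌊Real.sqrt u⌋₊, a i * B (u / i)) := by
  obtain ⟨Q, δ, hδ, hQ⟩ := hB
  obtain ⟨K, hK0, hK⟩ := hQ.nonneg_const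
  obtain ⟨L, hL0, hL⟩ := ha' (δ / 2) (half_pos hδ)
  -- The main term ∑ a(i) Q(log u - log i) after Taylor expansion: each power of log i is a weight
  -- to which `PowLog.log_pow_mul` applies.
  have hmain : PowLog (fun u => ∑ n ∈ Finset.range (Q.natDegree + 1),
      ((hasseDeriv n Q).eval (Real.log u : ℂ)) *
        ((-1) ^ n * partialSum (fun i => (Real.log i : ℂ) ^ n * a i) (Real.sqrt u))) :=
    PowLog.sum _ fun n _ => (PowLog.eval_log _).mul
      ((PowLog.const _).mul (ha.log_pow_mul n).comp_sqrt)
  -- For i ≤ √u one has u/i ≥ √u, so each error is at most K (√u)^{-δ}. Summing |a(i)| costs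
  -- (√u)^{δ/2}, which leaves u^{-δ/4}.
  have herr : PowLog (fun u => ∑ i ∈ Finset.Icc 1 ⌊Real.sqrt u⌋₊,
      a i * (B (u / i) - Q.eval (Real.log (u / i) : ℂ))) := by
    refine PowLog.of_norm_le (K := K * L) (δ := δ / 4) (by positivity) fun u hu => ?_
    have hu0 : 0 < u := by linarith
    have hs : 1 ≤ Real.sqrt u := Real.one_le_sqrt.mpr hu
    have hs0 : 0 < Real.sqrt u := by linarith
    calc ‖∑ i ∈ Finset.Icc 1 ⌊Real.sqrt u⌋₊, a i * (B (u / i) - Q.eval (Real.log (u / i) : ℂ))‖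
        ≤ ∑ i ∈ Finset.Icc 1 ⌊Real.sqrt u⌋₊, ‖a i‖ * (K * Real.sqrt u ^ (-δ)) := by
          refine norm_sum_le_of_le _ fun i hi => ?_
          rw [norm_mul]
          have hi1 : (1 : ℝ) ≤ i := by exact_mod_cast (Finset.mem_Icc.mp hi).1
          have hi2 : (i : ℝ) ≤ Real.sqrt u :=
            (Nat.le_floor_iff hs0.le).mp (Finset.mem_Icc.mp hi).2
          have h1 : Real.sqrt u ≤ u / i := by
            rw [le_div_iff₀ (by linarith)]
            calc Real.sqrt u * i ≤ Real.sqrt u * Real.sqrt u := by gcongr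
              _ = u := Real.mul_self_sqrt hu0.le
          gcongr
          refine (hK _ (hs.trans h1)).trans ?_
          gcongr ?_ * ?_
          exact Real.rpow_le_rpow_of_nonpos hs0 h1 (by linarith)
      _ = (∑ i ∈ Finset.Icc 1 ⌊Real.sqrt u⌋₊, ‖a i‖) * (K * Real.sqrt u ^ (-δ)) := by
          rw [Finset.sum_mul]
      _ ≤ (L * Real.sqrt u ^ (δ / 2)) * (K * Real.sqrt u ^ (-δ)) := by
          gcongr; exact hL _ hs
      _ = K * L * (Real.sqrt u ^ (δ / 2) * Real.sqrt u ^ (-δ)) := by ring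
      _ = K * L * u ^ (-(δ / 4)) := by
          rw [← Real.rpow_add hs0, Real.sqrt_eq_rpow, ← Real.rpow_mul hu0.le]
          congr 2; ring
  refine (hmain.add herr).congr fun u hu => ?_
  have : ∑ n ∈ Finset.range (Q.natDegree + 1), ((hasseDeriv n Q).eval (Real.log u : ℂ)) *
        ((-1) ^ n * partialSum (fun i => (Real.log i : ℂ) ^ n * a i) (Real.sqrt u))
      = ∑ i ∈ Finset.Icc 1 ⌊Real.sqrt u⌋₊, a i * Q.eval (Real.log (u / i) : ℂ) := by
    simp only [partialSum, Finset.mul_sum]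
    rw [Finset.sum_comm]
    refine Finset.sum_congr rfl fun i hi => ?_
    have hi1 : (i : ℝ) ≠ 0 := by
      have := (Finset.mem_Icc.mp hi).1
      exact_mod_cast (by omega : i ≠ 0)
    rw [Real.log_div (by linarith) hi1, Complex.ofReal_sub, eval_sub_eq_sum, Finset.mul_sum]
    refine Finset.sum_congr rfl fun n _ => ?_
    rw [neg_pow]; ring
  rw [this, ← Finset.sum_add_distrib]
  exact Finset.sum_congr rfl fun i _ => by ring

lemma partialSum_mul (a b : ArithmeticFunction ℂ) (u : ℝ) :
    partialSum (a * b : ArithmeticFunction ℂ) u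
      = ∑ i ∈ Finset.Icc 1 ⌊u⌋₊, a i * partialSum b (u / i) := by
  have h := ArithmeticFunction.sum_Ioc_mul_eq_sum_sum a b ⌊u⌋₊
  simp only [partialSum, Nat.floor_div_natCast]
  -- On ℕ the intervals `Ioc 0 N` and `Icc 1 N` agree definitionally.
  exact h

lemma floor_sqrt_eq {u : ℝ} (hu : 0 ≤ u) : ⌊Real.sqrt u⌋₊ = Nat.sqrt ⌊u⌋₊ := by
  rw [Nat.floor_eq_iff (Real.sqrt_nonneg u)]
  constructor
  · apply Real.le_sqrt_of_sq_le
    have h1 : Nat.sqrt ⌊u⌋₊ * Nat.sqrt ⌊u⌋₊ ≤ ⌊u⌋₊ := Nat.sqrt_le _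
    have h2 := Nat.floor_le hu
    calc ((Nat.sqrt ⌊u⌋₊ : ℕ) : ℝ) ^ 2 = ((Nat.sqrt ⌊u⌋₊ * Nat.sqrt ⌊u⌋₊ : ℕ) : ℝ) := by
          push_cast; ring
      _ ≤ (⌊u⌋₊ : ℝ) := by exact_mod_cast h1
      _ ≤ u := h2
  · rw [Real.sqrt_lt' (by positivity)]
    have h1 : ⌊u⌋₊ < (Nat.sqrt ⌊u⌋₊ + 1) * (Nat.sqrt ⌊u⌋₊ + 1) := Nat.lt_succ_sqrt _
    have h2 := Nat.lt_floor_add_one u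
    calc u < (⌊u⌋₊ : ℝ) + 1 := h2
      _ ≤ (((Nat.sqrt ⌊u⌋₊ + 1) * (Nat.sqrt ⌊u⌋₊ + 1) : ℕ) : ℝ) := by exact_mod_cast h1
      _ = _ := by push_cast; ring

/-- The Dirichlet hyperbola method. -/
lemma partialSum_mul_eq_hyperbola (a b : ArithmeticFunction ℂ) {u : ℝ} (hu : 0 ≤ u) :
    partialSum (a * b : ArithmeticFunction ℂ) u
      = ∑ i ∈ Finset.Icc 1 ⌊Real.sqrt u⌋₊, a i * partialSum b (u / i)
        + ∑ j ∈ Finset.Icc 1 ⌊Real.sqrt u⌋₊, b j * partialSum a (u / j)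
        - partialSum a (Real.sqrt u) * partialSum b (Real.sqrt u) := by
  set N := ⌊u⌋₊ with hN
  set Y := Nat.sqrt N with hY
  have hYN : Y * Y ≤ N := Nat.sqrt_le _
  have hYN' : N < (Y + 1) * (Y + 1) := Nat.lt_succ_sqrt _
  have hYle : Y ≤ N := Nat.sqrt_le_self _
  simp only [floor_sqrt_eq hu, partialSum, Nat.floor_div_natCast, ← hN, ← hY]
  set s : Finset (ℕ × ℕ) :=
    (Finset.Icc 1 N ×ˢ Finset.Icc 1 N).filter fun x => x.1 * x.2 ≤ N with hs
  have h0 : ∑ n ∈ Finset.Icc 1 N, (a * b : ArithmeticFunction ℂ) n = ∑ x ∈ s, a x.1 * b x.2 :=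
    ArithmeticFunction.sum_Ioc_mul_eq_sum_prod_filter a b N
  -- If both coordinates exceeded Y their product would be at least (Y + 1)², which is larger than
  -- N. The overlap of the two pieces is the full square, because Y² ≤ N.
  have hu12 : s = s.filter (fun x => x.1 ≤ Y) ∪ s.filter (fun x => x.2 ≤ Y) := by
    ext x
    simp only [hs, Finset.mem_union, Finset.mem_filter, Finset.mem_product, Finset.mem_Icc]
    constructor
    · intro hx
      by_cases h1 : x.1 ≤ Y
      · exact Or.inl ⟨hx, h1⟩
      · refine Or.inr ⟨hx, ?_⟩
        by_contra h2
        push Not at h1 h2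
        have := Nat.mul_le_mul (Nat.succ_le_of_lt h1) (Nat.succ_le_of_lt h2)
        simp only [Nat.succ_eq_add_one] at this
        omega
    · rintro (h | h) <;> exact h.1
  have h3 : s.filter (fun x => x.1 ≤ Y) ∩ s.filter (fun x => x.2 ≤ Y)
      = Finset.Icc 1 Y ×ˢ Finset.Icc 1 Y := by
    ext x
    simp only [hs, Finset.mem_inter, Finset.mem_filter, Finset.mem_product, Finset.mem_Icc]
    constructor
    · rintro ⟨⟨⟨h1, h2⟩, h3⟩, h4⟩
      exact ⟨⟨h1.1.1, h3⟩, h1.2.1, h4.2⟩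
    · rintro ⟨⟨h1, h2⟩, h3, h4⟩
      have := Nat.mul_le_mul h2 h4
      exact ⟨⟨⟨⟨⟨h1, by omega⟩, h3, by omega⟩, by omega⟩, h2⟩,
        ⟨⟨⟨h1, by omega⟩, h3, by omega⟩, by omega⟩, h4⟩
  have h1 : ∑ x ∈ s.filter (fun x => x.1 ≤ Y), a x.1 * b x.2
      = ∑ i ∈ Finset.Icc 1 Y, a i * ∑ n ∈ Finset.Icc 1 (N / i), b n := by
    simp only [Finset.mul_sum]
    rw [Finset.sum_sigma']
    refine Finset.sum_nbij' (fun x => ⟨x.1, x.2⟩) (fun x => (x.1, x.2)) ?_ ?_ ?_ ?_ ?_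
    · intro x hx
      simp only [hs, Finset.mem_filter, Finset.mem_product, Finset.mem_Icc] at hx
      simp only [Finset.mem_sigma, Finset.mem_Icc]
      exact ⟨⟨hx.1.1.1.1, hx.2⟩, hx.1.1.2.1,
        (Nat.le_div_iff_mul_le hx.1.1.1.1).mpr (by rw [mul_comm]; exact hx.1.2)⟩
    · intro x hx
      simp only [Finset.mem_sigma, Finset.mem_Icc] at hx
      have := (Nat.le_div_iff_mul_le hx.1.1).mp hx.2.2
      simp only [hs, Finset.mem_filter, Finset.mem_product, Finset.mem_Icc]
      refine ⟨⟨⟨⟨hx.1.1, by omega⟩, hx.2.1, ?_⟩, by rw [mul_comm]; exact this⟩, hx.1.2⟩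
      nlinarith [hx.1.1]
    · simp
    · simp
    · simp
  have h2 : ∑ x ∈ s.filter (fun x => x.2 ≤ Y), a x.1 * b x.2
      = ∑ j ∈ Finset.Icc 1 Y, b j * ∑ n ∈ Finset.Icc 1 (N / j), a n := by
    simp only [Finset.mul_sum]
    rw [Finset.sum_sigma']
    refine Finset.sum_nbij' (fun x => ⟨x.2, x.1⟩) (fun x => (x.2, x.1)) ?_ ?_ ?_ ?_ ?_
    · intro x hx
      simp only [hs, Finset.mem_filter, Finset.mem_product, Finset.mem_Icc] at hx
      simp only [Finset.mem_sigma, Finset.mem_Icc]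
      exact ⟨⟨hx.1.1.2.1, hx.2⟩, hx.1.1.1.1, (Nat.le_div_iff_mul_le hx.1.1.2.1).mpr hx.1.2⟩
    · intro x hx
      simp only [Finset.mem_sigma, Finset.mem_Icc] at hx
      have := (Nat.le_div_iff_mul_le hx.1.1).mp hx.2.2
      simp only [hs, Finset.mem_filter, Finset.mem_product, Finset.mem_Icc]
      refine ⟨⟨⟨⟨hx.2.1, ?_⟩, hx.1.1, by omega⟩, this⟩, hx.1.2⟩
      nlinarith [hx.1.1]
    · simp
    · simp
    · intro x _; simp [mul_comm]
  have h4 := Finset.sum_union_inter (s₁ := s.filter (fun x => x.1 ≤ Y))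
    (s₂ := s.filter (fun x => x.2 ≤ Y)) (f := fun x => a x.1 * b x.2)
  rw [← hu12, h3, h1, h2, Finset.sum_product] at h4
  rw [h0, Finset.sum_mul_sum, eq_sub_iff_add_eq, h4]

lemma PowLog.convolution {a b : ArithmeticFunction ℂ} (ha : PowLog (partialSum a))
    (hb : PowLog (partialSum b)) (ha' : SubPoly a) (hb' : SubPoly b) :
    PowLog (partialSum (a * b : ArithmeticFunction ℂ)) := by
  have h := ((ha.sum_le_sqrt ha' hb).add (hb.sum_le_sqrt hb' ha)).add
    ((PowLog.const (-1)).mul (ha.comp_sqrt.mul hb.comp_sqrt))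
  refine h.congr fun u hu => ?_
  rw [partialSum_mul_eq_hyperbola a b (by linarith)]
  ring

/-! ### Harmonic sums over residue classes -/

lemma exists_card_modEq (q r : ℕ) (hq : 0 < q) (N : ℕ) :
    ∃ E : ℝ, |E| ≤ 1 ∧ (((Finset.Icc 1 N).filter fun n => n ≡ r [MOD q]).card : ℝ) = N / q + E := by
  have h := Nat.Ioc_filter_modEq_card 0 N hq r
  have h' : (((Finset.Icc 1 N).filter fun n => n ≡ r [MOD q]).card : ℤ)
      = max (⌊((N : ℚ) - r) / q⌋ - ⌊((0 : ℕ) - r : ℚ) / q⌋) 0 := h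
  have hq' : (0 : ℚ) < q := by exact_mod_cast hq
  have hmono : ⌊((0 : ℕ) - r : ℚ) / q⌋ ≤ ⌊((N : ℚ) - r) / q⌋ := by
    apply Int.floor_le_floor
    gcongr
    exact_mod_cast Nat.zero_le N
  rw [max_eq_left (by omega)] at h'
  have e1 := Int.floor_le (((N : ℚ) - r) / q)
  have e2 := Int.lt_floor_add_one (((N : ℚ) - r) / q)
  have e3 := Int.floor_le (((0 : ℕ) - r : ℚ) / q)
  have e4 := Int.lt_floor_add_one (((0 : ℕ) - r : ℚ) / q)
  set c := ((Finset.Icc 1 N).filter fun n => n ≡ r [MOD q]).card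
  have h2 : ((c : ℤ) : ℚ) = (⌊((N : ℚ) - r) / q⌋ : ℚ) - (⌊((0 : ℕ) - r : ℚ) / q⌋ : ℚ) := by
    rw [h']; push_cast; ring
  have e5 : ((N : ℚ) - r) / q - ((0 : ℕ) - r : ℚ) / q = N / q := by push_cast; ring
  have e6 : |(c : ℚ) - N / q| ≤ 1 := by
    rw [abs_le]
    push_cast at h2
    push_cast at e3 e4 e5
    constructor <;> linarith
  refine ⟨c - N / q, ?_, by ring⟩
  have e7 := (Rat.cast_le (K := ℝ)).mpr e6
  push_cast at e7
  exact e7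

/-- Partial summation against the counting function t/q + O(1). This is the base case for all later
asymptotics over residue classes. -/
lemma powLog_partialSum_inv_modEq (q r : ℕ) (hq : 0 < q) :
    PowLog (partialSum fun n => if n ≡ r [MOD q] then (n : ℂ)⁻¹ else 0) := by
  set a : ℕ → ℂ := fun n => if n ≡ r [MOD q] then 1 else 0 with ha
  have hE : ∀ t : ℝ, 1 ≤ t → ‖partialSum a t - t / q‖ ≤ 2 := fun t ht => by
    obtain ⟨E, hE1, hE2⟩ := exists_card_modEq q r hq ⌊t⌋₊
    have : partialSum a t = ((⌊t⌋₊ / q + E : ℝ) : ℂ) := by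
      rw [← hE2, partialSum, ha]
      simp
    rw [this, ← Complex.ofReal_natCast q, ← Complex.ofReal_div, ← Complex.ofReal_sub, Complex.norm_real,
      Real.norm_eq_abs]
    have h1 := Nat.floor_le (by linarith : 0 ≤ t)
    have h2 := Nat.lt_floor_add_one t
    have hq1 : (1 : ℝ) ≤ q := by exact_mod_cast hq
    have h3 : |((⌊t⌋₊ : ℝ) - t) / q| ≤ 1 := by
      rw [abs_div, div_le_one (by positivity), abs_le, abs_of_pos (by linarith : (0 : ℝ) < q)]
      constructor <;> linarith
    calc |(⌊t⌋₊ : ℝ) / q + E - t / q| = |((⌊t⌋₊ : ℝ) - t) / q + E| := by congr 1; ring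
      _ ≤ 1 + 1 := (abs_add_le _ _).trans (add_le_add h3 hE1)
      _ = 2 := by norm_num
  have hne : ∀ {X : ℝ}, ∀ t ∈ Set.Icc 1 X, (t : ℂ) ≠ 0 := fun t ht => by
    have : (0 : ℝ) < t := by linarith [ht.1]
    exact_mod_cast this.ne'
  have hc2 : ∀ X : ℝ, ContinuousOn (fun t : ℝ => ((t : ℂ) ^ 2)⁻¹) (Set.Icc 1 X) := fun X =>
    (Complex.continuous_ofReal.pow 2).continuousOn.inv₀ fun t ht => pow_ne_zero 2 (hne t ht)
  have hc1 : ∀ X : ℝ, ContinuousOn (fun t : ℝ => (t : ℂ)⁻¹ / q) (Set.Icc 1 X) := fun X =>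
    (Complex.continuous_ofReal.continuousOn.inv₀ hne).div_const _
  set E : ℝ → ℂ := fun t => ((t : ℂ) ^ 2)⁻¹ * partialSum a t - (t : ℂ)⁻¹ / q with hEdef
  have hi : ∀ X : ℝ, 1 ≤ X → IntegrableOn E (Set.Icc 1 X) := fun X hX =>
    (integrableOn_mul_partialSum a (hc2 X)).sub ((hc1 X).integrableOn_compact isCompact_Icc)
  obtain ⟨c, hc⟩ := exists_integral_tail one_pos hi (K := 2) fun t ht => by
    have ht0 : 0 < t := by linarith
    have : E t = ((t : ℂ) ^ 2)⁻¹ * (partialSum a t - t / q) := by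
      have : (t : ℂ) ≠ 0 := by exact_mod_cast ht0.ne'
      rw [hEdef]; simp only; field_simp
    rw [this, norm_mul, norm_inv, norm_pow, Complex.norm_real, Real.norm_of_nonneg ht0.le]
    rw [show (-1 - 1 : ℝ) = -(2 : ℕ) by norm_num, Real.rpow_neg ht0.le, Real.rpow_natCast, mul_comm]
    gcongr
    exact hE t ht
  -- The boundary term contributes 1/q to the constant and c is the convergent integral of `E`. The
  -- bound 4 is 2 from the boundary term plus 2 from the tail.
  refine ⟨Polynomial.C ((q : ℂ)⁻¹) * Polynomial.X + Polynomial.C (c + (q : ℂ)⁻¹), 1, one_pos, 4, fun X hX => ?_⟩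
  have hX0 : 0 < X := by linarith
  have hXc : (X : ℂ) ≠ 0 := by exact_mod_cast hX0.ne'
  have h1 := sum_mul_sub_eq_integral a (f := fun t : ℝ => (t : ℂ)⁻¹)
    (f' := fun t : ℝ => -((t : ℂ) ^ 2)⁻¹) hX
    (fun t ht => by
      have := (hasDerivAt_inv (hne t ht)).comp_ofReal
      simpa using this) (hc2 X).neg
  have h2 : partialSum (fun n => if n ≡ r [MOD q] then (n : ℂ)⁻¹ else 0) X
      = (X : ℂ)⁻¹ * partialSum a X + ∫ t in (1 : ℝ)..X, ((t : ℂ) ^ 2)⁻¹ * partialSum a t := by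
    have : ∫ t in (1 : ℝ)..X, ((t : ℂ) ^ 2)⁻¹ * partialSum a t
        = - ∫ t in (1 : ℝ)..X, -((t : ℂ) ^ 2)⁻¹ * partialSum a t := by
      rw [← intervalIntegral.integral_neg]
      exact intervalIntegral.integral_congr fun t _ => by simp
    rw [this, ← h1, partialSum, partialSum, Finset.mul_sum, ← Finset.sum_neg_distrib,
      ← Finset.sum_add_distrib]
    refine Finset.sum_congr rfl fun n _ => ?_
    simp only [ha, Complex.ofReal_natCast]
    split_ifs <;> ring
  have hmain : ∫ t in (1 : ℝ)..X, (t : ℂ)⁻¹ / q = (q : ℂ)⁻¹ * (Real.log X : ℂ) := by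
    have := intervalIntegral.integral_eq_sub_of_hasDerivAt_of_le (a := 1) (b := X) hX
      (f := fun t : ℝ => (Real.log t : ℂ) / q) (f' := fun t : ℝ => (t : ℂ)⁻¹ / q)
      ((by simpa using continuous_eval_mul_log Polynomial.X 1 (X := X) : ContinuousOn (fun t : ℝ => (Real.log t : ℂ)) _).div_const _)
      (fun t ht => (hasDerivAt_ofReal_log (by linarith [ht.1])).div_const _)
      ((hc1 X).intervalIntegrable_of_Icc hX)
    rw [this]; simp; ring
  have h3 : ∫ t in (1 : ℝ)..X, ((t : ℂ) ^ 2)⁻¹ * partialSum a t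
      = (∫ t in (1 : ℝ)..X, E t) + (q : ℂ)⁻¹ * (Real.log X : ℂ) := by
    rw [← hmain, ← intervalIntegral.integral_add]
    · simp [hEdef]
    · exact (intervalIntegrable_iff_integrableOn_Icc_of_le hX).mpr (hi X hX)
    · exact (hc1 X).intervalIntegrable_of_Icc hX
  have h4 : partialSum (fun n => if n ≡ r [MOD q] then (n : ℂ)⁻¹ else 0) X
      - (Polynomial.C ((q : ℂ)⁻¹) * Polynomial.X + Polynomial.C (c + (q : ℂ)⁻¹)).eval (Real.log X : ℂ)
      = (X : ℂ)⁻¹ * (partialSum a X - X / q) + ((∫ t in (1 : ℝ)..X, E t) - c) := by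
    rw [h2, h3]
    simp
    field_simp
    ring
  rw [h4]
  have h5 : ‖(X : ℂ)⁻¹ * (partialSum a X - X / q)‖ ≤ 2 * X ^ (-(1 : ℝ)) := by
    rw [norm_mul, norm_inv, Complex.norm_real, Real.norm_of_nonneg hX0.le, Real.rpow_neg_one,
      mul_comm]
    gcongr
    exact hE X hX
  refine (norm_add_le _ _).trans ((add_le_add h5 (hc X hX)).trans (le_of_eq ?_))
  ring

/-! ### Partial summation against t^κ p(κ log t). -/

/-- The function `t ^ κ p(κ log t)`. -/
def powEval (κ : ℝ) (p : ℂ[X]) (t : ℝ) : ℂ := ((t ^ κ : ℝ) : ℂ) * p.eval ((κ : ℂ) * (Real.log t : ℂ))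

/-- Differentiation acts on the polynomial as p ↦ p + p'. Taking κ log t as the argument is what
makes this operator independent of κ. -/
lemma hasDerivAt_powEval (κ : ℝ) (p : ℂ[X]) {t : ℝ} (ht : 0 < t) :
    HasDerivAt (powEval κ p) (κ * powEval κ (p + derivative p) t / t) t := by
  have h1 : HasDerivAt (fun t : ℝ => ((t ^ κ : ℝ) : ℂ)) ((κ * t ^ (κ - 1) : ℝ) : ℂ) t :=
    (Real.hasDerivAt_rpow_const (Or.inl ht.ne')).ofReal_comp
  have h2 : HasDerivAt (fun t : ℝ => p.eval ((κ : ℂ) * (Real.log t : ℂ)))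
      ((derivative p).eval ((κ : ℂ) * (Real.log t : ℂ)) * (κ * (t : ℂ)⁻¹)) t :=
    (p.hasDerivAt _).comp_of_eq t ((hasDerivAt_ofReal_log ht.ne').const_mul (κ : ℂ)) rfl
  convert! h1.mul h2 using 1
  have ht' : (t : ℂ) ≠ 0 := by exact_mod_cast ht.ne'
  rw [powEval, Real.rpow_sub_one ht.ne', eval_add]
  push_cast
  field_simp

lemma continuousOn_powEval (κ : ℝ) (p : ℂ[X]) {X : ℝ} :
    ContinuousOn (powEval κ p) (Set.Icc 1 X) := fun t ht =>
  (hasDerivAt_powEval κ p (by linarith [ht.1])).continuousAt.continuousWithinAt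

lemma continuousOn_powEval_div (κ : ℝ) (p : ℂ[X]) {X : ℝ} :
    ContinuousOn (fun t : ℝ => κ * powEval κ p t / t) (Set.Icc 1 X) :=
  (continuousOn_const.mul (continuousOn_powEval κ p)).div Complex.continuous_ofReal.continuousOn
    fun t ht => by
      have : (0 : ℝ) < t := by linarith [ht.1]
      exact_mod_cast this.ne'

lemma exists_norm_powEval_le {κ : ℝ} (hκ : 0 < κ) (p : ℂ[X]) {ε : ℝ} (hε : 0 < ε) :
    ∃ K : ℝ, 0 ≤ K ∧ ∀ t : ℝ, 1 ≤ t → ‖powEval κ p t‖ ≤ K * t ^ (κ + ε) := by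
  obtain ⟨K, hK0, hK⟩ := exists_norm_eval_le p (div_pos hε hκ)
  refine ⟨K, hK0, fun t ht => ?_⟩
  have ht0 : 0 < t := by linarith
  have h1 : 1 ≤ t ^ κ := Real.one_le_rpow ht hκ.le
  have h2 := hK (t ^ κ) ((κ : ℂ) * (Real.log t : ℂ)) h1 (by
    rw [Real.log_rpow ht0, norm_mul, Complex.norm_real, Complex.norm_real,
      Real.norm_of_nonneg hκ.le, Real.norm_of_nonneg (Real.log_nonneg ht)])
  rw [← Real.rpow_mul ht0.le, mul_div_cancel₀ _ hκ.ne'] at h2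
  rw [powEval, norm_mul, Complex.norm_real, Real.norm_of_nonneg (by positivity)]
  calc t ^ κ * ‖p.eval ((κ : ℂ) * (Real.log t : ℂ))‖ ≤ t ^ κ * (K * t ^ ε) := by gcongr
    _ = K * t ^ (κ + ε) := by rw [Real.rpow_add ht0]; ring

/-- The sum equals the integral of f' against the partial sums of a. Replacing these by Q(log t)
costs the integral of t^{κ-1+δ/2} t^{-δ}, where δ/2 pays for the polynomial in f'. -/
lemma exists_sum_mul_powEval_sub_integral_le {a : ℕ → ℂ} {Q : ℂ[X]} {δ κ : ℝ} (hδ : 0 < δ) (hκ : 0 < κ)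
    (h : LogAsymp (partialSum a) Q δ) (p : ℂ[X]) :
    ∃ K : ℝ, ∀ X : ℝ, 1 ≤ X →
      ‖∑ n ∈ Finset.Icc 1 ⌊X⌋₊, a n * (powEval κ p X - powEval κ p n)
        - ∫ t in (1 : ℝ)..X, κ * powEval κ (p + derivative p) t / t * Q.eval (Real.log t : ℂ)‖
        ≤ K * X ^ (κ - min (δ / 2) (κ / 2)) := by
  -- Capping by κ/2 keeps κ - δ' positive, so the error integral is of size X^{κ-δ'}.
  set δ' := min (δ / 2) (κ / 2) with hδ'
  have hδ'κ : δ' < κ := (min_le_right _ _).trans_lt (by linarith)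
  have hδ'δ : δ' ≤ δ / 2 := min_le_left _ _
  obtain ⟨L, hL0, hL⟩ := h.nonneg_const
  obtain ⟨M, hM0, hM⟩ := exists_norm_powEval_le hκ (p + derivative p) (half_pos hδ)
  refine ⟨κ * M * L / (κ - δ'), fun X hX => ?_⟩
  have hX0 : 0 < X := by linarith
  have hint' : IntervalIntegrable (fun t : ℝ => κ * powEval κ (p + derivative p) t / t
      * Q.eval (Real.log t : ℂ)) volume 1 X :=
    ContinuousOn.intervalIntegrable_of_Icc hX ((continuousOn_powEval_div κ _).mul
      (by simpa using continuous_eval_mul_log Q 1 (X := X)))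
  rw [sum_mul_sub_eq_integral a hX
    (fun t ht => hasDerivAt_powEval κ p (by linarith [ht.1])) (continuousOn_powEval_div κ _),
    ← intervalIntegral.integral_sub
      (intervalIntegrable_mul_partialSum a hX (continuousOn_powEval_div κ _)) hint']
  have hint : IntervalIntegrable (fun t : ℝ => κ * M * L * t ^ (κ - δ' - 1)) volume 1 X := by
    apply IntervalIntegrable.const_mul
    exact intervalIntegral.intervalIntegrable_rpow' (by linarith)
  refine (intervalIntegral.norm_integral_le_of_norm_le hX (Eventually.of_forall fun t ht => ?_)
    hint).trans ?_
  · have ht1 : 1 ≤ t := ht.1.le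
    have ht0 : 0 < t := by linarith
    rw [← mul_sub, norm_mul, norm_div, norm_mul, Complex.norm_real, Complex.norm_real,
      Real.norm_of_nonneg hκ.le, Real.norm_of_nonneg ht0.le]
    calc κ * ‖powEval κ (p + derivative p) t‖ / t * ‖partialSum a t - Q.eval (Real.log t : ℂ)‖
        ≤ κ * (M * t ^ (κ + δ / 2)) / t * (L * t ^ (-δ)) := by
          have := hM t ht1
          have := hL t ht1
          gcongr
      _ = κ * M * L * t ^ (κ - δ / 2 - 1) := by
          rw [show κ - δ / 2 - 1 = (κ + δ / 2) + (-δ) + (-1) by ring,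
            Real.rpow_add ht0 (κ + δ / 2 + -δ) (-1), Real.rpow_add ht0 (κ + δ / 2) (-δ),
            Real.rpow_neg_one]
          ring
      _ ≤ κ * M * L * t ^ (κ - δ' - 1) := by
          gcongr
  · rw [intervalIntegral.integral_const_mul, integral_rpow (Or.inl (by linarith))]
    simp only [sub_add_cancel, Real.one_rpow]
    rw [mul_div_assoc', div_mul_eq_mul_div]
    have h1 : 0 < κ - δ' := by linarith
    gcongr
    linarith

lemma eval_comp_inv_mul {κ : ℝ} (hκ : 0 < κ) (Q : ℂ[X]) (z : ℂ) :
    (Q.comp (Polynomial.C ((κ : ℂ)⁻¹) * Polynomial.X)).eval ((κ : ℂ) * z) = Q.eval z := by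
  have : (κ : ℂ) ≠ 0 := by exact_mod_cast hκ.ne'
  simp [eval_comp, this]

/-- If `∑_{n ≤ t} a_i(n)` is asymptotically polynomial in `log t`, then so are the sums
`∑_{n ≤ X} a_i(n) (f_i(X) - f_i(n)) / X ^ κ` with `f_i(t) = t ^ κ p_i(κ log t)`; the polynomial is
determined by a differential equation. -/
lemma exists_sum_mul_powEval_sub_le {ι : Type*} (s : Finset ι) {a : ι → ℕ → ℂ} {p Q : ι → ℂ[X]}
    {P : ℂ[X]} {δ κ : ℝ} (hδ : 0 < δ) (hκ : 0 < κ)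
    (h : ∀ i ∈ s, LogAsymp (partialSum (a i)) (Q i) δ)
    (hP : P + derivative P = ∑ i ∈ s, (p i + derivative (p i)) *
      (Q i).comp (Polynomial.C ((κ : ℂ)⁻¹) * Polynomial.X)) :
    ∃ δ' : ℝ, 0 < δ' ∧ ∃ K : ℝ, ∀ X : ℝ, 1 ≤ X →
      ‖∑ i ∈ s, ∑ n ∈ Finset.Icc 1 ⌊X⌋₊, a i n * (powEval κ (p i) X - powEval κ (p i) n)
        - powEval κ P X‖ ≤ K * X ^ (κ - δ') := by
  choose! K hK using fun i hi => exists_sum_mul_powEval_sub_integral_le hδ hκ (h i hi) (p i)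
  set δ' := min (δ / 2) (κ / 2) with hδ'
  have hδ'κ : δ' < κ := (min_le_right _ _).trans_lt (by linarith)
  refine ⟨δ', lt_min (by linarith) (by linarith), ∑ i ∈ s, K i + ‖P.eval 0‖, fun X hX => ?_⟩
  have hcont : ∀ i, ContinuousOn (fun t : ℝ => κ * powEval κ (p i + derivative (p i)) t / t
      * (Q i).eval (Real.log t : ℂ)) (Set.Icc 1 X) := fun i =>
    (continuousOn_powEval_div κ _).mul (by simpa using continuous_eval_mul_log (Q i) 1 (X := X))
  -- The equation `hP` says precisely that the total integrand is the derivative of `powEval κ P`;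
  -- the lower endpoint leaves P(0), which goes into the error.
  have hint : ∑ i ∈ s, ∫ t in (1 : ℝ)..X, κ * powEval κ (p i + derivative (p i)) t / t
      * (Q i).eval (Real.log t : ℂ) = powEval κ P X - P.eval 0 := by
    rw [← intervalIntegral.integral_finsetSum fun i _ => (hcont i).intervalIntegrable_of_Icc hX]
    have h1 := intervalIntegral.integral_eq_sub_of_hasDerivAt_of_le (a := 1) (b := X) hX
      (continuousOn_powEval κ P) (fun t ht => hasDerivAt_powEval κ P (by linarith [ht.1]))
      ((continuousOn_powEval_div κ _).intervalIntegrable_of_Icc hX)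
    have h2 : powEval κ P 1 = P.eval 0 := by simp [powEval]
    rw [← h2, ← h1]
    refine intervalIntegral.integral_congr fun t _ => ?_
    simp only [powEval, hP, eval_finsetSum, eval_mul, eval_comp_inv_mul hκ, Finset.mul_sum,
      Finset.sum_div]
    exact Finset.sum_congr rfl fun i _ => by ring
  have h3 : ∑ i ∈ s, ∑ n ∈ Finset.Icc 1 ⌊X⌋₊, a i n * (powEval κ (p i) X - powEval κ (p i) n)
      - powEval κ P X
      = ∑ i ∈ s, (∑ n ∈ Finset.Icc 1 ⌊X⌋₊, a i n * (powEval κ (p i) X - powEval κ (p i) n)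
        - ∫ t in (1 : ℝ)..X, κ * powEval κ (p i + derivative (p i)) t / t
            * (Q i).eval (Real.log t : ℂ)) - P.eval 0 := by
    rw [Finset.sum_sub_distrib, hint]; ring
  rw [h3, add_mul, Finset.sum_mul]
  refine (norm_sub_le _ _).trans (add_le_add (norm_sum_le_of_le _ fun i hi => hK i hi X hX) ?_)
  exact le_mul_of_one_le_right (norm_nonneg _) (Real.one_le_rpow hX (by linarith))

/-! ### Determination of the polynomial from the Dirichlet series -/

/-- G is built so that -t^{-w} G(log t) is an antiderivative of w (log t)^m t^{-w-1}. The value at t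
= 1 then gives the transform m! w^{-m}. -/
lemma exists_laplace_monomial (m : ℕ) {w : ℂ} (hw : w ≠ 0) :
    ∃ G : ℂ[X], Polynomial.C w * G - derivative G = Polynomial.C w * Polynomial.X ^ m ∧
      G.eval 0 = (m ! : ℂ) * w⁻¹ ^ m := by
  induction m with
  | zero => exact ⟨1, by simp, by simp⟩
  | succ m ih =>
    obtain ⟨G, h1, h2⟩ := ih
    refine ⟨Polynomial.X ^ (m + 1) + Polynomial.C ((m + 1) * w⁻¹) * G, ?_, ?_⟩
    · have hc : Polynomial.C w * Polynomial.C ((m + 1) * w⁻¹) = Polynomial.C ((m : ℂ) + 1) := by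
        rw [← Polynomial.C_mul]; congr 1; field_simp
      have hc' : Polynomial.C ((m + 1) * w⁻¹) * Polynomial.C w = Polynomial.C ((m : ℂ) + 1) := by
        rw [mul_comm, hc]
      have h3 : derivative G = Polynomial.C w * G - Polynomial.C w * Polynomial.X ^ m := by
        rw [← h1]; ring
      simp only [derivative_add, derivative_X_pow, derivative_mul, derivative_C, h3, zero_mul,
        zero_add, Nat.cast_add, Nat.cast_one, add_tsub_cancel_right]
      rw [mul_sub, ← mul_assoc, ← mul_assoc, hc', mul_add, ← mul_assoc, hc]
      ring
    · simp only [eval_add, eval_pow, eval_X, eval_mul, eval_C, h2, Nat.factorial_succ, pow_succ]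
      push_cast
      ring

/-- The polynomial `∑_m m! p_m X ^ m` for `P = ∑_m p_m X ^ m`. -/
def laplacePoly (P : ℂ[X]) : ℂ[X] :=
  ∑ m ∈ Finset.range (P.natDegree + 1), Polynomial.C (P.coeff m * (m ! : ℂ)) * Polynomial.X ^ m

lemma laplacePoly_coeff (P : ℂ[X]) (m : ℕ) : (laplacePoly P).coeff m = P.coeff m * (m ! : ℂ) := by
  rw [laplacePoly, finsetSum_coeff]
  simp only [coeff_C_mul, coeff_X_pow, mul_ite, mul_one, mul_zero]
  rw [Finset.sum_ite_eq]
  split_ifs with h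
  · rfl
  · rw [coeff_eq_zero_of_natDegree_lt, zero_mul]
    simpa using h

lemma integrableOn_eval_log_mul_rpow (P : ℂ[X]) {w : ℝ} (hw : 0 < w) :
    IntegrableOn (fun t : ℝ => P.eval (Real.log t : ℂ) * ((t ^ (-(w + 1)) : ℝ) : ℂ)) (Set.Ioi 1) := by
  obtain ⟨K, hK0, hK⟩ := exists_norm_eval_le P (half_pos hw)
  have hg : IntegrableOn (fun t : ℝ => K * t ^ (-1 - w / 2)) (Set.Ioi 1) :=
    (integrableOn_Ioi_rpow_of_lt (by linarith) one_pos).const_mul K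
  refine Integrable.mono' hg (ContinuousOn.aestronglyMeasurable ?_ measurableSet_Ioi) ?_
  · have hne : ∀ t ∈ Set.Ioi (1 : ℝ), t ≠ 0 := fun t ht => by linarith [Set.mem_Ioi.mp ht]
    refine ContinuousOn.mul (P.continuous.comp_continuousOn
      (Complex.continuous_ofReal.comp_continuousOn (Real.continuousOn_log.mono hne))) ?_
    exact Complex.continuous_ofReal.comp_continuousOn
      (continuousOn_id.rpow_const fun t ht => Or.inl (hne t ht))
  · refine (ae_restrict_iff' measurableSet_Ioi).mpr (ae_of_all _ fun t ht => ?_)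
    have ht1 : 1 ≤ t := (Set.mem_Ioi.mp ht).le
    have ht0 : 0 < t := by linarith
    rw [norm_mul, Complex.norm_real, Real.norm_of_nonneg (by positivity)]
    calc _ ≤ K * t ^ (w / 2) * t ^ (-(w + 1)) := by
          gcongr; exact hK t _ ht1 (norm_log_le ht1)
      _ = K * t ^ (-1 - w / 2) := by
          rw [mul_assoc, ← Real.rpow_add ht0]; congr 2; ring

lemma mul_integral_eval_log (P : ℂ[X]) {w : ℝ} (hw : 0 < w) :
    (w : ℂ) * ∫ t in Set.Ioi (1 : ℝ), P.eval (Real.log t : ℂ) * ((t ^ (-(w + 1)) : ℝ) : ℂ)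
      = (laplacePoly P).eval ((w : ℂ)⁻¹) := by
  have hw' : (w : ℂ) ≠ 0 := by exact_mod_cast hw.ne'
  choose G hG1 hG2 using fun m => exists_laplace_monomial m hw'
  set H : ℂ[X] := ∑ m ∈ Finset.range (P.natDegree + 1), Polynomial.C (P.coeff m) * G m with hH
  have h1 : Polynomial.C (w : ℂ) * H - derivative H = Polynomial.C (w : ℂ) * P := by
    conv_rhs => rw [P.as_sum_range_C_mul_X_pow]
    rw [hH, derivative_sum, Finset.mul_sum, Finset.mul_sum, ← Finset.sum_sub_distrib]
    refine Finset.sum_congr rfl fun m _ => ?_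
    rw [derivative_C_mul, mul_left_comm, ← mul_sub, hG1]; ring
  have h2 : H.eval 0 = (laplacePoly P).eval ((w : ℂ)⁻¹) := by
    rw [hH, laplacePoly, eval_finsetSum, eval_finsetSum]
    exact Finset.sum_congr rfl fun m _ => by simp [hG2, mul_assoc]
  have hder : ∀ t ∈ Set.Ici (1 : ℝ), HasDerivAt
      (fun t : ℝ => -(((t ^ (-w) : ℝ) : ℂ) * H.eval (Real.log t : ℂ)))
      ((w : ℂ) * (P.eval (Real.log t : ℂ) * ((t ^ (-(w + 1)) : ℝ) : ℂ))) t := by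
    intro t ht
    have ht0 : 0 < t := by linarith [Set.mem_Ici.mp ht]
    have d1 : HasDerivAt (fun t : ℝ => ((t ^ (-w) : ℝ) : ℂ)) ((-w * t ^ (-w - 1) : ℝ) : ℂ) t :=
      (Real.hasDerivAt_rpow_const (Or.inl ht0.ne')).ofReal_comp
    have d2 : HasDerivAt (fun t : ℝ => H.eval (Real.log t : ℂ))
        ((derivative H).eval (Real.log t : ℂ) * ((t : ℂ)⁻¹)) t :=
      (H.hasDerivAt _).comp_of_eq t (hasDerivAt_ofReal_log ht0.ne') rfl
    convert! (d1.mul d2).neg using 1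
    have e1 := congrArg (fun p : ℂ[X] => p.eval (Real.log t : ℂ)) h1
    simp only [eval_sub, eval_mul, eval_C] at e1
    have ht' : (t : ℂ) ≠ 0 := by exact_mod_cast ht0.ne'
    rw [← mul_assoc, ← e1, show -(w + 1) = -w - 1 by ring, Real.rpow_sub_one ht0.ne']
    push_cast
    field_simp
    ring
  have hlim : Tendsto (fun t : ℝ => -(((t ^ (-w) : ℝ) : ℂ) * H.eval (Real.log t : ℂ))) atTop (𝓝 0) := by
    obtain ⟨K, hK0, hK⟩ := exists_norm_eval_le H (half_pos hw)
    have : Tendsto (fun t : ℝ => K * t ^ (-(w / 2))) atTop (𝓝 0) := by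
      simpa using (tendsto_rpow_neg_atTop (half_pos hw)).const_mul K
    refine squeeze_zero_norm' ?_ this
    filter_upwards [eventually_ge_atTop 1] with t ht
    have ht0 : 0 < t := by linarith
    rw [norm_neg, norm_mul, Complex.norm_real, Real.norm_of_nonneg (by positivity)]
    calc _ ≤ t ^ (-w) * (K * t ^ (w / 2)) := by gcongr; exact hK t _ ht (norm_log_le ht)
      _ = K * t ^ (-(w / 2)) := by
          rw [mul_left_comm, ← Real.rpow_add ht0]; congr 2; ring
  rw [← MeasureTheory.integral_const_mul, integral_Ioi_of_hasDerivAt_of_tendsto' hder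
    ((integrableOn_eval_log_mul_rpow P hw).const_mul _) hlim]
  simp [h2]

lemma measurable_partialSum (a : ℕ → ℂ) : Measurable (partialSum a) := by
  have : partialSum a = (fun n : ℕ => ∑ k ∈ Finset.Icc 1 n, a k) ∘ (fun u : ℝ => ⌊u⌋₊) := rfl
  rw [this]
  exact measurable_from_top.comp Nat.measurable_floor

/-- The Dirichlet series is w times the integral of its partial sums against t^{-w-1}. The
polynomial contributes `laplacePoly` at 1/w, and the power saving makes the remaining integral
bounded as w → 0+, leaving O(w). -/
lemma LogAsymp.norm_LSeries_sub_le {a : ℕ → ℂ} {P : ℂ[X]} {δ : ℝ} (hδ : 0 < δ)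
    (h : LogAsymp (partialSum a) P δ) (hs : ∀ w : ℝ, 0 < w → LSeriesSummable a w) :
    ∃ K : ℝ, ∀ w : ℝ, 0 < w → ‖LSeries a w - (laplacePoly P).eval ((w : ℂ)⁻¹)‖ ≤ K * w := by
  obtain ⟨K, hK0, hK⟩ := h.nonneg_const
  refine ⟨K / δ, fun w hw => ?_⟩
  obtain ⟨L, hL0, hL⟩ := h.norm_le hδ.le (half_pos hw)
  have h1 := LSeries_eq_mul_integral a (half_pos hw).le (s := (w : ℂ)) (by simp; linarith) (hs w hw) (by
    refine IsBigO.of_bound L ?_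
    filter_upwards [eventually_ge_atTop 1] with n hn
    have := hL n (by exact_mod_cast hn)
    rw [Real.norm_of_nonneg (by positivity)]
    simpa [partialSum] using this)
  have h2 : ∫ t in Set.Ioi (1 : ℝ), (∑ k ∈ Finset.Icc 1 ⌊t⌋₊, a k) * (t : ℂ) ^ (-((w : ℂ) + 1))
      = ∫ t in Set.Ioi (1 : ℝ), partialSum a t * ((t ^ (-(w + 1)) : ℝ) : ℂ) := by
    refine setIntegral_congr_fun measurableSet_Ioi fun t ht => ?_
    have ht0 : 0 ≤ t := by linarith [Set.mem_Ioi.mp ht]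
    simp only [partialSum]
    rw [Complex.ofReal_cpow ht0]
    push_cast
    rfl
  have hg : IntegrableOn (fun t : ℝ => K * t ^ (-1 - δ)) (Set.Ioi 1) :=
    (integrableOn_Ioi_rpow_of_lt (by linarith) one_pos).const_mul K
  have hb : ∀ t ∈ Set.Ioi (1 : ℝ), ‖(partialSum a t - P.eval (Real.log t : ℂ)) * ((t ^ (-(w + 1)) : ℝ) : ℂ)‖
      ≤ K * t ^ (-1 - δ) := fun t ht => by
    have ht1 : 1 ≤ t := (Set.mem_Ioi.mp ht).le
    have ht0 : 0 < t := by linarith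
    rw [norm_mul, Complex.norm_real, Real.norm_of_nonneg (by positivity)]
    calc _ ≤ K * t ^ (-δ) * t ^ (-(w + 1)) := by gcongr; exact hK t ht1
      _ = K * t ^ (-1 - δ - w) := by
          rw [mul_assoc, ← Real.rpow_add ht0]; congr 2; ring
      _ ≤ K * t ^ (-1 - δ) := mul_le_mul_of_nonneg_left
          (Real.rpow_le_rpow_of_exponent_le ht1 (by linarith)) hK0
  have hE : IntegrableOn (fun t : ℝ => (partialSum a t - P.eval (Real.log t : ℂ)) * ((t ^ (-(w + 1)) : ℝ) : ℂ))
      (Set.Ioi 1) := by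
    refine Integrable.mono' hg ?_ ((ae_restrict_iff' measurableSet_Ioi).mpr (ae_of_all _ hb))
    refine Measurable.aestronglyMeasurable ?_
    refine Measurable.mul ((measurable_partialSum a).sub (P.continuous.measurable.comp
      (Complex.measurable_ofReal.comp Real.measurable_log))) ?_
    exact Complex.measurable_ofReal.comp (measurable_id.pow_const _)
  have h3 : ∫ t in Set.Ioi (1 : ℝ), partialSum a t * ((t ^ (-(w + 1)) : ℝ) : ℂ)
      = (∫ t in Set.Ioi (1 : ℝ), (partialSum a t - P.eval (Real.log t : ℂ)) * ((t ^ (-(w + 1)) : ℝ) : ℂ))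
        + ∫ t in Set.Ioi (1 : ℝ), P.eval (Real.log t : ℂ) * ((t ^ (-(w + 1)) : ℝ) : ℂ) := by
    rw [← MeasureTheory.integral_add hE (integrableOn_eval_log_mul_rpow P hw)]
    exact setIntegral_congr_fun measurableSet_Ioi fun t _ => by ring
  rw [h1, h2, h3, mul_add, mul_integral_eval_log P hw, add_sub_cancel_right, norm_mul,
    Complex.norm_real, Real.norm_of_nonneg hw.le, mul_comm]
  gcongr
  refine (norm_integral_le_of_norm_le hg ((ae_restrict_iff' measurableSet_Ioi).mpr
    (ae_of_all _ hb))).trans (le_of_eq ?_)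
  rw [MeasureTheory.integral_const_mul, integral_Ioi_rpow_of_lt (by linarith) one_pos]
  rw [show -1 - δ + 1 = -δ by ring]
  simp
  field_simp

/-- A nonconstant polynomial is unbounded along the reals. This gives the uniqueness of asymptotic
polynomials, used for their coefficients and again for their reality. -/
lemma eq_zero_of_tendsto_eval {R : ℂ[X]}
    (h : Tendsto (fun v : ℝ => R.eval (v : ℂ)) atTop (𝓝 0)) : R = 0 := by
  have hdeg : R.degree ≤ 0 := by
    by_contra hd
    push Not at hd
    have h1 := R.tendsto_norm_atTop hd (z := fun v : ℝ => (v : ℂ)) (l := atTop) (by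
      simpa using tendsto_abs_atTop_atTop)
    exact not_tendsto_nhds_of_tendsto_atTop h1 _ h.norm
  rw [eq_C_of_degree_le_zero hdeg] at h ⊢
  simp only [eval_C] at h
  rw [tendsto_nhds_unique tendsto_const_nhds h, Polynomial.C_0]

/-- The `n`-th Taylor coefficient of `f` at `c`. -/
def taylorCoeff (f : ℂ → ℂ) (c : ℂ) (n : ℕ) : ℂ := iteratedDeriv n f c / (n ! : ℂ)

lemma taylor_isBigO {f : ℂ → ℂ} {c : ℂ} (hf : AnalyticAt ℂ f c) (N : ℕ) :
    (fun w : ℂ => f (c + w) - ∑ r ∈ Finset.range N, taylorCoeff f c r * w ^ r) =O[𝓝 0]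
      fun w => ‖w‖ ^ N := by
  have h := hf.hasFPowerSeriesAt.isBigO_sub_partialSum_pow N
  refine h.congr_left fun w => ?_
  congr 1
  simp [FormalMultilinearSeries.partialSum, FormalMultilinearSeries.ofScalars, taylorCoeff, div_eq_inv_mul, mul_comm]

/-- The polynomial in an asymptotic formula is determined by the Dirichlet series. -/
lemma LogAsymp.coeff_eq {a : ℕ → ℂ} {P : ℂ[X]} {δ : ℝ} (hδ : 0 < δ)
    (h : LogAsymp (partialSum a) P δ) (hs : ∀ w : ℝ, 0 < w → LSeriesSummable a w) {Y : ℂ → ℂ}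
    (hY : AnalyticAt ℂ Y 0) {j : ℕ} (hL : ∀ w : ℝ, 0 < w → LSeries a w * (w : ℂ) ^ j = Y w) (m : ℕ) :
    P.coeff m * (m ! : ℂ) = if m ≤ j then taylorCoeff Y 0 (j - m) else 0 := by
  obtain ⟨K, hK⟩ := h.norm_LSeries_sub_le hδ hs
  -- With v = 1/w, this is the part of w^{-j} Y(w) with nonnegative powers of v. It and `laplacePoly
  -- P` are polynomials in v that differ by O(1/v), hence they are equal.
  set R : ℂ[X] := ∑ m ∈ Finset.range (j + 1), Polynomial.C (taylorCoeff Y 0 (j - m)) * Polynomial.X ^ m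
    with hR
  have hT := taylor_isBigO hY (j + 1)
  simp only [zero_add] at hT
  have hin : Tendsto (fun v : ℝ => (v : ℂ)⁻¹) atTop (𝓝 0) := by
    have := (Complex.continuous_ofReal.tendsto 0).comp (tendsto_inv_atTop_zero (𝕜 := ℝ))
    simpa [Function.comp_def] using this
  have hT' := hT.comp_tendsto hin
  obtain ⟨M, hM⟩ := hT'.bound
  have hz : Tendsto (fun v : ℝ => (laplacePoly P - R).eval (v : ℂ)) atTop (𝓝 0) := by
    have hlim : Tendsto (fun v : ℝ => (K + M) * v⁻¹) atTop (𝓝 0) := by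
      simpa using (tendsto_inv_atTop_zero (𝕜 := ℝ)).const_mul (K + M)
    refine squeeze_zero_norm' ?_ hlim
    filter_upwards [eventually_gt_atTop 0, hM] with v hv hv2
    have hvc : (v : ℂ) ≠ 0 := by exact_mod_cast hv.ne'
    have h1 := hK v⁻¹ (inv_pos.mpr hv)
    have h2 := hL v⁻¹ (inv_pos.mpr hv)
    push_cast at h1 h2
    rw [inv_inv] at h1
    have h3 : R.eval (v : ℂ) = (v : ℂ) ^ j * ∑ r ∈ Finset.range (j + 1),
        taylorCoeff Y 0 r * (v : ℂ)⁻¹ ^ r := by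
      rw [hR, eval_finsetSum, Finset.mul_sum, ← Finset.sum_range_reflect]
      refine Finset.sum_congr rfl fun r hr => ?_
      have hr' : r ≤ j := by simpa [Nat.lt_succ_iff] using hr
      simp only [eval_mul, eval_C, eval_pow, eval_X, Nat.add_sub_cancel, Nat.sub_sub_self hr']
      rw [pow_sub₀ _ hvc hr', inv_pow]
      ring
    have h4 : LSeries a ((v : ℂ)⁻¹) = (v : ℂ) ^ j * Y ((v : ℂ)⁻¹) := by
      rw [← h2, inv_pow]; field_simp
    have h5 : (laplacePoly P - R).eval (v : ℂ)
        = (v : ℂ) ^ j * (Y ((v : ℂ)⁻¹) - ∑ r ∈ Finset.range (j + 1), taylorCoeff Y 0 r * (v : ℂ)⁻¹ ^ r)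
          - (LSeries a ((v : ℂ)⁻¹) - (laplacePoly P).eval (v : ℂ)) := by
      rw [eval_sub, h3, h4]; ring
    rw [h5]
    refine (norm_sub_le _ _).trans ?_
    rw [add_mul, add_comm (K * v⁻¹)]
    refine add_le_add ?_ h1
    rw [norm_mul, norm_pow, Complex.norm_real, Real.norm_of_nonneg hv.le]
    simp only [Function.comp_apply, norm_inv, Complex.norm_real, Real.norm_of_nonneg hv.le, norm_pow] at hv2
    calc _ ≤ v ^ j * (M * v⁻¹ ^ (j + 1)) := by gcongr
      _ = (v * v⁻¹) ^ j * (M * v⁻¹) := by rw [pow_succ, mul_pow]; ring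
      _ = M * v⁻¹ := by rw [mul_inv_cancel₀ hv.ne', one_pow, one_mul]
  have h0 := eq_zero_of_tendsto_eval hz
  have h1 := congrArg (fun p : ℂ[X] => p.coeff m) (sub_eq_zero.mp h0)
  simp only [laplacePoly_coeff] at h1
  rw [h1, hR, finsetSum_coeff]
  simp only [coeff_C_mul, coeff_X_pow, mul_ite, mul_one, mul_zero]
  rw [Finset.sum_ite_eq]
  simp

end

end AdditiveDivisor

namespace AdditiveDivisor

open Finset

noncomputable section

/-! ### The divisor functions: multiplicativity and values at prime powers. -/

/-- `d_k` as a complex valued arithmetic function. -/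
def dC (k : ℕ) : ArithmeticFunction ℂ := (ArithmeticFunction.zeta : ArithmeticFunction ℂ) ^ k

lemma dC_apply (k n : ℕ) : dC k n = (d k n : ℂ) := by
  have h : dC k = ((ArithmeticFunction.zeta ^ k : ArithmeticFunction ℕ) : ArithmeticFunction ℂ) := by
    induction k with
    | zero => simp [dC]
    | succ k ih => rw [dC, pow_succ, ← dC, ih, pow_succ, ArithmeticFunction.natCoe_mul]
  rw [h, ArithmeticFunction.natCoe_apply, d]

lemma dC_isMultiplicative (k : ℕ) : (dC k).IsMultiplicative :=
  (ArithmeticFunction.isMultiplicative_zeta.natCast).pow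

lemma d_isMultiplicative (k : ℕ) : (ArithmeticFunction.zeta ^ k).IsMultiplicative :=
  ArithmeticFunction.isMultiplicative_zeta.pow

lemma d_zero_right (k : ℕ) : d k 0 = 0 := ArithmeticFunction.map_zero

lemma d_one_right (k : ℕ) : d k 1 = 1 := (d_isMultiplicative k).1

lemma d_zero_left (n : ℕ) : d 0 n = if n = 1 then 1 else 0 := by
  simp [d, ArithmeticFunction.one_apply]

lemma d_succ (k n : ℕ) : d (k + 1) n = ∑ i ∈ n.divisors, d k i := by
  rw [d, pow_succ, ArithmeticFunction.mul_zeta_apply]; rfl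

lemma d_mul_of_coprime (k : ℕ) {m n : ℕ} (h : m.Coprime n) : d k (m * n) = d k m * d k n :=
  (d_isMultiplicative k).2 h

lemma d_pos {k : ℕ} (hk : 1 ≤ k) {n : ℕ} (hn : n ≠ 0) : 0 < d k n := by
  obtain ⟨k, rfl⟩ := Nat.exists_eq_add_of_le' hk
  rw [d_succ]
  refine Finset.sum_pos' (fun i _ => Nat.zero_le _) ⟨1, by simp [hn], ?_⟩
  simp [d_one_right]

lemma d_prime_pow_le (k : ℕ) {p : ℕ} (hp : p.Prime) (e : ℕ) : d k (p ^ e) ≤ (e + 1) ^ k := by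
  induction k generalizing e with
  | zero => rw [d_zero_left]; split_ifs <;> simp
  | succ k ih =>
    rw [d_succ, Nat.sum_divisors_prime_pow hp]
    calc ∑ i ∈ Finset.range (e + 1), d k (p ^ i) ≤ ∑ i ∈ Finset.range (e + 1), (e + 1) ^ k := by
          refine Finset.sum_le_sum fun i hi => (ih i).trans ?_
          have : i ≤ e := by simpa [Nat.lt_succ_iff] using hi
          gcongr
      _ = (e + 1) ^ (k + 1) := by simp [pow_succ, mul_comm]

/-! ### Local factors -/

lemma mul_apply_prime_pow {R : Type*} [CommSemiring R] (f g : ArithmeticFunction R) {p : ℕ} (hp : p.Prime) (n : ℕ) :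
    (f * g) (p ^ n) = ∑ x ∈ Finset.HasAntidiagonal.antidiagonal n, f (p ^ x.1) * g (p ^ x.2) := by
  rw [ArithmeticFunction.mul_apply, Nat.sum_divisorsAntidiagonal (fun x y => f x * g y),
    Nat.sum_divisors_prime_pow hp, Finset.Nat.sum_antidiagonal_eq_sum_range_succ_mk]
  refine Finset.sum_congr rfl fun i hi => ?_
  rw [Nat.pow_div (by simpa [Nat.lt_succ_iff] using hi) hp.pos]

/-- The local factor `∑_n f(p ^ n) z ^ n` converges absolutely and has the value `S`. -/
def HasLocalSum (f : ArithmeticFunction ℂ) (p : ℕ) (z S : ℂ) : Prop :=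
  Summable (fun n : ℕ => ‖f (p ^ n) * z ^ n‖) ∧ ∑' n : ℕ, f (p ^ n) * z ^ n = S

lemma HasLocalSum.hasSum {f : ArithmeticFunction ℂ} {p : ℕ} {z S : ℂ} (h : HasLocalSum f p z S) :
    HasSum (fun n : ℕ => f (p ^ n) * z ^ n) S := h.2 ▸ h.1.of_norm.hasSum

lemma HasLocalSum.mul {f g : ArithmeticFunction ℂ} {p : ℕ} (hp : p.Prime) {z S T : ℂ}
    (hf : HasLocalSum f p z S) (hg : HasLocalSum g p z T) : HasLocalSum (f * g) p z (S * T) := by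
  have h : ∀ n : ℕ, (f * g) (p ^ n) * z ^ n
      = ∑ x ∈ Finset.HasAntidiagonal.antidiagonal n, (f (p ^ x.1) * z ^ x.1) * (g (p ^ x.2) * z ^ x.2) := fun n => by
    rw [mul_apply_prime_pow f g hp, Finset.sum_mul]
    refine Finset.sum_congr rfl fun x hx => ?_
    rw [← Finset.HasAntidiagonal.mem_antidiagonal.mp hx, pow_add]; ring
  constructor
  · simp_rw [h]
    exact summable_norm_sum_mul_antidiagonal_of_summable_norm
      (f := fun n => f (p ^ n) * z ^ n) (g := fun n => g (p ^ n) * z ^ n) hf.1 hg.1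
  · simp_rw [h]
    rw [← tsum_mul_tsum_eq_tsum_sum_antidiagonal_of_summable_norm
      (f := fun n => f (p ^ n) * z ^ n) (g := fun n => g (p ^ n) * z ^ n) hf.1 hg.1, hf.2, hg.2]

lemma hasLocalSum_one {p : ℕ} (hp : p.Prime) (z : ℂ) : HasLocalSum 1 p z 1 := by
  have h : ∀ n : ℕ, (1 : ArithmeticFunction ℂ) (p ^ n) * z ^ n = if n = 0 then 1 else 0 := fun n => by
    rw [ArithmeticFunction.one_apply]
    by_cases hn : n = 0
    · simp [hn]
    · have : p ^ n ≠ 1 := by simp [hn, hp.one_lt.ne']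
      rw [if_neg this, if_neg hn, zero_mul]
  constructor
  · simp only [h]
    exact summable_of_ne_finset_zero (s := {0}) fun n hn => by simp_all
  · simp only [h]; simp

lemma HasLocalSum.pow {f : ArithmeticFunction ℂ} {p : ℕ} (hp : p.Prime) {z S : ℂ}
    (hf : HasLocalSum f p z S) (k : ℕ) : HasLocalSum (f ^ k) p z (S ^ k) := by
  induction k with
  | zero => simpa using hasLocalSum_one hp z
  | succ k ih => rw [pow_succ, pow_succ]; exact ih.mul hp hf

lemma hasLocalSum_zeta {p : ℕ} (hp : p.Prime) {z : ℂ} (hz : ‖z‖ < 1) :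
    HasLocalSum (ArithmeticFunction.zeta : ArithmeticFunction ℂ) p z ((1 - z)⁻¹) := by
  have h : ∀ n : ℕ, (ArithmeticFunction.zeta : ArithmeticFunction ℂ) (p ^ n) * z ^ n = z ^ n :=
    fun n => by simp [hp.ne_zero]
  constructor
  · simp only [h, norm_pow]
    exact summable_geometric_of_lt_one (norm_nonneg _) hz
  · simp only [h]
    exact tsum_geometric_of_norm_lt_one hz

lemma hasLocalSum_dC (k : ℕ) {p : ℕ} (hp : p.Prime) {z : ℂ} (hz : ‖z‖ < 1) :
    HasLocalSum (dC k) p z (((1 - z) ^ k)⁻¹) := by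
  rw [← inv_pow]; exact (hasLocalSum_zeta hp hz).pow hp k

lemma hasLocalSum_moebius {p : ℕ} (hp : p.Prime) (z : ℂ) :
    HasLocalSum (ArithmeticFunction.moebius : ArithmeticFunction ℂ) p z (1 - z) := by
  have h : ∀ n : ℕ, n ∉ Finset.range 2 →
      (ArithmeticFunction.moebius : ArithmeticFunction ℂ) (p ^ n) * z ^ n = 0 := fun n hn => by
    have hn' : 2 ≤ n := by simpa [Nat.succ_le_iff] using hn
    rw [ArithmeticFunction.intCoe_apply, ArithmeticFunction.moebius_apply_prime_pow hp (by omega),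
      if_neg (by omega)]
    simp
  constructor
  · exact summable_of_ne_finset_zero (s := Finset.range 2) fun n hn => by rw [h n hn, norm_zero]
  · rw [tsum_eq_sum h, Finset.sum_range_succ, Finset.sum_range_one]
    simp [ArithmeticFunction.moebius_apply_prime hp, sub_eq_add_neg]

/-! ### Summability of multiplicative functions and the divisor bound -/

/-- The sum over n < N is at most the sum over N-smooth numbers, a finite Euler product. By 1 + x ≤
e^x that product is at most exp(∑ p^{-η} · ∑ c(e)), uniformly in N. -/
lemma summable_of_prime_pow_le {b : ArithmeticFunction ℝ} (hb : b.IsMultiplicative)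
    (hb0 : ∀ n, 0 ≤ b n) {η : ℝ} (hη : 1 < η) {c : ℕ → ℝ} (hc0 : ∀ e, 0 ≤ c e) (hc : Summable c)
    (h : ∀ p : ℕ, p.Prime → ∀ e : ℕ, b (p ^ (e + 1)) ≤ (p : ℝ) ^ (-η) * c e) : Summable b := by
  have hs1 : ∀ p : ℕ, p.Prime → Summable fun e : ℕ => b (p ^ (e + 1)) := fun p hp =>
    Summable.of_nonneg_of_le (fun e => hb0 _) (h p hp) (hc.mul_left _)
  have hs : ∀ {p : ℕ}, p.Prime → Summable fun e : ℕ => ‖b (p ^ e)‖ := fun {p} hp => by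
    refine (summable_nat_add_iff 1).mp ?_
    simpa [Real.norm_of_nonneg (hb0 _)] using hs1 p hp
  have hη' : Summable fun n : ℕ => (n : ℝ) ^ (-η) := Real.summable_nat_rpow.mpr (by linarith)
  set B := Real.exp ((∑' n : ℕ, (n : ℝ) ^ (-η)) * ∑' e, c e) with hB
  have hC0 : 0 ≤ ∑' e, c e := tsum_nonneg hc0
  refine summable_of_sum_range_le hb0 (c := B) fun N => ?_
  obtain ⟨h1, h2⟩ := EulerProduct.summable_and_hasSum_smoothNumbers_prod_primesBelow_tsum
    (f := b) hb.1 (fun {m n} hmn => hb.2 hmn) hs N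
  have h3 : ∑ n ∈ Finset.range N, b n ≤ ∏ p ∈ N.primesBelow, ∑' e : ℕ, b (p ^ e) := by
    have e1 : ∑ n ∈ Finset.range N, b n
        = ∑ n ∈ (Finset.range N).filter (· ∈ N.smoothNumbers), b n := by
      symm
      refine Finset.sum_subset (Finset.filter_subset _ _) fun n hn hn' => ?_
      have : n = 0 := by
        by_contra h0
        exact hn' (Finset.mem_filter.mpr ⟨hn, Nat.mem_smoothNumbers_of_lt (Nat.pos_of_ne_zero h0)
          (Finset.mem_range.mp hn)⟩)
      rw [this, ArithmeticFunction.map_zero]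
    rw [e1]
    have e2 := hasSum_subtype_iff_indicator.mp h2
    have e3 := sum_le_hasSum ((Finset.range N).filter (· ∈ N.smoothNumbers))
      (fun n _ => Set.indicator_nonneg (fun n _ => hb0 n) n) e2
    refine le_trans (le_of_eq (Finset.sum_congr rfl fun n hn => ?_)) e3
    rw [Set.indicator_of_mem (Finset.mem_filter.mp hn).2]
  refine h3.trans ?_
  calc ∏ p ∈ N.primesBelow, ∑' e : ℕ, b (p ^ e)
      ≤ ∏ p ∈ N.primesBelow, Real.exp ((p : ℝ) ^ (-η) * ∑' e, c e) := by
        refine Finset.prod_le_prod (fun p _ => tsum_nonneg fun e => hb0 _) fun p hp => ?_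
        have hp' := Nat.prime_of_mem_primesBelow hp
        have e1 : ∑' e : ℕ, b (p ^ e) = 1 + ∑' e : ℕ, b (p ^ (e + 1)) := by
          have := (hs hp').of_norm.tsum_eq_zero_add
          simpa [hb.1] using this
        have e2 : ∑' e : ℕ, b (p ^ (e + 1)) ≤ (p : ℝ) ^ (-η) * ∑' e, c e := by
          rw [← tsum_mul_left]
          exact (hs1 p hp').tsum_le_tsum (h p hp') (hc.mul_left _)
        rw [e1]
        linarith [Real.add_one_le_exp ((p : ℝ) ^ (-η) * ∑' e, c e)]
    _ = Real.exp ((∑ p ∈ N.primesBelow, (p : ℝ) ^ (-η)) * ∑' e, c e) := by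
        rw [← Real.exp_sum, Finset.sum_mul]
    _ ≤ B := by
        rw [hB]
        gcongr
        exact hη'.sum_le_tsum _ fun n _ => by positivity

/-- The divisor bound. -/
lemma exists_d_le (k : ℕ) {ε : ℝ} (hε : 0 < ε) :
    ∃ K : ℝ, 0 ≤ K ∧ ∀ n : ℕ, (d k n : ℝ) ≤ K * (n : ℝ) ^ ε := by
  -- Moment trick: d_k(n)^m n^{-2} is summable for every m, hence bounded, so d_k(n) ≪ n^{2/m}; m ≥
  -- 2/ε gives the exponent ε.
  obtain ⟨m, hm⟩ := exists_nat_ge (2 / ε)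
  have hm0 : 0 < m := by
    have : (0 : ℝ) < m := lt_of_lt_of_le (by positivity) hm
    exact_mod_cast this
  set b : ArithmeticFunction ℝ := ⟨fun n => (d k n : ℝ) ^ m * ((n : ℝ) ^ 2)⁻¹, by simp⟩ with hb
  have hbn : ∀ n, b n = (d k n : ℝ) ^ m * ((n : ℝ) ^ 2)⁻¹ := fun n => rfl
  have hb0 : ∀ n, 0 ≤ b n := fun n => by rw [hbn]; positivity
  have hbm : b.IsMultiplicative := by
    refine ⟨by simp [hbn, d_one_right], fun {m n} hmn => ?_⟩
    simp only [hbn, d_mul_of_coprime k hmn]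
    push_cast
    rw [mul_pow, mul_pow, mul_inv]; ring
  have hc : Summable fun e : ℕ => ((e + 2 : ℕ) : ℝ) ^ (k * m) * (1 / 4 : ℝ) ^ e := by
    have h1 := summable_pow_mul_geometric_of_norm_lt_one (R := ℝ) (k * m) (r := 1 / 4) (by norm_num)
    have h2 := ((summable_nat_add_iff 2).mpr h1).mul_left 16
    refine h2.congr fun e => ?_
    rw [pow_add]; push_cast; ring
  have hsum : Summable b := by
    refine summable_of_prime_pow_le hbm hb0 (η := 2) (by norm_num) (fun e => by positivity) hc
      fun p hp e => ?_
    have hp2 : (2 : ℝ) ≤ p := by exact_mod_cast hp.two_le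
    rw [hbn, show (-2 : ℝ) = -((2 : ℕ) : ℝ) by norm_num, Real.rpow_neg (by positivity), Real.rpow_natCast]
    have e1 : (d k (p ^ (e + 1)) : ℝ) ≤ ((e + 2 : ℕ) : ℝ) ^ k := by
      exact_mod_cast d_prime_pow_le k hp (e + 1)
    have e2 : (((p ^ (e + 1) : ℕ) : ℝ) ^ 2)⁻¹ ≤ ((p : ℝ) ^ 2)⁻¹ * (1 / 4) ^ e := by
      have : (((p ^ (e + 1) : ℕ) : ℝ) ^ 2)⁻¹ = ((p : ℝ) ^ 2)⁻¹ * ((1 / (p : ℝ) ^ 2)) ^ e := by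
        push_cast; rw [one_div, inv_pow, ← mul_inv]; congr 1; ring
      rw [this]
      gcongr
      nlinarith
    calc _ ≤ (((e + 2 : ℕ) : ℝ) ^ k) ^ m * (((p : ℝ) ^ 2)⁻¹ * (1 / 4) ^ e) := by gcongr
      _ = _ := by rw [pow_mul]; ring
  set M := ∑' n, b n with hM
  have hM0 : 0 ≤ M := tsum_nonneg hb0
  refine ⟨M ^ ((m : ℝ)⁻¹), by positivity, fun n => ?_⟩
  rcases Nat.eq_zero_or_pos n with rfl | hn
  · simp [d_zero_right]; positivity
  have hn1 : (1 : ℝ) ≤ n := by exact_mod_cast hn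
  have h1 : (d k n : ℝ) ^ m ≤ M * (n : ℝ) ^ 2 := by
    have := hsum.le_tsum n fun j _ => hb0 j
    rw [hbn, ← hM, ← div_eq_mul_inv, div_le_iff₀ (by positivity)] at this
    exact this
  have h2 : (d k n : ℝ) = ((d k n : ℝ) ^ m) ^ ((m : ℝ)⁻¹) := by
    rw [← Real.rpow_natCast, ← Real.rpow_mul (by positivity), mul_inv_cancel₀ (by exact_mod_cast hm0.ne'),
      Real.rpow_one]
  rw [h2]
  calc ((d k n : ℝ) ^ m) ^ ((m : ℝ)⁻¹) ≤ (M * (n : ℝ) ^ 2) ^ ((m : ℝ)⁻¹) := by gcongr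
    _ = M ^ ((m : ℝ)⁻¹) * (n : ℝ) ^ (2 * (m : ℝ)⁻¹) := by
        rw [Real.mul_rpow hM0 (by positivity), ← Real.rpow_natCast, ← Real.rpow_mul (by positivity)]
        norm_num
    _ ≤ M ^ ((m : ℝ)⁻¹) * (n : ℝ) ^ ε := by
        gcongr
        rw [← div_eq_mul_inv]
        exact div_le_of_le_mul₀ (by positivity) hε.le (by rw [div_le_iff₀ hε] at hm; linarith)

lemma exists_sum_rpow_le {ε : ℝ} (hε : 0 < ε) :
    ∃ K : ℝ, 0 ≤ K ∧ ∀ u : ℝ, 1 ≤ u →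
      ∑ n ∈ Finset.Icc 1 ⌊u⌋₊, (n : ℝ) ^ (ε - 1) ≤ K * u ^ (2 * ε) := by
  have hs : Summable fun n : ℕ => (n : ℝ) ^ (-1 - ε) := Real.summable_nat_rpow.mpr (by linarith)
  refine ⟨∑' n : ℕ, (n : ℝ) ^ (-1 - ε), tsum_nonneg fun n => by positivity, fun u hu => ?_⟩
  calc ∑ n ∈ Finset.Icc 1 ⌊u⌋₊, (n : ℝ) ^ (ε - 1)
      ≤ ∑ n ∈ Finset.Icc 1 ⌊u⌋₊, (n : ℝ) ^ (-1 - ε) * u ^ (2 * ε) := by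
        refine Finset.sum_le_sum fun n hn => ?_
        have hn1 : (1 : ℝ) ≤ n := by exact_mod_cast (Finset.mem_Icc.mp hn).1
        have hn2 : (n : ℝ) ≤ u := (Nat.le_floor_iff (by linarith)).mp (Finset.mem_Icc.mp hn).2
        -- Splitting off n^{2ε} ≤ u^{2ε} leaves a convergent series; the doubled exponent is
        -- harmless.
        calc (n : ℝ) ^ (ε - 1) = (n : ℝ) ^ (-1 - ε) * (n : ℝ) ^ (2 * ε) := by
              rw [← Real.rpow_add (by linarith)]; congr 1; ring
          _ ≤ _ := by gcongr
    _ = (∑ n ∈ Finset.Icc 1 ⌊u⌋₊, (n : ℝ) ^ (-1 - ε)) * u ^ (2 * ε) := by rw [Finset.sum_mul]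
    _ ≤ _ := by
        gcongr
        exact hs.sum_le_tsum _ fun n _ => by positivity

lemma subPoly_of_norm_le {a : ℕ → ℂ} (k : ℕ) (h : ∀ n, ‖a n‖ ≤ (d k n : ℝ) / n) : SubPoly a := by
  intro ε hε
  obtain ⟨K, hK0, hK⟩ := exists_d_le k (half_pos hε)
  obtain ⟨L, hL0, hL⟩ := exists_sum_rpow_le (half_pos hε)
  refine ⟨K * L, by positivity, fun u hu => ?_⟩
  calc ∑ n ∈ Finset.Icc 1 ⌊u⌋₊, ‖a n‖ ≤ ∑ n ∈ Finset.Icc 1 ⌊u⌋₊, K * (n : ℝ) ^ (ε / 2 - 1) := by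
        refine Finset.sum_le_sum fun n hn => (h n).trans ?_
        have hn1 : (1 : ℝ) ≤ n := by exact_mod_cast (Finset.mem_Icc.mp hn).1
        rw [Real.rpow_sub_one (by linarith), mul_div_assoc']
        gcongr
        exact hK n
    _ = K * ∑ n ∈ Finset.Icc 1 ⌊u⌋₊, (n : ℝ) ^ (ε / 2 - 1) := by rw [Finset.mul_sum]
    _ ≤ K * (L * u ^ (2 * (ε / 2))) := by gcongr; exact hL u hu
    _ = K * L * u ^ ε := by rw [mul_div_cancel₀ _ two_ne_zero]; ring

/-! ### Weighted divisor sums over residue classes -/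

/-- The function `n ↦ d_k(n) / n` restricted to a residue class. -/
def dRes (q r k : ℕ) : ArithmeticFunction ℂ :=
  ⟨fun n => if n ≡ r [MOD q] then (d k n : ℂ) / n else 0, by simp⟩

lemma dRes_apply (q r k n : ℕ) :
    dRes q r k n = if n ≡ r [MOD q] then (d k n : ℂ) / n else 0 := rfl

lemma norm_dRes_le (q r k n : ℕ) : ‖dRes q r k n‖ ≤ (d k n : ℝ) / n := by
  rw [dRes_apply]
  split_ifs
  · rw [norm_div, Complex.norm_natCast, Complex.norm_natCast]
  · rw [norm_zero]; positivity

/-- Every factorization n = y₁ y₂ belongs to exactly one pair of residues (y₁ mod q, y₂ mod q). A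
class restriction of d_{k+1} is therefore a finite sum of convolutions of class restrictions of d_k
and of 1. -/
lemma dRes_succ {q : ℕ} (hq : 0 < q) (r k n : ℕ) :
    dRes q r (k + 1) n = ∑ x ∈ (Finset.range q ×ˢ Finset.range q).filter
      (fun x => x.1 * x.2 ≡ r [MOD q]), (dRes q x.1 k * dRes q x.2 1) n := by
  have h1 : ∀ n, d 1 n = if n = 0 then 0 else 1 := fun n => by
    simp [d, ArithmeticFunction.zeta_apply]
  have key : ∀ y ∈ n.divisorsAntidiagonal,
      ∑ x ∈ (Finset.range q ×ˢ Finset.range q).filter (fun x => x.1 * x.2 ≡ r [MOD q]),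
        dRes q x.1 k y.1 * dRes q x.2 1 y.2
      = if n ≡ r [MOD q] then (d k y.1 : ℂ) / n else 0 := by
    intro y hy
    obtain ⟨hy1, hy2⟩ := Nat.mem_divisorsAntidiagonal.mp hy
    have hy3 : y.2 ≠ 0 := by rintro h; simp [h] at hy1; exact hy2 hy1.symm
    have e1 : ∀ x ∈ (Finset.range q ×ˢ Finset.range q).filter (fun x => x.1 * x.2 ≡ r [MOD q]),
        x ≠ (y.1 % q, y.2 % q) → dRes q x.1 k y.1 * dRes q x.2 1 y.2 = 0 := by
      intro x hx hne
      simp only [Finset.mem_filter, Finset.mem_product, Finset.mem_range] at hx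
      rw [dRes_apply, dRes_apply]
      by_cases h2 : y.1 ≡ x.1 [MOD q]
      · by_cases h3 : y.2 ≡ x.2 [MOD q]
        · refine absurd (Prod.ext ?_ ?_) hne
          · rw [← Nat.mod_eq_of_lt hx.1.1]; exact h2.symm
          · rw [← Nat.mod_eq_of_lt hx.1.2]; exact h3.symm
        · rw [if_neg h3, mul_zero]
      · rw [if_neg h2, zero_mul]
    have e2 : (y.1 % q) * (y.2 % q) ≡ n [MOD q] := by
      rw [← hy1]; exact (Nat.mod_modEq _ _).mul (Nat.mod_modEq _ _)
    by_cases hn : n ≡ r [MOD q]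
    · rw [if_pos hn, Finset.sum_eq_single_of_mem (y.1 % q, y.2 % q) ?_ e1]
      · rw [dRes_apply, dRes_apply, if_pos (Nat.mod_modEq _ _).symm, if_pos (Nat.mod_modEq _ _).symm,
          h1, if_neg hy3, ← hy1]
        push_cast
        rw [div_mul_div_comm, mul_one]
      · simp only [Finset.mem_filter, Finset.mem_product, Finset.mem_range]
        exact ⟨⟨Nat.mod_lt _ hq, Nat.mod_lt _ hq⟩, e2.trans hn⟩
    · rw [if_neg hn]
      refine Finset.sum_eq_zero fun x hx => e1 x hx ?_
      rintro rfl
      exact hn (e2.symm.trans (Finset.mem_filter.mp hx).2)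
  have e3 : ∑ x ∈ (Finset.range q ×ˢ Finset.range q).filter
      (fun x => x.1 * x.2 ≡ r [MOD q]), (dRes q x.1 k * dRes q x.2 1) n
      = ∑ y ∈ n.divisorsAntidiagonal, if n ≡ r [MOD q] then (d k y.1 : ℂ) / n else 0 := by
    simp only [ArithmeticFunction.mul_apply]
    rw [Finset.sum_comm]
    exact Finset.sum_congr rfl key
  rw [e3, dRes_apply]
  split_ifs with hn
  · rw [d_succ, Nat.sum_divisorsAntidiagonal (fun x _ => (d k x : ℂ) / n)]
    push_cast
    rw [Finset.sum_div]
  · simp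

/-- Induction on k by the hyperbola method through `dRes_succ`. The modulus is fixed and the
polynomial is left unspecified. It is used with modulus 1, where it gives d_k itself, and with
moduli dividing h. -/
lemma powLog_dRes {q : ℕ} (hq : 0 < q) (r k : ℕ) : PowLog (partialSum (dRes q r k)) := by
  induction k generalizing r with
  | zero =>
    refine (PowLog.const (dRes q r 0 1)).congr fun u hu => ?_
    rw [partialSum, Finset.sum_eq_single_of_mem 1 (by simpa using hu)]
    intro n _ hn
    simp [dRes_apply, d_zero_left, hn]
  | succ k ih =>
    have h1 : ∀ r, PowLog (partialSum (dRes q r 1)) := fun r => by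
      refine (powLog_partialSum_inv_modEq q r hq).congr fun u _ => ?_
      refine Finset.sum_congr rfl fun n hn => ?_
      have : n ≠ 0 := by have := (Finset.mem_Icc.mp hn).1; omega
      simp [dRes_apply, d, ArithmeticFunction.zeta_apply, this]
    have h2 := PowLog.sum ((Finset.range q ×ˢ Finset.range q).filter
      (fun x => x.1 * x.2 ≡ r [MOD q])) (T := fun x => partialSum (dRes q x.1 k * dRes q x.2 1 : ArithmeticFunction ℂ))
      fun x _ => (ih x.1).convolution (h1 x.2) (subPoly_of_norm_le k (norm_dRes_le _ _ _))
        (subPoly_of_norm_le 1 (norm_dRes_le _ _ _))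
    refine h2.congr fun u _ => ?_
    simp only [partialSum]
    rw [Finset.sum_comm]
    exact Finset.sum_congr rfl fun n _ => dRes_succ hq r k n

/-! ### The Dirichlet series over integers with a prescribed gcd with q. -/

/-- The local factor at `p ^ α` of `q ↦ q / φ(q / (h, q)) * ∑_{(n, q) = (h, q)} d_k(n) n ^ (-s) / ζ(s) ^ k`. -/
def locFactor (h k : ℕ) (s : ℂ) (p α : ℕ) : ℂ :=
  if α ≤ h.factorization p then
    (p : ℂ) ^ α * (1 - (1 - (p : ℂ) ^ (-s)) ^ k *
      ∑ β ∈ Finset.range α, (d k (p ^ β) : ℂ) * ((p : ℂ) ^ (-s)) ^ β)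
  else (p : ℂ) ^ h.factorization p * (d k (p ^ h.factorization p) : ℂ)
    * ((p : ℂ) ^ (-s)) ^ h.factorization p * (1 - (p : ℂ) ^ (-s)) ^ k / (1 - (p : ℂ)⁻¹)

lemma locFactor_zero (h k : ℕ) (s : ℂ) (p : ℕ) : locFactor h k s p 0 = 1 := by simp [locFactor]

/-- The multiplicative function with the values `locFactor` at prime powers. -/
def gcdFactor (h k : ℕ) (s : ℂ) : ArithmeticFunction ℂ :=
  ⟨fun q => if q = 0 then 0 else q.factorization.prod (locFactor h k s), by simp⟩

lemma gcdFactor_apply (h k : ℕ) (s : ℂ) {q : ℕ} (hq : q ≠ 0) :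
    gcdFactor h k s q = q.factorization.prod (locFactor h k s) := if_neg hq

lemma gcdFactor_prime_pow (h k : ℕ) (s : ℂ) {p : ℕ} (hp : p.Prime) (α : ℕ) :
    gcdFactor h k s (p ^ α) = locFactor h k s p α := by
  rw [gcdFactor_apply _ _ _ (pow_ne_zero _ hp.ne_zero), hp.factorization_pow,
    Finsupp.prod_single_index (locFactor_zero _ _ _ _)]

lemma gcdFactor_isMultiplicative (h k : ℕ) (s : ℂ) : (gcdFactor h k s).IsMultiplicative := by
  rw [ArithmeticFunction.IsMultiplicative.iff_ne_zero]
  refine ⟨by rw [gcdFactor_apply _ _ _ one_ne_zero]; simp, fun {m n} hm hn hmn => ?_⟩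
  rw [gcdFactor_apply _ _ _ hm, gcdFactor_apply _ _ _ hn, gcdFactor_apply _ _ _ (mul_ne_zero hm hn),
    Nat.factorization_mul hm hn, Finsupp.prod_add_index_of_disjoint]
  exact hmn.disjoint_primeFactors

/-- Allows g, q/g and q to be written as products over one index set, the primes of q, so that they
can be compared prime by prime. -/
lemma prod_primeFactors_superset {R : Type*} [CommMonoid R] {f : ℕ → R} (h1 : f 1 = 1)
    (hmul : ∀ m n : ℕ, m.Coprime n → f (m * n) = f m * f n) {n : ℕ} (hn : n ≠ 0) {S : Finset ℕ}
    (hS : n.primeFactors ⊆ S) : f n = ∏ p ∈ S, f (p ^ n.factorization p) := by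
  rw [Nat.multiplicative_factorization f hmul h1 hn]
  exact Finsupp.prod_of_support_subset _ hS _ fun p _ => by simp [h1]

lemma norm_prime_cpow_lt_one {p : ℕ} (hp : p.Prime) {s : ℂ} (hs : 0 < s.re) : ‖(p : ℂ) ^ (-s)‖ < 1 := by
  rw [Complex.norm_natCast_cpow_of_pos hp.pos, Complex.neg_re]
  exact Real.rpow_lt_one_of_one_lt_of_neg (by exact_mod_cast hp.one_lt) (by linarith)

lemma one_sub_ne_zero_of_norm_lt_one {z : ℂ} (hz : ‖z‖ < 1) : 1 - z ≠ 0 := by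
  intro h
  rw [← sub_eq_zero.mp h] at hz
  simp at hz

lemma one_sub_inv_prime_ne_zero {p : ℕ} (hp : p.Prime) : 1 - (p : ℂ)⁻¹ ≠ 0 := by
  apply one_sub_ne_zero_of_norm_lt_one
  rw [norm_inv, Complex.norm_natCast]
  exact inv_lt_one_of_one_lt₀ (by exact_mod_cast hp.one_lt)

lemma hasSum_dC_shift (k : ℕ) {p : ℕ} (hp : p.Prime) {z : ℂ} (hz : ‖z‖ < 1) (α : ℕ) :
    HasSum (fun β : ℕ => (d k (p ^ (α + β)) : ℂ) * z ^ (α + β))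
      (((1 - z) ^ k)⁻¹ - ∑ β ∈ Finset.range α, (d k (p ^ β) : ℂ) * z ^ β) := by
  have h := (hasLocalSum_dC k hp hz).hasSum
  simp only [dC_apply] at h
  have h2 := (hasSum_nat_add_iff' α).mpr h
  simpa only [add_comm] using h2

/-- The finite sum in `locFactor` makes it visibly entire in s; the tail series is the form in which
the Euler product over multiples of p^α produces it. -/
lemma locFactor_of_le (h k : ℕ) {s : ℂ} (hs : 0 < s.re) {p : ℕ} (hp : p.Prime) {α : ℕ}
    (hα : α ≤ h.factorization p) :
    locFactor h k s p α = (p : ℂ) ^ α * ((1 - (p : ℂ) ^ (-s)) ^ k *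
      ∑' β : ℕ, (d k (p ^ (α + β)) : ℂ) * ((p : ℂ) ^ (-s)) ^ (α + β)) := by
  have hz := norm_prime_cpow_lt_one hp hs
  have hne := pow_ne_zero k (one_sub_ne_zero_of_norm_lt_one hz)
  rw [locFactor, if_pos hα, (hasSum_dC_shift k hp hz α).tsum_eq, mul_sub _ _ (∑ β ∈ _, _),
    mul_inv_cancel₀ hne]

lemma dC_lseriesSummable (k : ℕ) {s : ℂ} (hs : 1 < s.re) : LSeriesSummable (dC k) s := by
  induction k with
  | zero =>
    refine summable_of_ne_finset_zero (s := {1}) fun n hn => ?_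
    have : n ≠ 1 := by simpa using hn
    rcases eq_or_ne n 0 with rfl | h0
    · simp
    · rw [LSeries.term_of_ne_zero h0, dC_apply, d_zero_left, if_neg this]; simp
  | succ k ih =>
    rw [dC, pow_succ, ← dC]
    exact ArithmeticFunction.LSeriesSummable_mul ih (ArithmeticFunction.LSeriesSummable_zeta_iff.mpr hs)

lemma hasProd_zeta_pow (k : ℕ) {s : ℂ} (hs : 1 < s.re) :
    HasProd (fun p : Nat.Primes => ((1 - (p : ℂ) ^ (-s)) ^ k)⁻¹) (riemannZeta s ^ k) := by
  induction k with
  | zero => simp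
  | succ k ih =>
    have := ih.mul (riemannZeta_eulerProduct_hasProd hs)
    simpa only [pow_succ, mul_inv] using this

lemma d_mul_prime_pow (k : ℕ) {g p : ℕ} (hg : g ≠ 0) (hp : p.Prime) (e : ℕ) :
    d k (g * p ^ e) * d k (p ^ g.factorization p) = d k g * d k (p ^ (g.factorization p + e)) := by
  have h1 := Nat.ordProj_mul_ordCompl_eq_self g p
  have h2 : p.Coprime (g / p ^ g.factorization p) := Nat.coprime_ordCompl hp hg
  set g0 := g / p ^ g.factorization p
  set a := g.factorization p
  have e1 : d k (g * p ^ e) = d k (p ^ (a + e)) * d k g0 := by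
    rw [← d_mul_of_coprime k (h2.pow_left _), pow_add]
    congr 1
    rw [← h1]; ring
  have e2 : d k g = d k (p ^ a) * d k g0 := by
    rw [← d_mul_of_coprime k (h2.pow_left _), h1]
  rw [e1, e2]; ring

/-- An instance of f(lcm) f(gcd) = f(x) f(y) for multiplicative f. It makes n ↦ d_k(gn)/d_k(g)
multiplicative. -/
lemma d_mul_mul_coprime (k : ℕ) {g m n : ℕ} (hmn : m.Coprime n) :
    d k (g * (m * n)) * d k g = d k (g * m) * d k (g * n) := by
  have h := (d_isMultiplicative k).lcm_apply_mul_gcd_apply (x := g * m) (y := g * n)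
  rwa [Nat.gcd_mul_left, hmn.gcd_eq_one, mul_one, Nat.lcm_mul_left, hmn.lcm_eq_mul] at h

lemma gcd_mul_left_eq_iff {g q m : ℕ} (hg : g ≠ 0) (hgq : g ∣ q) :
    (g * m).gcd q = g ↔ m.Coprime (q / g) := by
  obtain ⟨q', rfl⟩ := hgq
  rw [Nat.gcd_mul_left, Nat.mul_div_cancel_left _ (Nat.pos_of_ne_zero hg), Nat.Coprime]
  constructor
  · intro h
    exact Nat.eq_of_mul_eq_mul_left (Nat.pos_of_ne_zero hg) (by rw [h, mul_one])
  · intro h; rw [h, mul_one]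

/-- The Dirichlet series over the integers with a given greatest common divisor with `q`. -/
lemma LSeries_gcd_eq (h k : ℕ) (hh : h ≠ 0) (hk : 1 ≤ k) {q : ℕ} (hq : q ≠ 0) {s : ℂ} (hs : 1 < s.re) :
    LSeries (fun n => if n.gcd q = h.gcd q then (d k n : ℂ) else 0) s
      = riemannZeta s ^ k * (((q / h.gcd q).totient : ℂ) * (gcdFactor h k s q / q)) := by
  set g := h.gcd q with hgdef
  have hg : g ≠ 0 := fun h0 => hq (Nat.eq_zero_of_gcd_eq_zero_right h0)
  have hgq : g ∣ q := Nat.gcd_dvd_right h q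
  have hdg : (d k g : ℂ) ≠ 0 := by exact_mod_cast (d_pos hk hg).ne'
  have hgs : (g : ℂ) ^ (-s) ≠ 0 := by
    rw [Complex.cpow_ne_zero_iff]; exact Or.inl (by exact_mod_cast hg)
  have hs0 : 0 < s.re := by linarith
  -- The integers with gcd g are n = g m with m coprime to q/g; dividing by d_k(g) makes the summand
  -- multiplicative in m.
  set F : ArithmeticFunction ℂ := ⟨fun n => if n.Coprime (q / g) then
    (d k (g * n) : ℂ) / d k g * (n : ℂ) ^ (-s) else 0, by simp [d_zero_right]⟩ with hF
  have hFn : ∀ n, F n = if n.Coprime (q / g) then (d k (g * n) : ℂ) / d k g * (n : ℂ) ^ (-s) else 0 :=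
    fun n => rfl
  have hterm : ∀ n, LSeries.term (fun n => if n.gcd q = g then (d k n : ℂ) else 0) s (g * n)
      = (d k g : ℂ) * (g : ℂ) ^ (-s) * F n := by
    intro n
    rcases eq_or_ne n 0 with rfl | hn
    · simp
    rw [LSeries.term_of_ne_zero (mul_ne_zero hg hn), hFn]
    simp only [gcd_mul_left_eq_iff hg hgq]
    split_ifs with hc
    · rw [div_eq_mul_inv, ← Complex.cpow_neg, Nat.cast_mul, Complex.natCast_mul_natCast_cpow]
      field_simp
    · simp
  have hinj : Function.Injective fun n : ℕ => g * n := fun a b hab =>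
    Nat.eq_of_mul_eq_mul_left (Nat.pos_of_ne_zero hg) hab
  have hLS : LSeries (fun n => if n.gcd q = g then (d k n : ℂ) else 0) s
      = (d k g : ℂ) * (g : ℂ) ^ (-s) * ∑' n, F n := by
    rw [LSeries, ← tsum_mul_left, ← hinj.tsum_eq]
    · exact tsum_congr hterm
    · intro n hn
      by_contra hc
      apply hn
      have : n.gcd q ≠ g := fun h0 => hc (by
        obtain ⟨m, hm⟩ := h0 ▸ Nat.gcd_dvd_left n q
        exact ⟨m, hm.symm⟩)
      rcases eq_or_ne n 0 with rfl | hn0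
      · simp
      · rw [LSeries.term_of_ne_zero hn0, if_neg this, zero_div]
  have hFmul : F.IsMultiplicative := by
    refine ⟨by simp [hFn, hdg], fun {m n} hmn => ?_⟩
    simp only [hFn, Nat.coprime_mul_iff_left]
    by_cases h1 : m.Coprime (q / g)
    swap
    · rw [if_neg (fun h0 => h1 h0.1), if_neg h1, zero_mul]
    by_cases h2 : n.Coprime (q / g)
    swap
    · rw [if_neg (fun h0 => h2 h0.2), if_neg h2, mul_zero]
    rw [if_pos ⟨h1, h2⟩, if_pos h1, if_pos h2]
    have h3 := d_mul_mul_coprime k (g := g) hmn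
    have h3' : (d k (g * (m * n)) : ℂ) * d k g = d k (g * m) * d k (g * n) := by exact_mod_cast h3
    rw [Nat.cast_mul, Complex.natCast_mul_natCast_cpow]
    field_simp
    linear_combination ((m : ℂ) ^ (-s) * (n : ℂ) ^ (-s)) * h3'
  have hFsum : Summable (‖F ·‖) := by
    have h1 : Summable fun n : ℕ => ‖LSeries.term (dC k) s (g * n)‖ :=
      (dC_lseriesSummable k hs).norm.comp_injective hinj
    have h2 := h1.mul_left ‖(d k g : ℂ) * (g : ℂ) ^ (-s)‖⁻¹
    refine Summable.of_nonneg_of_le (fun _ => norm_nonneg _) (fun n => ?_) h2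
    rcases eq_or_ne n 0 with rfl | hn
    · simp
    rw [hFn, LSeries.term_of_ne_zero (mul_ne_zero hg hn), ← norm_inv, ← norm_mul, dC_apply]
    split_ifs
    · refine le_of_eq (congrArg _ ?_)
      rw [div_eq_mul_inv _ (((g * n : ℕ) : ℂ) ^ s), ← Complex.cpow_neg, Nat.cast_mul,
        Complex.natCast_mul_natCast_cpow]
      field_simp
    · rw [norm_zero]; exact norm_nonneg _
  -- The quotient of the local sum of F by the Euler factor of ζ^k. It is 1 at primes not dividing
  -- q, so only a finite product corrects ζ(s)^k.
  set r : ℕ → ℂ := fun p => (1 - (p : ℂ) ^ (-s)) ^ k * ∑' e : ℕ, F (p ^ e) with hr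
  have hzp : ∀ p : ℕ, p.Prime → (1 - (p : ℂ) ^ (-s)) ^ k ≠ 0 := fun p hp =>
    pow_ne_zero k (one_sub_ne_zero_of_norm_lt_one (norm_prime_cpow_lt_one hp hs0))
  have hcp : ∀ p e : ℕ, ((p ^ e : ℕ) : ℂ) ^ (-s) = ((p : ℂ) ^ (-s)) ^ e := fun p e => by
    induction e with
    | zero => simp
    | succ e ih => rw [pow_succ, Nat.cast_mul, Complex.natCast_mul_natCast_cpow, ih, pow_succ]
  have hloc : ∀ p : ℕ, p.Prime → p.Coprime (q / g) → ∀ e, F (p ^ e)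
      = (d k (p ^ (g.factorization p + e)) : ℂ) / d k (p ^ g.factorization p) * ((p : ℂ) ^ (-s)) ^ e := by
    intro p hp hpc e
    rw [hFn, if_pos (hpc.pow_left e), hcp]
    congr 1
    have hdp : (d k (p ^ g.factorization p) : ℂ) ≠ 0 := by
      exact_mod_cast (d_pos hk (pow_ne_zero _ hp.ne_zero)).ne'
    rw [div_eq_div_iff hdg hdp]
    have := d_mul_prime_pow k hg hp e
    rw [mul_comm (d k g)] at this
    exact_mod_cast this
  have hr1 : ∀ p : Nat.Primes, p ∉ q.primeFactors.subtype Nat.Prime → r p = 1 := by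
    intro p hp
    have hpq : ¬ (p : ℕ) ∣ q := fun hd => hp
      (Finset.mem_subtype.mpr (Nat.mem_primeFactors.mpr ⟨p.2, hd, hq⟩))
    have hpg : ¬ (p : ℕ) ∣ g := fun hd => hpq (hd.trans hgq)
    have hpc : (p : ℕ).Coprime (q / g) := (Nat.Prime.coprime_iff_not_dvd p.2).mpr fun hd =>
      hpq (hd.trans (Nat.div_dvd_of_dvd hgq))
    have h0 := Nat.factorization_eq_zero_of_not_dvd hpg
    have h1 := (hasLocalSum_dC k p.2 (norm_prime_cpow_lt_one p.2 hs0)).2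
    simp only [hr, hloc p p.2 hpc, h0, pow_zero, zero_add, d_one_right, Nat.cast_one, div_one]
    simp only [dC_apply] at h1
    rw [h1, mul_inv_cancel₀ (hzp p p.2)]
  have hprod : ∑' n, F n = riemannZeta s ^ k * ∏ p ∈ q.primeFactors, r p := by
    have h1 := hFmul.eulerProduct_hasProd hFsum
    have h2 := (hasProd_zeta_pow k hs).mul (hasProd_prod_of_ne_finset_one hr1)
    have h3 : (fun p : Nat.Primes => ((1 - (p : ℂ) ^ (-s)) ^ k)⁻¹ * r p)
        = fun p : Nat.Primes => ∑' e : ℕ, F (p ^ e) := by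
      ext p
      simp only [hr]
      rw [← mul_assoc, inv_mul_cancel₀ (hzp p p.2), one_mul]
    have h4 := h1.unique (h3 ▸ h2)
    rw [h4]
    congr 1
    exact Finset.prod_subtype_of_mem r fun p hp => Nat.prime_of_mem_primeFactors hp
  have hgS : g.primeFactors ⊆ q.primeFactors := Nat.primeFactors_mono hgq hq
  have hqg0 : q / g ≠ 0 := (Nat.div_pos (Nat.le_of_dvd (Nat.pos_of_ne_zero hq) hgq) (Nat.pos_of_ne_zero hg)).ne'
  have hqgS : (q / g).primeFactors ⊆ q.primeFactors := Nat.primeFactors_mono (Nat.div_dvd_of_dvd hgq) hq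
  have p1 : (d k g : ℂ) = ∏ p ∈ q.primeFactors, (d k (p ^ g.factorization p) : ℂ) :=
    prod_primeFactors_superset (f := fun n => (d k n : ℂ)) (by simp [d_one_right])
      (fun m n hmn => by simp [d_mul_of_coprime k hmn]) hg hgS
  have p2 : (g : ℂ) ^ (-s) = ∏ p ∈ q.primeFactors, ((p ^ g.factorization p : ℕ) : ℂ) ^ (-s) :=
    prod_primeFactors_superset (f := fun n => (n : ℂ) ^ (-s)) (by simp)
      (fun m n _ => by rw [Nat.cast_mul, Complex.natCast_mul_natCast_cpow]) hg hgS
  have p3 : ((q / g).totient : ℂ) = ∏ p ∈ q.primeFactors, ((p ^ (q / g).factorization p).totient : ℂ) :=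
    prod_primeFactors_superset (f := fun n => (n.totient : ℂ)) (by simp)
      (fun m n hmn => by rw [Nat.totient_mul hmn]; push_cast; rfl) hqg0 hqgS
  have p4 : (q : ℂ) = ∏ p ∈ q.primeFactors, ((p ^ q.factorization p : ℕ) : ℂ) :=
    prod_primeFactors_superset (f := fun n => (n : ℂ)) (by simp)
      (fun m n _ => by push_cast; rfl) hq subset_rfl
  have p5 : gcdFactor h k s q = ∏ p ∈ q.primeFactors, locFactor h k s p (q.factorization p) := by
    rw [gcdFactor_apply _ _ _ hq]; rfl
  rw [hLS, hprod, mul_left_comm]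
  congr 1
  rw [p5]
  conv_lhs => rw [p1, p2]
  conv_rhs => rw [p3, p4]
  rw [← Finset.prod_mul_distrib, ← Finset.prod_mul_distrib, ← Finset.prod_div_distrib,
    ← Finset.prod_mul_distrib]
  refine Finset.prod_congr rfl fun p hp => ?_
  have hpp := Nat.prime_of_mem_primeFactors hp
  have hp0 : (p : ℂ) ≠ 0 := by exact_mod_cast hpp.ne_zero
  have hgp : g.factorization p = min (h.factorization p) (q.factorization p) := by
    rw [hgdef, Nat.factorization_gcd hh hq]; rfl
  have hqgp : (q / g).factorization p = q.factorization p - g.factorization p := by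
    rw [Nat.factorization_div hgq]; rfl
  rw [hcp]
  -- If p^α exactly divides q and α does not exceed the exponent of p in h, then p does not divide
  -- q/g and the local sum is unrestricted. Otherwise p divides q/g and only the term e = 0
  -- survives.
  rcases le_or_gt (q.factorization p) (h.factorization p) with hle | hlt
  · have ha : g.factorization p = q.factorization p := by rw [hgp, min_eq_right hle]
    have hpc : p.Coprime (q / g) := by
      refine (Nat.Prime.coprime_iff_not_dvd hpp).mpr fun hd => ?_
      have := (hpp.dvd_iff_one_le_factorization hqg0).mp hd
      omega
    have hdp : (d k (p ^ q.factorization p) : ℂ) ≠ 0 := by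
      exact_mod_cast (d_pos hk (pow_ne_zero _ hpp.ne_zero)).ne'
    rw [hqgp, ha, Nat.sub_self, pow_zero, Nat.totient_one, locFactor_of_le h k hs0 hpp hle]
    simp only [hr, hloc p hpp hpc, ha]
    have : ∑' β : ℕ, (d k (p ^ (q.factorization p + β)) : ℂ) * ((p : ℂ) ^ (-s)) ^ (q.factorization p + β)
        = (d k (p ^ q.factorization p) : ℂ) * ((p : ℂ) ^ (-s)) ^ q.factorization p *
          ∑' e : ℕ, (d k (p ^ (q.factorization p + e)) : ℂ) / d k (p ^ q.factorization p) * ((p : ℂ) ^ (-s)) ^ e := by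
      rw [← tsum_mul_left]
      refine tsum_congr fun e => ?_
      rw [pow_add ((p : ℂ) ^ (-s))]; field_simp
    rw [this]
    push_cast
    field_simp
  · have ha : g.factorization p = h.factorization p := by rw [hgp, min_eq_left hlt.le]
    have hdiv : p ∣ q / g := by
      rw [hpp.dvd_iff_one_le_factorization hqg0]; omega
    have hF0 : ∑' e : ℕ, F (p ^ e) = 1 := by
      rw [tsum_eq_single 0]
      · simpa using hFmul.1
      · intro e he
        rw [hFn, if_neg]
        rw [Nat.coprime_pow_left_iff (Nat.pos_of_ne_zero he), Nat.Prime.coprime_iff_not_dvd hpp]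
        exact fun hn => hn hdiv
    obtain ⟨c, hc⟩ := Nat.exists_eq_add_of_lt hlt
    have hq1 : q.factorization p - h.factorization p = c + 1 := by omega
    rw [hqgp, ha, hq1, locFactor, if_neg (by omega), Nat.totient_prime_pow_succ hpp, hc]
    simp only [hr, hF0]
    have h1p : (1 - (p : ℂ)⁻¹) = ((p - 1 : ℕ) : ℂ) / p := by
      rw [Nat.cast_sub hpp.one_le]; field_simp; simp
    have hp1 : ((p - 1 : ℕ) : ℂ) ≠ 0 := by
      have := hpp.two_le
      exact_mod_cast (by omega : p - 1 ≠ 0)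
    rw [h1p]
    push_cast
    field_simp
    ring

/-! ### The convolution factor `betaFn` and its uniform majorant. -/

/-- The arithmetic function whose convolution with `d_j` is `d_j(q) * gcdFactor(q)`. -/
def betaFn (h k j : ℕ) (s : ℂ) : ArithmeticFunction ℂ :=
  (dC j).pmul (gcdFactor h k s) * (ArithmeticFunction.moebius : ArithmeticFunction ℂ) ^ j

lemma dC_mul_moebius_pow (j : ℕ) :
    dC j * (ArithmeticFunction.moebius : ArithmeticFunction ℂ) ^ j = 1 := by
  rw [dC, ← mul_pow, ArithmeticFunction.coe_zeta_mul_coe_moebius, one_pow]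

lemma betaFn_mul_dC (h k j : ℕ) (s : ℂ) :
    betaFn h k j s * dC j = (dC j).pmul (gcdFactor h k s) := by
  rw [betaFn, mul_assoc, mul_comm _ (dC j), dC_mul_moebius_pow, mul_one]

lemma betaFn_isMultiplicative (h k j : ℕ) (s : ℂ) : (betaFn h k j s).IsMultiplicative :=
  ((dC_isMultiplicative j).pmul (gcdFactor_isMultiplicative h k s)).mul
    ArithmeticFunction.isMultiplicative_moebius.intCast.pow

/-- The constant value of `locFactor` at large exponents. -/
def locTail (h k : ℕ) (s : ℂ) (p : ℕ) : ℂ :=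
  (p : ℂ) ^ h.factorization p * (d k (p ^ h.factorization p) : ℂ)
    * ((p : ℂ) ^ (-s)) ^ h.factorization p * (1 - (p : ℂ) ^ (-s)) ^ k / (1 - (p : ℂ)⁻¹)

lemma locFactor_of_lt (h k : ℕ) (s : ℂ) {p α : ℕ} (hα : h.factorization p < α) :
    locFactor h k s p α = locTail h k s p := by
  rw [locFactor, if_neg (by omega), locTail]

/-- On prime powers μ has only the nonzero values 1 and -1, so each convolution with μ at most
doubles the bound, whatever the exponent m. -/
lemma norm_moebius_pow_le (j : ℕ) {p : ℕ} (hp : p.Prime) (m : ℕ) :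
    ‖((ArithmeticFunction.moebius : ArithmeticFunction ℂ) ^ j) (p ^ m)‖ ≤ 2 ^ j := by
  induction j generalizing m with
  | zero =>
    rw [pow_zero, pow_zero, ArithmeticFunction.one_apply]
    split_ifs <;> simp
  | succ j ih =>
    rw [pow_succ, mul_apply_prime_pow _ _ hp, Finset.Nat.sum_antidiagonal_eq_sum_range_succ_mk,
      ← Finset.sum_range_reflect]
    have hb : ∀ n : ℕ, ∑ i ∈ Finset.range n,
        ‖(ArithmeticFunction.moebius : ArithmeticFunction ℂ) (p ^ i)‖ ≤ 2 := fun n => by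
      have h0 : ∀ i, i ∉ Finset.range 2 →
          ‖(ArithmeticFunction.moebius : ArithmeticFunction ℂ) (p ^ i)‖ = 0 := fun i hi => by
        have hi' : 2 ≤ i := by simpa [Nat.succ_le_iff] using hi
        rw [ArithmeticFunction.intCoe_apply, ArithmeticFunction.moebius_apply_prime_pow hp (by omega),
          if_neg (by omega)]
        simp
      have h1 : HasSum (fun i => ‖(ArithmeticFunction.moebius : ArithmeticFunction ℂ) (p ^ i)‖)
          (∑ i ∈ Finset.range 2, ‖(ArithmeticFunction.moebius : ArithmeticFunction ℂ) (p ^ i)‖) :=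
        hasSum_sum_of_ne_finset_zero h0
      have h2 := sum_le_hasSum (Finset.range n) (fun i _ => norm_nonneg _) h1
      refine h2.trans ?_
      simp [Finset.sum_range_succ, ArithmeticFunction.moebius_apply_prime hp]
      norm_num
    calc _ ≤ ∑ i ∈ Finset.range (m + 1), 2 ^ j *
          ‖(ArithmeticFunction.moebius : ArithmeticFunction ℂ) (p ^ i)‖ := by
          refine norm_sum_le_of_le _ fun i hi => ?_
          have hi' : i ≤ m := by simpa [Nat.lt_succ_iff] using hi
          rw [norm_mul]
          have e : m - (m + 1 - 1 - i) = i := by omega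
          simp only [e]
          gcongr
          exact ih _
      _ = 2 ^ j * ∑ i ∈ Finset.range (m + 1), ‖(ArithmeticFunction.moebius : ArithmeticFunction ℂ) (p ^ i)‖ := by
          rw [Finset.mul_sum]
      _ ≤ 2 ^ j * 2 := by gcongr; exact hb _
      _ = 2 ^ (j + 1) := by rw [pow_succ]

/-- The convolution of d_j with the j-th power of μ vanishes at p^n for n ≠ 0, so the constant
`locTail` may be subtracted from `locFactor`. This kills all terms beyond the exponent of p in h and
leaves boundedly many, each of them small. -/
lemma betaFn_prime_pow (h k j : ℕ) (s : ℂ) {p : ℕ} (hp : p.Prime) {n : ℕ} (hn : n ≠ 0) :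
    betaFn h k j s (p ^ n) = ∑ x ∈ (Finset.HasAntidiagonal.antidiagonal n).filter
      (fun x => x.1 ≤ h.factorization p),
      (d j (p ^ x.1) : ℂ) * (locFactor h k s p x.1 - locTail h k s p)
        * ((ArithmeticFunction.moebius : ArithmeticFunction ℂ) ^ j) (p ^ x.2) := by
  have h1 : ∑ x ∈ Finset.HasAntidiagonal.antidiagonal n, dC j (p ^ x.1)
      * ((ArithmeticFunction.moebius : ArithmeticFunction ℂ) ^ j) (p ^ x.2) = 0 := by
    rw [← mul_apply_prime_pow _ _ hp, dC_mul_moebius_pow, ArithmeticFunction.one_apply_ne]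
    simp [hn, hp.one_lt.ne']
  rw [betaFn, mul_apply_prime_pow _ _ hp, Finset.sum_filter]
  have h2 := congrArg (locTail h k s p * ·) h1
  simp only [mul_zero, Finset.mul_sum] at h2
  refine sub_eq_zero.mp (Eq.trans ?_ h2)
  rw [← Finset.sum_sub_distrib]
  refine Finset.sum_congr rfl fun x _ => ?_
  rw [ArithmeticFunction.pmul_apply, gcdFactor_prime_pow _ _ _ hp, dC_apply]
  split_ifs with hx
  · ring
  · rw [locFactor_of_lt h k s (by omega)]; ring

lemma norm_one_sub_pow_sub_one_le (k : ℕ) {z : ℂ} (hz : ‖z‖ ≤ 1) :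
    ‖1 - (1 - z) ^ k‖ ≤ k * 2 ^ k * ‖z‖ := by
  have h2 : ‖1 - z‖ ≤ 2 := (norm_sub_le _ _).trans (by rw [norm_one]; linarith)
  have h := mul_geom_sum (1 - z) k
  have h3 : 1 - (1 - z) ^ k = z * ∑ i ∈ Finset.range k, (1 - z) ^ i := by
    linear_combination h
  rw [h3, norm_mul, mul_comm]
  gcongr
  calc ‖∑ i ∈ Finset.range k, (1 - z) ^ i‖ ≤ ∑ i ∈ Finset.range k, (2 : ℝ) ^ k := by
        refine norm_sum_le_of_le _ fun i hi => ?_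
        rw [norm_pow]
        calc ‖1 - z‖ ^ i ≤ 2 ^ i := by gcongr
          _ ≤ 2 ^ k := pow_le_pow_right₀ (by norm_num) (Finset.mem_range.mp hi).le
    _ = k * 2 ^ k := by simp

lemma norm_prime_cpow_le {p : ℕ} (hp : p.Prime) {s : ℂ} {σ : ℝ} (hs : σ ≤ s.re) :
    ‖(p : ℂ) ^ (-s)‖ ≤ (p : ℝ) ^ (-σ) := by
  rw [Complex.norm_natCast_cpow_of_pos hp.pos, Complex.neg_re]
  exact Real.rpow_le_rpow_of_exponent_le (by exact_mod_cast hp.one_le) (by linarith)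

lemma re_ge_of_mem_closedBall {s : ℂ} (hs : s ∈ Metric.closedBall (1 : ℂ) (1 / 4)) : 3 / 4 ≤ s.re := by
  rw [Metric.mem_closedBall, Complex.dist_eq] at hs
  have h1 := Complex.abs_re_le_norm (s - 1)
  rw [Complex.sub_re, Complex.one_re] at h1
  have := (abs_le.mp (h1.trans hs)).1
  linarith

lemma norm_one_sub_inv_prime_ge {p : ℕ} (hp : p.Prime) : 1 / 2 ≤ ‖1 - (p : ℂ)⁻¹‖ := by
  have h1 : ‖(p : ℂ)⁻¹‖ ≤ 1 / 2 := by
    rw [norm_inv, Complex.norm_natCast, one_div]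
    exact inv_anti₀ two_pos (by exact_mod_cast hp.two_le)
  have := norm_sub_norm_le (1 : ℂ) ((p : ℂ)⁻¹)
  rw [norm_one] at this
  linarith

/-- If p ∤ h, only α = 0 occurs and the difference is 1 - (1 - p^{-s})^k/(1 - 1/p), which is
O(p^{-3/4}) for Re s ≥ 3/4. If p ∣ h, then p ≤ h, so a crude bound suffices, the power p^{-3/4}
being supplied by 1 ≤ h p^{-3/4}. -/
lemma exists_norm_locFactor_sub_le (h k j : ℕ) (hh : h ≠ 0) :
    ∃ K : ℝ, 0 ≤ K ∧ ∀ p : ℕ, p.Prime → ∀ s ∈ Metric.closedBall (1 : ℂ) (1 / 4),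
      ∀ α ≤ h.factorization p,
        ‖(d j (p ^ α) : ℂ) * (locFactor h k s p α - locTail h k s p)‖ ≤ K * (p : ℝ) ^ (-(3 / 4) : ℝ) := by
  set M : ℝ := (h + 1 : ℝ) ^ k with hM
  set K1 : ℝ := 2 * (1 + k * 2 ^ k) with hK1
  set K2 : ℝ := (h + 1 : ℝ) ^ j * (h * (1 + 2 ^ k * (h * M)) + h * M * 2 ^ k * 2) * h with hK2
  have hM0 : 0 ≤ M := by positivity
  refine ⟨K1 + K2, by positivity, fun p hp s hs α hα => ?_⟩
  have hs' := re_ge_of_mem_closedBall hs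
  have hz1 := norm_prime_cpow_le hp hs'
  have hz2 : ‖(p : ℂ) ^ (-s)‖ ≤ 1 := (norm_prime_cpow_lt_one hp (by linarith)).le
  have hp1 : (1 : ℝ) ≤ p := by exact_mod_cast hp.one_le
  have hP := norm_one_sub_inv_prime_ge hp
  have hP0 : 0 < ‖1 - (p : ℂ)⁻¹‖ := by linarith
  have hPne := one_sub_inv_prime_ne_zero hp
  set z := (p : ℂ) ^ (-s) with hz
  by_cases hph : p ∣ h
  · have hple : p ≤ h := Nat.le_of_dvd (Nat.pos_of_ne_zero hh) hph
    have hγ : h.factorization p ≤ h := (Nat.factorization_lt p hh).le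
    have hpγ : (p : ℝ) ^ h.factorization p ≤ h := by
      exact_mod_cast Nat.le_of_dvd (Nat.pos_of_ne_zero hh) (Nat.ordProj_dvd h p)
    have hpα : (p : ℝ) ^ α ≤ h := (pow_le_pow_right₀ hp1 hα).trans hpγ
    have hd : ∀ i β : ℕ, β ≤ h → (d i (p ^ β) : ℝ) ≤ (h + 1 : ℝ) ^ i := fun i β hβ => by
      have h1 : (d i (p ^ β) : ℝ) ≤ (β + 1 : ℝ) ^ i := by exact_mod_cast d_prime_pow_le i hp β
      refine h1.trans ?_
      gcongr
    have h1z : ‖(1 - z) ^ k‖ ≤ 2 ^ k := by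
      rw [norm_pow]
      gcongr
      exact (norm_sub_le _ _).trans (by rw [norm_one]; linarith)
    have e1 : ‖locFactor h k s p α‖ ≤ h * (1 + 2 ^ k * (h * M)) := by
      rw [locFactor, if_pos hα, norm_mul, norm_pow, Complex.norm_natCast]
      gcongr
      refine (norm_sub_le _ _).trans ?_
      rw [norm_one, norm_mul]
      gcongr
      calc ‖∑ β ∈ Finset.range α, (d k (p ^ β) : ℂ) * z ^ β‖ ≤ ∑ β ∈ Finset.range α, M := by
            refine norm_sum_le_of_le _ fun β hβ => ?_
            rw [norm_mul, norm_pow, Complex.norm_natCast]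
            have : β ≤ h := by have := Finset.mem_range.mp hβ; omega
            exact (mul_le_of_le_one_right (by positivity) (pow_le_one₀ (norm_nonneg _) hz2)).trans
              (hd k β this)
        _ = α * M := by simp
        _ ≤ h * M := by gcongr; exact hα.trans hγ
    have e2 : ‖locTail h k s p‖ ≤ h * M * 2 ^ k * 2 := by
      rw [locTail, norm_div, norm_mul, norm_mul, norm_mul, norm_pow, norm_pow _ (h.factorization p),
        Complex.norm_natCast, Complex.norm_natCast, div_eq_mul_inv]
      have e3 : ‖1 - (p : ℂ)⁻¹‖⁻¹ ≤ 2 := by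
        rw [inv_le_comm₀ hP0 two_pos]; linarith
      have e4 : ‖z‖ ^ h.factorization p ≤ 1 := pow_le_one₀ (norm_nonneg _) hz2
      have e5 := hd k _ hγ
      calc _ ≤ (h : ℝ) * M * 1 * 2 ^ k * 2 := by gcongr
        _ = _ := by ring
    have e6 : (1 : ℝ) ≤ h * (p : ℝ) ^ (-(3 / 4) : ℝ) := by
      have e7 : ((p : ℝ))⁻¹ ≤ (p : ℝ) ^ (-(3 / 4) : ℝ) := by
        rw [← Real.rpow_neg_one]
        exact Real.rpow_le_rpow_of_exponent_le hp1 (by norm_num)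
      calc (1 : ℝ) = p * (p : ℝ)⁻¹ := by field_simp
        _ ≤ h * (p : ℝ) ^ (-(3 / 4) : ℝ) := by gcongr
    have e8 : ‖(d j (p ^ α) : ℂ) * (locFactor h k s p α - locTail h k s p)‖
        ≤ (h + 1 : ℝ) ^ j * (h * (1 + 2 ^ k * (h * M)) + h * M * 2 ^ k * 2) := by
      rw [norm_mul, Complex.norm_natCast]
      have := hd j α (hα.trans hγ)
      gcongr
      exact (norm_sub_le _ _).trans (add_le_add e1 e2)
    calc _ ≤ (h + 1 : ℝ) ^ j * (h * (1 + 2 ^ k * (h * M)) + h * M * 2 ^ k * 2) * 1 := by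
          rw [mul_one]; exact e8
      _ ≤ (h + 1 : ℝ) ^ j * (h * (1 + 2 ^ k * (h * M)) + h * M * 2 ^ k * 2)
            * (h * (p : ℝ) ^ (-(3 / 4) : ℝ)) := by gcongr
      _ = K2 * (p : ℝ) ^ (-(3 / 4) : ℝ) := by rw [hK2]; ring
      _ ≤ _ := by gcongr; linarith [show 0 ≤ K1 by positivity]
  · have hγ : h.factorization p = 0 := Nat.factorization_eq_zero_of_not_dvd hph
    have hα0 : α = 0 := by omega
    subst hα0
    rw [locFactor_zero, locTail, hγ]
    simp only [pow_zero, d_one_right, Nat.cast_one, one_mul]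
    have e1 : 1 - (1 - z) ^ k / (1 - (p : ℂ)⁻¹) = ((1 - (1 - z) ^ k) - (p : ℂ)⁻¹) / (1 - (p : ℂ)⁻¹) := by
      rw [eq_div_iff hPne, sub_mul, div_mul_cancel₀ _ hPne]; ring
    have e2 : ‖(1 - (1 - z) ^ k) - (p : ℂ)⁻¹‖ ≤ (1 + k * 2 ^ k) * (p : ℝ) ^ (-(3 / 4) : ℝ) := by
      refine (norm_sub_le _ _).trans ?_
      have e3 := norm_one_sub_pow_sub_one_le k hz2
      have e4 : ‖(p : ℂ)⁻¹‖ ≤ (p : ℝ) ^ (-(3 / 4) : ℝ) := by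
        rw [norm_inv, Complex.norm_natCast, ← Real.rpow_neg_one]
        exact Real.rpow_le_rpow_of_exponent_le hp1 (by norm_num)
      calc _ ≤ k * 2 ^ k * (p : ℝ) ^ (-(3 / 4) : ℝ) + (p : ℝ) ^ (-(3 / 4) : ℝ) := by
            gcongr
            refine e3.trans ?_
            gcongr
        _ = _ := by ring
    rw [e1, norm_div, div_le_iff₀ hP0]
    calc _ ≤ (1 + k * 2 ^ k) * (p : ℝ) ^ (-(3 / 4) : ℝ) := e2
      _ = K1 * (p : ℝ) ^ (-(3 / 4) : ℝ) * (1 / 2) := by rw [hK1]; ring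
      _ ≤ (K1 + K2) * (p : ℝ) ^ (-(3 / 4) : ℝ) * ‖1 - (p : ℂ)⁻¹‖ := by
          gcongr
          linarith [show 0 ≤ K2 by positivity]

lemma exists_norm_betaFn_prime_pow_le (h k j : ℕ) (hh : h ≠ 0) :
    ∃ K : ℝ, 0 ≤ K ∧ ∀ p : ℕ, p.Prime → ∀ s ∈ Metric.closedBall (1 : ℂ) (1 / 4),
      ∀ e : ℕ, ‖betaFn h k j s (p ^ (e + 1))‖ ≤ K * (p : ℝ) ^ (-(3 / 4) : ℝ) := by
  obtain ⟨K, hK0, hK⟩ := exists_norm_locFactor_sub_le h k j hh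
  refine ⟨(h + 1) * (K * 2 ^ j), by positivity, fun p hp s hs e => ?_⟩
  rw [betaFn_prime_pow h k j s hp e.succ_ne_zero]
  have hcard : ((Finset.HasAntidiagonal.antidiagonal (e + 1)).filter
      (fun x => x.1 ≤ h.factorization p)).card ≤ h + 1 := by
    have h1 : (((Finset.HasAntidiagonal.antidiagonal (e + 1)).filter
        (fun x => x.1 ≤ h.factorization p)).card) ≤ (Finset.range (h + 1)).card := by
      refine Finset.card_le_card_of_injOn Prod.fst (fun x hx => ?_) (fun x hx y hy hxy => ?_)
      · have hx2 := (Finset.mem_filter.mp hx).2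
        have := (Nat.factorization_lt p hh)
        simp only [Finset.coe_range, Set.mem_Iio]
        omega
      · have hx1 := Finset.HasAntidiagonal.mem_antidiagonal.mp (Finset.mem_filter.mp hx).1
        have hy1 := Finset.HasAntidiagonal.mem_antidiagonal.mp (Finset.mem_filter.mp hy).1
        exact Prod.ext hxy (by omega)
    simpa using h1
  calc _ ≤ ∑ x ∈ (Finset.HasAntidiagonal.antidiagonal (e + 1)).filter
        (fun x => x.1 ≤ h.factorization p), (K * (p : ℝ) ^ (-(3 / 4) : ℝ)) * 2 ^ j := by
        refine norm_sum_le_of_le _ fun x hx => ?_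
        rw [norm_mul]
        gcongr
        · exact hK p hp s hs x.1 (Finset.mem_filter.mp hx).2
        · exact norm_moebius_pow_le j hp _
    _ = (((Finset.HasAntidiagonal.antidiagonal (e + 1)).filter
        (fun x => x.1 ≤ h.factorization p)).card : ℝ) * ((K * (p : ℝ) ^ (-(3 / 4) : ℝ)) * 2 ^ j) := by
        rw [Finset.sum_const, nsmul_eq_mul]
    _ ≤ (h + 1) * ((K * (p : ℝ) ^ (-(3 / 4) : ℝ)) * 2 ^ j) := by
        gcongr
        exact_mod_cast hcard
    _ = _ := by ring

/-- A summable majorant of `betaFn`, uniform for `s` near `1`. -/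
lemma exists_betaFn_majorant (h k j : ℕ) (hh : h ≠ 0) :
    ∃ b : ℕ → ℝ, (∀ n, 0 ≤ b n) ∧ Summable (fun n => b n * (n : ℝ) ^ (-(3 / 4) : ℝ)) ∧
      ∀ s ∈ Metric.closedBall (1 : ℂ) (1 / 4), ∀ n, ‖betaFn h k j s n‖ ≤ b n := by
  obtain ⟨K, hK0, hK⟩ := exists_norm_betaFn_prime_pow_le h k j hh
  set b : ArithmeticFunction ℝ :=
    ArithmeticFunction.prodPrimeFactors fun p => K * (p : ℝ) ^ (-(3 / 4) : ℝ) with hb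
  have hbm : b.IsMultiplicative := ArithmeticFunction.IsMultiplicative.prodPrimeFactors _
  have hb0 : ∀ n, 0 ≤ b n := fun n => by
    rcases eq_or_ne n 0 with rfl | hn
    · simp
    · rw [hb, ArithmeticFunction.prodPrimeFactors_apply hn]
      exact Finset.prod_nonneg fun p _ => by positivity
  set c : ArithmeticFunction ℝ := ⟨fun n => b n * (n : ℝ) ^ (-(3 / 4) : ℝ), by simp⟩ with hc
  have hcn : ∀ n, c n = b n * (n : ℝ) ^ (-(3 / 4) : ℝ) := fun n => rfl
  have hcm : c.IsMultiplicative := by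
    refine ⟨by simp [hcn, hbm.1], fun {m n} hmn => ?_⟩
    rw [hcn, hcn, hcn, hbm.2 hmn, Nat.cast_mul, Real.mul_rpow (by positivity) (by positivity)]
    ring
  have hθ : (2 : ℝ) ^ (-(3 / 4) : ℝ) < 1 := Real.rpow_lt_one_of_one_lt_of_neg (by norm_num) (by norm_num)
  refine ⟨b, hb0, ?_, fun s hs n => ?_⟩
  -- Since b(p^{e+1}) = K p^{-3/4} for every e, the weight n^{-3/4} brings the value down to
  -- p^{-3/2} times a geometric factor in e, and 3/2 > 1.
  · refine summable_of_prime_pow_le hcm (fun n => by rw [hcn]; have := hb0 n; positivity) (η := 3 / 2)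
      (by norm_num) (c := fun e => K * ((2 : ℝ) ^ (-(3 / 4) : ℝ)) ^ e) (fun e => by positivity)
      ((summable_geometric_of_lt_one (by positivity) hθ).mul_left K) fun p hp e => ?_
    have hp0 : (0 : ℝ) < p := by exact_mod_cast hp.pos
    have e1 : b (p ^ (e + 1)) = K * (p : ℝ) ^ (-(3 / 4) : ℝ) := by
      rw [hb, ArithmeticFunction.prodPrimeFactors_apply (pow_ne_zero _ hp.ne_zero),
        Nat.primeFactors_prime_pow e.succ_ne_zero hp, Finset.prod_singleton]
    have e2 : ((p ^ (e + 1) : ℕ) : ℝ) ^ (-(3 / 4) : ℝ)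
        = (p : ℝ) ^ (-(3 / 4) : ℝ) * ((p : ℝ) ^ (-(3 / 4) : ℝ)) ^ e := by
      rw [Nat.cast_pow, ← pow_succ', ← Real.rpow_natCast, ← Real.rpow_mul hp0.le, mul_comm,
        Real.rpow_mul hp0.le, Real.rpow_natCast]
    rw [hcn, e1, e2]
    calc K * (p : ℝ) ^ (-(3 / 4) : ℝ) * ((p : ℝ) ^ (-(3 / 4) : ℝ) * ((p : ℝ) ^ (-(3 / 4) : ℝ)) ^ e)
        = (p : ℝ) ^ (-(3 / 2) : ℝ) * (K * ((p : ℝ) ^ (-(3 / 4) : ℝ)) ^ e) := by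
          rw [show (-(3 / 2) : ℝ) = -(3 / 4) + -(3 / 4) by norm_num, Real.rpow_add hp0]; ring
      _ ≤ _ := by
          gcongr ?_ * (_ * ?_ ^ e)
          exact Real.rpow_le_rpow_of_nonpos (by norm_num) (by exact_mod_cast hp.two_le) (by norm_num)
  · rcases eq_or_ne n 0 with rfl | hn
    · simp
    · rw [(betaFn_isMultiplicative h k j s).multiplicative_factorization _ hn, hb,
        ArithmeticFunction.prodPrimeFactors_apply hn, Finsupp.prod, norm_prod]
      refine Finset.prod_le_prod (fun _ _ => norm_nonneg _) fun p hp => ?_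
      have hpp := Nat.prime_of_mem_primeFactors hp
      obtain ⟨e, he⟩ := Nat.exists_eq_succ_of_ne_zero (Finsupp.mem_support_iff.mp hp)
      rw [he]
      exact hK p hpp s hs e

lemma betaFn_lseriesSummable {h k j : ℕ} (hh : h ≠ 0) {s : ℂ}
    (hs : s ∈ Metric.closedBall (1 : ℂ) (1 / 4)) {w : ℂ} (hw : 3 / 4 ≤ w.re) :
    LSeriesSummable (betaFn h k j s) w := by
  obtain ⟨b, hb0, hb1, hb2⟩ := exists_betaFn_majorant h k j hh
  refine Summable.of_norm_bounded hb1 fun n => ?_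
  rcases eq_or_ne n 0 with rfl | hn
  · simp
  rw [LSeries.norm_term_eq, if_neg hn, div_eq_mul_inv, ← Real.rpow_neg (by positivity)]
  have : (1 : ℝ) ≤ n := by exact_mod_cast Nat.one_le_iff_ne_zero.mpr hn
  gcongr
  · exact hb0 n
  · exact hb2 s hs n

/-! ### The Euler product -/

lemma cpow_neg_prime_pow (p e : ℕ) (s : ℂ) : ((p ^ e : ℕ) : ℂ) ^ (-s) = ((p : ℂ) ^ (-s)) ^ e := by
  induction e with
  | zero => simp
  | succ e ih => rw [pow_succ, Nat.cast_mul, Complex.natCast_mul_natCast_cpow, ih, pow_succ]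

lemma hasProd_LSeries {f : ArithmeticFunction ℂ} (hf : f.IsMultiplicative) {s : ℂ}
    (hs : LSeriesSummable f s) :
    HasProd (fun p : Nat.Primes => ∑' e : ℕ, f (p ^ e) * ((p : ℂ) ^ (-s)) ^ e) (LSeries f s) := by
  set F : ArithmeticFunction ℂ := ⟨fun n => f n * (n : ℂ) ^ (-s), by simp⟩ with hF
  have hFn : ∀ n, F n = f n * (n : ℂ) ^ (-s) := fun n => rfl
  have hterm : ∀ n, LSeries.term f s n = F n := fun n => by
    rcases eq_or_ne n 0 with rfl | hn
    · simp
    · rw [LSeries.term_of_ne_zero hn, hFn, Complex.cpow_neg, div_eq_mul_inv]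
  have hFm : F.IsMultiplicative := by
    refine ⟨by simp [hFn, hf.1], fun {m n} hmn => ?_⟩
    rw [hFn, hFn, hFn, hf.2 hmn, Nat.cast_mul, Complex.natCast_mul_natCast_cpow]
    ring
  have h1 := hFm.eulerProduct_hasProd (by simpa only [hterm] using hs.norm)
  have h2 : ∑' n, F n = LSeries f s := tsum_congr fun n => (hterm n).symm
  rw [h2] at h1
  convert! h1 using 3 with p
  ext e
  rw [hFn, cpow_neg_prime_pow]

/-- The local sum of `d_j * gcdFactor`. -/
def locSum (h k j : ℕ) (s : ℂ) (p : ℕ) (z : ℂ) : ℂ :=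
  ∑ α ∈ Finset.range (h.factorization p + 1), (d j (p ^ α) : ℂ) * locFactor h k s p α * z ^ α
    + locTail h k s p * ∑' β : ℕ, (d j (p ^ (h.factorization p + 1 + β)) : ℂ) * z ^ (h.factorization p + 1 + β)

lemma hasLocalSum_pmul_gcdFactor (h k j : ℕ) (s : ℂ) {p : ℕ} (hp : p.Prime) {z : ℂ} (hz : ‖z‖ < 1) :
    HasLocalSum ((dC j).pmul (gcdFactor h k s)) p z (locSum h k j s p z) := by
  have hv : ∀ α, ((dC j).pmul (gcdFactor h k s)) (p ^ α) * z ^ α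
      = (d j (p ^ α) : ℂ) * locFactor h k s p α * z ^ α := fun α => by
    rw [ArithmeticFunction.pmul_apply, gcdFactor_prime_pow _ _ _ hp, dC_apply]
  have ht : ∀ β, (d j (p ^ (β + (h.factorization p + 1))) : ℂ) * locFactor h k s p (β + (h.factorization p + 1))
      * z ^ (β + (h.factorization p + 1)) = locTail h k s p *
        ((d j (p ^ (h.factorization p + 1 + β)) : ℂ) * z ^ (h.factorization p + 1 + β)) := fun β => by
    rw [locFactor_of_lt h k s (by omega), add_comm β]; ring
  have hs := (hasLocalSum_dC j hp hz).1
  simp only [dC_apply] at hs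
  have hsum : Summable fun α : ℕ => ‖(d j (p ^ α) : ℂ) * locFactor h k s p α * z ^ α‖ := by
    rw [← summable_nat_add_iff (h.factorization p + 1)]
    simp only [ht, norm_mul (locTail h k s p)]
    refine Summable.mul_left _ ?_
    have := (summable_nat_add_iff (h.factorization p + 1)).mpr hs
    simpa only [add_comm] using this
  refine ⟨by simpa only [hv] using hsum, ?_⟩
  simp only [hv]
  rw [← hsum.of_norm.sum_add_tsum_nat_add (h.factorization p + 1), locSum, ← tsum_mul_left]
  simp only [ht]

lemma tsum_betaFn_prime_pow (h k j : ℕ) (s : ℂ) {p : ℕ} (hp : p.Prime) {z : ℂ} (hz : ‖z‖ < 1) :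
    ∑' e : ℕ, betaFn h k j s (p ^ e) * z ^ e = locSum h k j s p z * (1 - z) ^ j :=
  ((hasLocalSum_pmul_gcdFactor h k j s hp hz).mul hp ((hasLocalSum_moebius hp z).pow hp j)).2

/-- The factors of `eulerC`. -/
def eulerCFactor (k j : ℕ) (s w : ℂ) (p : ℕ) : ℂ :=
  (1 - (p : ℂ) ^ (-w - 1)) ^ j + (1 - (p : ℂ) ^ (-s)) ^ k / (1 - (p : ℂ)⁻¹)
    - (1 - (p : ℂ) ^ (-s)) ^ k * (1 - (p : ℂ) ^ (-w - 1)) ^ j / (1 - (p : ℂ)⁻¹)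

lemma locSum_of_not_dvd {h : ℕ} (k j : ℕ) (s : ℂ) {p : ℕ} (hp : p.Prime) (hph : ¬ p ∣ h) {z : ℂ}
    (hz : ‖z‖ < 1) :
    locSum h k j s p z * (1 - z) ^ j = (1 - z) ^ j + (1 - (p : ℂ) ^ (-s)) ^ k / (1 - (p : ℂ)⁻¹)
      - (1 - (p : ℂ) ^ (-s)) ^ k * (1 - z) ^ j / (1 - (p : ℂ)⁻¹) := by
  have hγ : h.factorization p = 0 := Nat.factorization_eq_zero_of_not_dvd hph
  have h1 := (hasSum_dC_shift j hp hz 1).tsum_eq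
  have hz' : (1 - z) ^ j ≠ 0 := pow_ne_zero _ (one_sub_ne_zero_of_norm_lt_one hz)
  rw [locSum, locTail, hγ]
  simp only [zero_add, Finset.sum_range_one, pow_zero, d_one_right, Nat.cast_one, mul_one,
    one_mul, locFactor_zero] at h1 ⊢
  rw [h1, add_mul, mul_assoc, sub_mul, inv_mul_cancel₀ hz']
  ring

/-- The factors of `eulerF`. -/
def eulerFFactor (h k j : ℕ) (s w : ℂ) (p : ℕ) : ℂ :=
  ((1 - (p : ℂ)⁻¹) * (∑ α ∈ Finset.range (h.factorization p + 1), (d j (p ^ α) : ℂ) *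
          (∑' β : ℕ, (d k (p ^ (α + β)) : ℂ) * (p : ℂ) ^ (-((α : ℂ) + β) * s - α * w)))
        + (d k (p ^ h.factorization p) : ℂ) * (p : ℂ) ^ ((h.factorization p : ℂ) * (1 - s)) *
          (∑' β : ℕ, (d j (p ^ (h.factorization p + 1 + β)) : ℂ) *
            (p : ℂ) ^ (-((h.factorization p : ℂ) + 1 + β) * (w + 1))))
      / ((1 - (p : ℂ)⁻¹) * ((1 - (p : ℂ) ^ (-s)) ^ k)⁻¹
          + ((1 - (p : ℂ) ^ (-w - 1)) ^ j)⁻¹ - 1)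

lemma inv_mul_identity {P u : ℂ} (hP : P ≠ 0) (hu : u ≠ 0) (S a b c t : ℂ) :
    P * S + b * (a * c) * t = P * u⁻¹ * (u * S + a * b * c * u / P * t) := by
  field_simp

lemma euler_factor_identity {P u v : ℂ} (hP : P ≠ 0) (hu : u ≠ 0) (hv : v ≠ 0) (S : ℂ) :
    (v + u / P - u * v / P) * (P * u⁻¹ * S) = S * v * (P * u⁻¹ + v⁻¹ - 1) := by
  field_simp

/-- The numerator of the f-factor is a multiple of `locSum`, and its denominator is exactly what the
C-factor cancels. The product is the local factor of `betaFn` at p. -/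
lemma eulerCFactor_mul_eulerFFactor (h k j : ℕ) {s w : ℂ} (hs : 0 < s.re) {p : ℕ} (hp : p.Prime)
    (hz : ‖(p : ℂ) ^ (-w - 1)‖ < 1)
    (hne : (1 - (p : ℂ)⁻¹) * ((1 - (p : ℂ) ^ (-s)) ^ k)⁻¹ + ((1 - (p : ℂ) ^ (-w - 1)) ^ j)⁻¹ - 1 ≠ 0) :
    eulerCFactor k j s w p * eulerFFactor h k j s w p
      = locSum h k j s p ((p : ℂ) ^ (-w - 1)) * (1 - (p : ℂ) ^ (-w - 1)) ^ j := by
  have hp0 : (p : ℂ) ≠ 0 := by exact_mod_cast hp.ne_zero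
  have hu : (1 - (p : ℂ) ^ (-s)) ^ k ≠ 0 :=
    pow_ne_zero _ (one_sub_ne_zero_of_norm_lt_one (norm_prime_cpow_lt_one hp hs))
  have hv : (1 - (p : ℂ) ^ (-w - 1)) ^ j ≠ 0 := pow_ne_zero _ (one_sub_ne_zero_of_norm_lt_one hz)
  have hP := one_sub_inv_prime_ne_zero hp
  set γ := h.factorization p with hγ
  have e1 : ∀ α β : ℕ, (p : ℂ) ^ (-((α : ℂ) + β) * s - α * w)
      = ((p : ℂ) ^ (-s)) ^ (α + β) * ((p : ℂ) ^ α * ((p : ℂ) ^ (-w - 1)) ^ α) := fun α β => by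
    rw [← Complex.cpow_nat_mul, ← Complex.cpow_nat_mul, ← Complex.cpow_natCast (p : ℂ) α,
      ← Complex.cpow_add _ _ hp0, ← Complex.cpow_add _ _ hp0]
    congr 1; push_cast; ring
  have e2 : ∀ β : ℕ, (p : ℂ) ^ (-((γ : ℂ) + 1 + β) * (w + 1)) = ((p : ℂ) ^ (-w - 1)) ^ (γ + 1 + β) :=
    fun β => by
      rw [← Complex.cpow_nat_mul]
      congr 1; push_cast; ring
  have e3 : (p : ℂ) ^ ((γ : ℂ) * (1 - s)) = (p : ℂ) ^ γ * ((p : ℂ) ^ (-s)) ^ γ := by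
    rw [← Complex.cpow_nat_mul, ← Complex.cpow_natCast (p : ℂ) γ, ← Complex.cpow_add _ _ hp0]
    congr 1; ring
  have hA : ∑ α ∈ Finset.range (γ + 1), (d j (p ^ α) : ℂ) * locFactor h k s p α * ((p : ℂ) ^ (-w - 1)) ^ α
      = (1 - (p : ℂ) ^ (-s)) ^ k * ∑ α ∈ Finset.range (γ + 1), (d j (p ^ α) : ℂ) *
          (∑' β : ℕ, (d k (p ^ (α + β)) : ℂ) * (p : ℂ) ^ (-((α : ℂ) + β) * s - α * w)) := by
    rw [Finset.mul_sum]
    refine Finset.sum_congr rfl fun α hα => ?_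
    rw [locFactor_of_le h k hs hp (by have := Finset.mem_range.mp hα; omega)]
    simp only [e1, ← mul_assoc]
    rw [tsum_mul_right, tsum_mul_right]
    ring
  have hN : (1 - (p : ℂ)⁻¹) * (∑ α ∈ Finset.range (γ + 1), (d j (p ^ α) : ℂ) *
          (∑' β : ℕ, (d k (p ^ (α + β)) : ℂ) * (p : ℂ) ^ (-((α : ℂ) + β) * s - α * w)))
        + (d k (p ^ γ) : ℂ) * (p : ℂ) ^ ((γ : ℂ) * (1 - s)) *
          (∑' β : ℕ, (d j (p ^ (γ + 1 + β)) : ℂ) *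
            (p : ℂ) ^ (-((γ : ℂ) + 1 + β) * (w + 1)))
      = (1 - (p : ℂ)⁻¹) * ((1 - (p : ℂ) ^ (-s)) ^ k)⁻¹ * locSum h k j s p ((p : ℂ) ^ (-w - 1)) := by
    rw [locSum, ← hγ, hA, locTail, ← hγ, e3]
    simp only [e2]
    exact inv_mul_identity hP hu _ _ _ _ _
  rw [eulerFFactor, ← hγ, hN, eulerCFactor, mul_div_assoc', div_eq_iff hne]
  exact euler_factor_identity hP hu hv _

/-- For h = 1 the Euler product of `betaFn` is literally the product defining `eulerC`, which also
proves its convergence. For general h the local factors change only at p ∣ h, where `eulerF`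
accounts for the change. -/
lemma lseries_betaFn_eq (h k j : ℕ) (hh : h ≠ 0) {s w : ℂ} (hs : s ∈ Metric.closedBall (1 : ℂ) (1 / 4))
    (hw : -(1 / 4) ≤ w.re)
    (hne : ∀ p ∈ h.primeFactors, (1 - (p : ℂ)⁻¹) * ((1 - (p : ℂ) ^ (-s)) ^ k)⁻¹
      + ((1 - (p : ℂ) ^ (-w - 1)) ^ j)⁻¹ - 1 ≠ 0) :
    LSeries (betaFn h k j s) (1 + w) = eulerC k (j + 1) s w * eulerF h k (j + 1) s w := by
  have hs0 : 0 < s.re := by linarith [re_ge_of_mem_closedBall hs]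
  have hw1 : (1 + w).re = 1 + w.re := by simp
  have hexp : -(1 + w) = -w - 1 := by ring
  have hz : ∀ p : ℕ, p.Prime → ‖(p : ℂ) ^ (-w - 1)‖ < 1 := fun p hp => by
    rw [← hexp]; exact norm_prime_cpow_lt_one hp (by rw [hw1]; linarith)
  have hC : HasProd (fun p : Nat.Primes => eulerCFactor k j s w p) (LSeries (betaFn 1 k j s) (1 + w)) := by
    have h1 := hasProd_LSeries (betaFn_isMultiplicative 1 k j s) (s := 1 + w)
      (betaFn_lseriesSummable one_ne_zero hs (by rw [hw1]; linarith))
    convert! h1 using 2 with p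
    rw [hexp, tsum_betaFn_prime_pow 1 k j s p.2 (hz p p.2),
      locSum_of_not_dvd k j s p.2 (by simpa using p.2.one_lt.ne') (hz p p.2)]
    rfl
  have hC' : eulerC k (j + 1) s w = LSeries (betaFn 1 k j s) (1 + w) := hC.tprod_eq
  set r : ℕ → ℂ := fun p => if p ∈ h.primeFactors then eulerFFactor h k j s w p else 1 with hr
  have hr1 : ∀ p : Nat.Primes, p ∉ h.primeFactors.subtype Nat.Prime → r p = 1 := fun p hp =>
    if_neg fun hd => hp (Finset.mem_subtype.mpr hd)
  have h2 := hC.mul (hasProd_prod_of_ne_finset_one hr1)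
  have h3 : ∏ p ∈ h.primeFactors.subtype Nat.Prime, r p = eulerF h k (j + 1) s w := by
    rw [Finset.prod_subtype_of_mem r fun p hp => Nat.prime_of_mem_primeFactors hp]
    exact Finset.prod_congr rfl fun p hp => if_pos hp
  rw [← hC'] at h2
  have h1 := hasProd_LSeries (betaFn_isMultiplicative h k j s) (s := 1 + w)
      (betaFn_lseriesSummable hh hs (by rw [hw1]; linarith))
  have h4 : (fun p : Nat.Primes => ∑' e : ℕ, betaFn h k j s (p ^ e) * ((p : ℂ) ^ (-(1 + w))) ^ e)
      = fun p : Nat.Primes => eulerCFactor k j s w p * r p := by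
    ext p
    rw [hexp, tsum_betaFn_prime_pow h k j s p.2 (hz p p.2)]
    by_cases hp : (p : ℕ) ∈ h.primeFactors
    · simp only [hr, if_pos hp]
      rw [eulerCFactor_mul_eulerFFactor h k j hs0 p.2 (hz p p.2) (hne p hp)]
    · simp only [hr, if_neg hp, mul_one]
      rw [locSum_of_not_dvd k j s p.2 (fun hd => hp (Nat.mem_primeFactors.mpr ⟨p.2, hd, hh⟩)) (hz p p.2)]
      rfl
  rw [h4] at h1
  rw [← h3]
  exact h1.unique h2

/-! ### The Dirichlet series of `d_k` -/

lemma zetaReg_of_ne {s : ℂ} (hs : s ≠ 1) : zetaReg s = (s - 1) * riemannZeta s :=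
  Function.update_of_ne hs _ _

lemma zetaReg_one : zetaReg 1 = 1 := Function.update_self _ _ _

/-- Removable singularity: (s - 1) ζ(s) is holomorphic off 1 and tends to 1 there. -/
lemma analyticAt_zetaReg : AnalyticAt ℂ zetaReg 1 := by
  refine Complex.analyticAt_of_differentiable_on_punctured_nhds_of_continuousAt ?_ ?_
  · filter_upwards [self_mem_nhdsWithin] with s hs
    have h1 : zetaReg =ᶠ[𝓝 s] fun s => (s - 1) * riemannZeta s := by
      filter_upwards [isOpen_ne.mem_nhds hs] with t ht using zetaReg_of_ne ht
    refine DifferentiableAt.congr_of_eventuallyEq ?_ h1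
    exact (differentiableAt_id.sub_const 1).mul (differentiableAt_riemannZeta hs)
  · exact continuousAt_update_same.mpr riemannZeta_residue_one

lemma LSeries_dC (k : ℕ) {s : ℂ} (hs : 1 < s.re) : LSeries (dC k) s = riemannZeta s ^ k := by
  have h1 := hasProd_LSeries (dC_isMultiplicative k) (dC_lseriesSummable k hs)
  have h2 : (fun p : Nat.Primes => ∑' e : ℕ, dC k (p ^ e) * ((p : ℂ) ^ (-s)) ^ e)
      = fun p : Nat.Primes => ((1 - (p : ℂ) ^ (-s)) ^ k)⁻¹ :=
    funext fun p => (hasLocalSum_dC k p.2 (norm_prime_cpow_lt_one p.2 (by linarith))).2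
  rw [h2] at h1
  exact h1.unique (hasProd_zeta_pow k hs)

/-- The arithmetic function `n ↦ f(n) / n`. -/
def divId (f : ArithmeticFunction ℂ) : ArithmeticFunction ℂ := ⟨fun n => f n / n, by simp⟩

lemma divId_apply (f : ArithmeticFunction ℂ) (n : ℕ) : divId f n = f n / n := rfl

lemma divId_mul (f g : ArithmeticFunction ℂ) : divId (f * g) = divId f * divId g := by
  ext n
  rw [divId_apply, ArithmeticFunction.mul_apply, ArithmeticFunction.mul_apply, Finset.sum_div]
  refine Finset.sum_congr rfl fun x hx => ?_
  rw [divId_apply, divId_apply, div_mul_div_comm, ← (Nat.mem_divisorsAntidiagonal.mp hx).1, Nat.cast_mul]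

lemma term_divId (f : ArithmeticFunction ℂ) (w : ℂ) (n : ℕ) :
    LSeries.term (divId f) w n = LSeries.term f (1 + w) n := by
  rcases eq_or_ne n 0 with rfl | hn
  · simp
  · rw [LSeries.term_of_ne_zero hn, LSeries.term_of_ne_zero hn, divId_apply,
      Complex.cpow_add _ _ (by exact_mod_cast hn), Complex.cpow_one, div_div]

lemma LSeries_divId (f : ArithmeticFunction ℂ) (w : ℂ) : LSeries (divId f) w = LSeries f (1 + w) :=
  tsum_congr fun n => term_divId f w n

lemma lseriesSummable_divId (f : ArithmeticFunction ℂ) (w : ℂ) :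
    LSeriesSummable (divId f) w ↔ LSeriesSummable f (1 + w) :=
  summable_congr fun n => term_divId f w n

lemma taylorCoeff_comp_const_add (f : ℂ → ℂ) (c : ℂ) (n : ℕ) :
    taylorCoeff (fun w => f (c + w)) 0 n = taylorCoeff f c n := by
  simp [taylorCoeff, iteratedDeriv_comp_const_add]

/-- `powLog_dRes` modulo 1 supplies the asymptotics. The coefficients follow from w^j ζ(1 + w)^j
being analytic at w = 0. -/
lemma exists_logAsymp_divId_dC (j : ℕ) :
    ∃ (P : ℂ[X]) (δ : ℝ), 0 < δ ∧ LogAsymp (partialSum (divId (dC j))) P δ ∧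
      ∀ m, P.coeff m * (m ! : ℂ) = if m ≤ j then aCoeff (j - m) j / ((j - m)! : ℂ) else 0 := by
  obtain ⟨P, δ, hδ, hP⟩ := powLog_dRes one_pos 0 j
  have h1 : dRes 1 0 j = divId (dC j) := by
    ext n
    rw [dRes_apply, if_pos (Nat.modEq_one), divId_apply, dC_apply]
  rw [h1] at hP
  refine ⟨P, δ, hδ, hP, fun m => ?_⟩
  have hre : ∀ w : ℝ, 0 < w → 1 < (1 + (w : ℂ)).re := fun w hw => by simpa using hw
  rw [hP.coeff_eq hδ (fun w hw => (lseriesSummable_divId _ _).mpr (dC_lseriesSummable j (hre w hw)))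
    (Y := fun w => zetaReg (1 + w) ^ j) (j := j) ?_ (fun w hw => ?_),
    taylorCoeff_comp_const_add (fun s => zetaReg s ^ j)]
  · rfl
  · have h2 : AnalyticAt ℂ zetaReg (1 + 0) := by rw [add_zero]; exact analyticAt_zetaReg
    exact (h2.fun_comp_of_eq (analyticAt_const.add analyticAt_id) rfl).pow j
  · have hw' : (1 : ℂ) + w ≠ 1 := by simpa using hw.ne'
    rw [LSeries_divId, LSeries_dC j (hre w hw), zetaReg_of_ne hw', mul_pow, mul_comm]
    simp

/-- For v < 1 the partial sum is empty and |P(log v)| ≪ v^{-δ} anyway. Hence the estimate may be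
applied at u/i for all i, including i > u. -/
lemma LogAsymp.norm_sub_le_of_pos {a : ℕ → ℂ} {P : ℂ[X]} {δ : ℝ} (hδ : 0 < δ)
    (h : LogAsymp (partialSum a) P δ) :
    ∃ K : ℝ, 0 ≤ K ∧ ∀ v : ℝ, 0 < v → ‖partialSum a v - P.eval (Real.log v : ℂ)‖ ≤ K * v ^ (-δ) := by
  obtain ⟨K, hK0, hK⟩ := h.nonneg_const
  obtain ⟨L, hL0, hL⟩ := exists_norm_eval_le P hδ
  refine ⟨K + L, by positivity, fun v hv => ?_⟩
  have hp : 0 < v ^ (-δ) := by positivity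
  rcases le_or_gt 1 v with h1 | h1
  · refine (hK v h1).trans ?_
    gcongr
    linarith
  · have h2 : partialSum a v = 0 := by
      rw [partialSum, Nat.floor_eq_zero.mpr h1]; simp
    rw [h2, zero_sub, norm_neg]
    have h3 := hL v⁻¹ (Real.log v : ℂ) ((one_le_inv₀ hv).mpr h1.le) (by
      rw [Complex.norm_real, Real.log_inv, Real.norm_of_nonpos (Real.log_nonpos hv.le h1.le)])
    rw [Real.inv_rpow hv.le, ← Real.rpow_neg hv.le] at h3
    refine h3.trans ?_
    gcongr
    linarith

/-! ### Dependence on `s` -/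

lemma differentiable_locFactor (h k : ℕ) {p : ℕ} (hp : p ≠ 0) (α : ℕ) :
    Differentiable ℂ fun s => locFactor h k s p α := by
  have h1 : Differentiable ℂ fun s : ℂ => (p : ℂ) ^ (-s) := fun s =>
    (differentiableAt_id.neg).const_cpow (Or.inl (by exact_mod_cast hp))
  unfold locFactor
  split_ifs <;> fun_prop

lemma differentiable_gcdFactor (h k q : ℕ) : Differentiable ℂ fun s => gcdFactor h k s q := by
  rcases eq_or_ne q 0 with rfl | hq
  · simp
  · simp only [gcdFactor_apply h k _ hq, Finsupp.prod]
    exact Differentiable.fun_finsetProd fun p hp =>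
      differentiable_locFactor h k (Nat.prime_of_mem_primeFactors hp).ne_zero _

lemma differentiable_betaFn (h k j n : ℕ) : Differentiable ℂ fun s => betaFn h k j s n := by
  simp only [betaFn, ArithmeticFunction.mul_apply, ArithmeticFunction.pmul_apply]
  exact Differentiable.fun_sum fun x _ =>
    ((differentiable_gcdFactor h k x.1).const_mul _).mul_const _

/-- The derivatives `∑ β_s(n) (-log n) ^ i / n` of the Dirichlet series of `betaFn` at `1`. -/
def betaMoment (h k j i : ℕ) (s : ℂ) : ℂ :=
  ∑' n : ℕ, betaFn h k j s n / n * (-(Real.log n : ℂ)) ^ i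

/-- The gap between 1 and the exponent 3/4 of the majorant absorbs the power of log n. -/
lemma exists_betaMoment_majorant (h k j : ℕ) (hh : h ≠ 0) (i : ℕ) :
    ∃ c : ℕ → ℝ, Summable c ∧ ∀ s ∈ Metric.closedBall (1 : ℂ) (1 / 4), ∀ n,
      ‖betaFn h k j s n / n * (-(Real.log n : ℂ)) ^ i‖ ≤ c n := by
  obtain ⟨b, hb0, hb1, hb2⟩ := exists_betaFn_majorant h k j hh
  obtain ⟨K, hK0, hK⟩ := exists_log_pow_le i (ε := 1 / 4) (by norm_num)
  refine ⟨fun n => K * (b n * (n : ℝ) ^ (-(3 / 4) : ℝ)), hb1.mul_left K, fun s hs n => ?_⟩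
  rcases eq_or_ne n 0 with rfl | hn
  · simp
  have hn1 : (1 : ℝ) ≤ n := by exact_mod_cast Nat.one_le_iff_ne_zero.mpr hn
  have hn0 : (0 : ℝ) < n := by linarith
  rw [norm_mul, norm_div, norm_pow, norm_neg, Complex.norm_natCast]
  have h1 : ‖(Real.log n : ℂ)‖ ^ i ≤ K * (n : ℝ) ^ (1 / 4 : ℝ) :=
    (pow_le_pow_left₀ (norm_nonneg _) (norm_log_le hn1) i).trans (hK n hn1)
  calc _ ≤ b n / n * (K * (n : ℝ) ^ (1 / 4 : ℝ)) := by
        have h2 := hb2 s hs n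
        have h3 := hb0 n
        gcongr
    _ = K * (b n * ((n : ℝ) ^ (-1 : ℝ) * (n : ℝ) ^ (1 / 4 : ℝ))) := by rw [Real.rpow_neg_one]; ring
    _ = _ := by rw [← Real.rpow_add hn0]; norm_num

lemma differentiableOn_betaMoment (h k j : ℕ) (hh : h ≠ 0) (i : ℕ) :
    DifferentiableOn ℂ (betaMoment h k j i) (Metric.ball 1 (1 / 4)) := by
  obtain ⟨c, hc, hb⟩ := exists_betaMoment_majorant h k j hh i
  exact Complex.differentiableOn_tsum_of_summable_norm hc
    (fun n => (((differentiable_betaFn h k j n).div_const _).mul_const _).differentiableOn)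
    Metric.isOpen_ball fun n s hs => hb s (Metric.ball_subset_closedBall hs) n

lemma betaMoment_eq_iteratedDeriv {h k j : ℕ} (hh : h ≠ 0) (i : ℕ) {s : ℂ}
    (hs : s ∈ Metric.closedBall (1 : ℂ) (1 / 4)) :
    iteratedDeriv i (LSeries (betaFn h k j s)) 1 = betaMoment h k j i s := by
  have habs : LSeries.abscissaOfAbsConv (betaFn h k j s) < (1 : ℂ).re := by
    refine (LSeriesSummable.abscissaOfAbsConv_le (s := (3 / 4 : ℂ))
      (betaFn_lseriesSummable hh hs (by norm_num))).trans_lt ?_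
    have : (3 / 4 : ℂ).re = 3 / 4 := by norm_num
    rw [this, Complex.one_re]
    exact_mod_cast (by norm_num : (3 / 4 : ℝ) < 1)
  rw [LSeries_iteratedDeriv i habs, LSeries, ← tsum_mul_left, betaMoment]
  refine tsum_congr fun n => ?_
  have h1 : ∀ (f : ℕ → ℂ) (m : ℕ), (LSeries.logMul^[m] f) n = Complex.log n ^ m * f n := by
    intro f m
    induction m generalizing f with
    | zero => simp
    | succ m ih => rw [Function.iterate_succ_apply, ih, LSeries.logMul, pow_succ]; ring
  rcases eq_or_ne n 0 with rfl | hn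
  · simp
  · rw [LSeries.term_of_ne_zero hn, h1, Complex.cpow_one, ← Complex.natCast_log, neg_pow]
    ring

lemma eval_sub_eq_sum_of_natDegree_le (Q : ℂ[X]) {N : ℕ} (hN : Q.natDegree ≤ N) (L M : ℂ) :
    Q.eval (L - M) = ∑ n ∈ Finset.range (N + 1), (hasseDeriv n Q).eval L * (-M) ^ n := by
  rw [eval_sub_eq_sum]
  refine Finset.sum_subset (Finset.range_mono (by omega)) fun n _ hn => ?_
  rw [hasseDeriv_eq_zero_of_lt_natDegree Q n (by simp at hn; omega), eval_zero, zero_mul]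

/-- Terms with i > u vanish, so the sum may run over all i; the main term then becomes a complete
series, with no truncation to estimate. -/
lemma partialSum_gcdFactor_eq_tsum (h k j : ℕ) (s : ℂ) {u : ℝ} (hu : 1 ≤ u) :
    partialSum (divId ((dC j).pmul (gcdFactor h k s))) u
      = ∑' i : ℕ, betaFn h k j s i / i * partialSum (divId (dC j)) (u / i) := by
  rw [← betaFn_mul_dC, divId_mul, partialSum_mul, tsum_eq_sum (s := Finset.Icc 1 ⌊u⌋₊)]
  · rfl
  · intro i hi
    rcases eq_or_ne i 0 with rfl | hi0
    · simp
    · have hiu : u < i := by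
        by_contra hc
        push Not at hc
        exact hi (Finset.mem_Icc.mpr ⟨Nat.one_le_iff_ne_zero.mpr hi0, Nat.le_floor hc⟩)
      have : ⌊u / i⌋₊ = 0 := Nat.floor_eq_zero.mpr ((div_lt_one (by linarith)).mpr hiu)
      rw [partialSum, this]
      simp

/-- Expanding P(log u - log n) turns the complete sum over n into the moments of `betaFn`. The
essential point is that `K` and `δ` do not depend on s, which permits Cauchy's estimate afterwards.
-/
lemma exists_partialSum_gcdFactor_sub_le (h k j : ℕ) (hh : h ≠ 0) :
    ∃ (P : ℂ[X]) (δ K : ℝ), 0 < δ ∧ P.natDegree ≤ j ∧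
      (∀ m, P.coeff m * (m ! : ℂ) = if m ≤ j then aCoeff (j - m) j / ((j - m)! : ℂ) else 0) ∧
      ∀ s ∈ Metric.closedBall (1 : ℂ) (1 / 4), ∀ u : ℝ, 1 ≤ u →
        ‖partialSum (divId ((dC j).pmul (gcdFactor h k s))) u
          - ∑ i ∈ Finset.range (j + 1), (hasseDeriv i P).eval (Real.log u : ℂ) * betaMoment h k j i s‖
        ≤ K * u ^ (-δ) := by
  obtain ⟨P, δ, hδ, hP, hcoeff⟩ := exists_logAsymp_divId_dC j
  -- With the saving capped at 1/4, n^{-1+η} ≤ n^{-3/4}, which the majorant can sum.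
  have hδ' : 0 < min δ (1 / 4) := lt_min hδ (by norm_num)
  obtain ⟨K, hK0, hK⟩ := (hP.mono (min_le_left δ (1 / 4))).norm_sub_le_of_pos hδ'
  set η := min δ (1 / 4) with hη
  have hη4 : η ≤ 1 / 4 := min_le_right _ _
  obtain ⟨b, hb0, hb1, hb2⟩ := exists_betaFn_majorant h k j hh
  have hdeg : P.natDegree ≤ j := by
    rw [natDegree_le_iff_coeff_eq_zero]
    intro m hm
    have := hcoeff m
    rw [if_neg (by omega)] at this
    exact (mul_eq_zero.mp this).resolve_right (by exact_mod_cast m.factorial_ne_zero)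
  refine ⟨P, η, K * ∑' n, b n * (n : ℝ) ^ (-(3 / 4) : ℝ), hδ', hdeg, hcoeff, fun s hs u hu => ?_⟩
  have hu0 : 0 < u := by linarith
  have hmom : ∀ i, Summable fun n : ℕ => betaFn h k j s n / n * (-(Real.log n : ℂ)) ^ i := fun i => by
    obtain ⟨c, hc, hb⟩ := exists_betaMoment_majorant h k j hh i
    exact Summable.of_norm_bounded hc (hb s hs)
  have hmain : HasSum (fun n : ℕ => betaFn h k j s n / n * P.eval ((Real.log u : ℂ) - Real.log n))
      (∑ i ∈ Finset.range (j + 1), (hasseDeriv i P).eval (Real.log u : ℂ) * betaMoment h k j i s) := by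
    have h1 := hasSum_sum (s := Finset.range (j + 1)) fun i _ =>
      (hmom i).hasSum.mul_left ((hasseDeriv i P).eval (Real.log u : ℂ))
    convert! h1 using 2 with n
    rw [eval_sub_eq_sum_of_natDegree_le P hdeg, Finset.mul_sum]
    exact Finset.sum_congr rfl fun i _ => by ring
  rw [partialSum_gcdFactor_eq_tsum h k j s hu]
  have hbd : ∀ n : ℕ, ‖betaFn h k j s n / n * partialSum (divId (dC j)) (u / n)
      - betaFn h k j s n / n * P.eval ((Real.log u : ℂ) - Real.log n)‖
      ≤ K * u ^ (-η) * (b n * (n : ℝ) ^ (-(3 / 4) : ℝ)) := fun n => by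
    rcases eq_or_ne n 0 with rfl | hn
    · simp
    have hn1 : (1 : ℝ) ≤ n := by exact_mod_cast Nat.one_le_iff_ne_zero.mpr hn
    have hn0 : (0 : ℝ) < n := by linarith
    rw [← mul_sub, norm_mul, norm_div, Complex.norm_natCast]
    have h1 := hK (u / n) (by positivity)
    rw [Real.log_div hu0.ne' hn0.ne', Complex.ofReal_sub, Real.div_rpow hu0.le hn0.le,
      Real.rpow_neg hn0.le, div_inv_eq_mul] at h1
    have h2 := hb2 s hs n
    have h3 := hb0 n
    calc _ ≤ b n / n * (K * (u ^ (-η) * (n : ℝ) ^ η)) := by gcongr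
      _ = K * u ^ (-η) * (b n * ((n : ℝ) ^ (-1 : ℝ) * (n : ℝ) ^ η)) := by rw [Real.rpow_neg_one]; ring
      _ ≤ _ := by
          rw [← Real.rpow_add hn0]
          have : -1 + η ≤ -(3 / 4) := by linarith
          gcongr
  have hsum : Summable fun n : ℕ => betaFn h k j s n / n * partialSum (divId (dC j)) (u / n)
      - betaFn h k j s n / n * P.eval ((Real.log u : ℂ) - Real.log n) :=
    Summable.of_norm_bounded (hb1.mul_left _) hbd
  have hsum2 : Summable fun n : ℕ => betaFn h k j s n / n * partialSum (divId (dC j)) (u / n) := by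
    simpa using hsum.add hmain.summable
  rw [← hmain.tsum_eq, ← hsum2.tsum_sub hmain.summable]
  refine (tsum_of_norm_bounded (hb1.hasSum.mul_left _) hbd).trans (le_of_eq (by ring))

/-! ### Taylor coefficients in `s` -/

lemma taylorCoeff_sum {ι : Type*} (t : Finset ι) {f : ι → ℂ → ℂ} {c : ℂ} (n : ℕ)
    (hf : ∀ i ∈ t, AnalyticAt ℂ (f i) c) :
    taylorCoeff (fun s => ∑ i ∈ t, f i s) c n = ∑ i ∈ t, taylorCoeff (f i) c n := by
  simp only [taylorCoeff]
  rw [iteratedDeriv_fun_sum fun i hi => (hf i hi).contDiffAt, Finset.sum_div]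

lemma taylorCoeff_sub {f g : ℂ → ℂ} {c : ℂ} (n : ℕ) (hf : AnalyticAt ℂ f c) (hg : AnalyticAt ℂ g c) :
    taylorCoeff (fun s => f s - g s) c n = taylorCoeff f c n - taylorCoeff g c n := by
  rw [taylorCoeff, iteratedDeriv_fun_sub hf.contDiffAt hg.contDiffAt, sub_div, taylorCoeff, taylorCoeff]

lemma taylorCoeff_const_mul (a : ℂ) (f : ℂ → ℂ) (c : ℂ) (n : ℕ) :
    taylorCoeff (fun s => a * f s) c n = a * taylorCoeff f c n := by
  rw [taylorCoeff, iteratedDeriv_const_mul_field, mul_div_assoc, taylorCoeff]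

lemma analyticAt_gcdFactor (h k q : ℕ) (c : ℂ) : AnalyticAt ℂ (fun s => gcdFactor h k s q) c :=
  (differentiable_gcdFactor h k q).analyticAt c

/-- The Taylor coefficients at `s = 1` of `gcdFactor`, weighted by `d_j(q) / q`. -/
def gcdTaylor (h k j r : ℕ) (q : ℕ) : ℂ :=
  (d j q : ℂ) / q * taylorCoeff (fun s => gcdFactor h k s q) 1 r

/-- The error is holomorphic in s and O(u^{-δ}) uniformly near 1, so Cauchy's estimate on a circle
of radius 1/8 gives the same saving for its r-th Taylor coefficient. -/
lemma exists_logAsymp_gcdTaylor (h k j : ℕ) (hh : h ≠ 0) (r : ℕ) :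
    ∃ (Q : ℂ[X]) (δ : ℝ), 0 < δ ∧ LogAsymp (partialSum (gcdTaylor h k j r)) Q δ ∧
      ∀ n, Q.coeff n = ∑ i ∈ Finset.range (j + 1 - n),
        aCoeff (j - n - i) j / (((j - n - i)! : ℂ) * (n ! : ℂ) * (i ! : ℂ))
          * taylorCoeff (betaMoment h k j i) 1 r := by
  obtain ⟨P, δ, K, hδ, hdeg, hcoeff, hP⟩ := exists_partialSum_gcdFactor_sub_le h k j hh
  refine ⟨∑ i ∈ Finset.range (j + 1), Polynomial.C (taylorCoeff (betaMoment h k j i) 1 r) * hasseDeriv i P,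
    δ, hδ, ⟨K / (1 / 8) ^ r, fun u hu => ?_⟩, fun n => ?_⟩
  · set E : ℂ → ℂ := fun s => ∑ q ∈ Finset.Icc 1 ⌊u⌋₊, ((d j q : ℂ) / q) * gcdFactor h k s q
      - ∑ i ∈ Finset.range (j + 1), (hasseDeriv i P).eval (Real.log u : ℂ) * betaMoment h k j i s with hE
    have hE1 : ∀ s, E s = partialSum (divId ((dC j).pmul (gcdFactor h k s))) u
        - ∑ i ∈ Finset.range (j + 1), (hasseDeriv i P).eval (Real.log u : ℂ) * betaMoment h k j i s :=
      fun s => by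
        simp only [hE, partialSum]
        congr 1
        refine Finset.sum_congr rfl fun q _ => ?_
        rw [divId_apply, ArithmeticFunction.pmul_apply, dC_apply]
        ring
    have hf1 : ∀ q ∈ Finset.Icc 1 ⌊u⌋₊, Differentiable ℂ fun s => ((d j q : ℂ) / q) * gcdFactor h k s q :=
      fun q _ => (differentiable_gcdFactor h k q).const_mul _
    have hf2 : ∀ i ∈ Finset.range (j + 1), DifferentiableOn ℂ
        (fun s => (hasseDeriv i P).eval (Real.log u : ℂ) * betaMoment h k j i s) (Metric.ball 1 (1 / 4)) :=
      fun i _ => (differentiableOn_betaMoment h k j hh i).const_mul _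
    have ha1 := fun q hq => (hf1 q hq).analyticAt 1
    have ha2 := fun i hi => (hf2 i hi).analyticAt (Metric.ball_mem_nhds (1 : ℂ) (by norm_num))
    have hd : DifferentiableOn ℂ E (Metric.ball 1 (1 / 4)) :=
      (Differentiable.fun_sum hf1).differentiableOn.sub (DifferentiableOn.fun_sum hf2)
    have hc := Complex.norm_iteratedDeriv_le_of_forall_mem_sphere_norm_le (c := (1 : ℂ)) (R := 1 / 8)
      (C := K * u ^ (-δ)) (f := E) r (by norm_num)
      ((hd.mono (by
        rw [closure_ball _ (by norm_num)]
        exact Metric.closedBall_subset_ball (by norm_num))).diffContOnCl)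
      (fun z hz => by
        rw [hE1]
        exact hP z (Metric.closedBall_subset_closedBall (by norm_num)
          (Metric.sphere_subset_closedBall hz)) u hu)
    have h1 : partialSum (gcdTaylor h k j r) u - (∑ i ∈ Finset.range (j + 1),
        Polynomial.C (taylorCoeff (betaMoment h k j i) 1 r) * hasseDeriv i P).eval (Real.log u : ℂ)
        = taylorCoeff E 1 r := by
      rw [hE, taylorCoeff_sub r (Finset.analyticAt_fun_sum _ ha1) (Finset.analyticAt_fun_sum _ ha2),
        taylorCoeff_sum _ _ ha1, taylorCoeff_sum _ _ ha2, eval_finsetSum]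
      congr 1
      · exact Finset.sum_congr rfl fun q _ => (taylorCoeff_const_mul _ _ _ _).symm
      · refine Finset.sum_congr rfl fun i _ => ?_
        rw [taylorCoeff_const_mul, eval_mul, eval_C, mul_comm]
    rw [h1, taylorCoeff, norm_div, Complex.norm_natCast, div_le_iff₀ (by exact_mod_cast r.factorial_pos)]
    refine hc.trans (le_of_eq (by ring))
  · rw [finsetSum_coeff]
    have h2 : ∀ i ∈ Finset.range (j + 1), i ∉ Finset.range (j + 1 - n) →
        (Polynomial.C (taylorCoeff (betaMoment h k j i) 1 r) * hasseDeriv i P).coeff n = 0 :=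
      fun i _ hi => by
        rw [coeff_C_mul, hasseDeriv_coeff, coeff_eq_zero_of_natDegree_lt, mul_zero, mul_zero]
        have := Finset.mem_range.not.mp hi
        omega
    rw [← Finset.sum_subset (Finset.range_mono (by omega)) h2]
    refine Finset.sum_congr rfl fun i hi => ?_
    have hi' : i < j + 1 - n := Finset.mem_range.mp hi
    have h3 := hcoeff (n + i)
    rw [if_pos (by omega), ← Nat.sub_sub] at h3
    have h4 : (((n + i).choose i : ℕ) : ℂ) * (i ! : ℂ) * (n ! : ℂ) = ((n + i)! : ℂ) := by
      have := Nat.choose_mul_factorial_mul_factorial (Nat.le_add_left i n)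
      rw [Nat.add_sub_cancel] at this
      exact_mod_cast this
    rw [coeff_C_mul, hasseDeriv_coeff]
    have e1 : (i ! : ℂ) ≠ 0 := by exact_mod_cast i.factorial_ne_zero
    have e2 : (n ! : ℂ) ≠ 0 := by exact_mod_cast n.factorial_ne_zero
    have h5 : (((n + i).choose i : ℕ) : ℂ) * P.coeff (n + i)
        = aCoeff (j - n - i) j / (((j - n - i)! : ℂ) * (n ! : ℂ) * (i ! : ℂ)) := by
      rw [← h4] at h3
      rw [mul_assoc, ← div_div, ← h3, eq_div_iff (mul_ne_zero e2 e1)]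
      ring
    rw [h5, mul_comm]

/-! ### The mixed derivatives -/

/-- With x = 1 - 1/p and k ≥ 1, both x^{1-k} and x^{-j} are at least 1. -/
lemma eulerF_denom_pos (k j : ℕ) (hk : 1 ≤ k) {p : ℕ} (hp : p.Prime) :
    0 < (1 - (p : ℝ)⁻¹) * ((1 - (p : ℝ)⁻¹) ^ k)⁻¹ + ((1 - (p : ℝ)⁻¹) ^ j)⁻¹ - 1 := by
  have hp1 : (p : ℝ)⁻¹ < 1 := inv_lt_one_of_one_lt₀ (by exact_mod_cast hp.one_lt)
  have hp0 : 0 < (p : ℝ)⁻¹ := by have := hp.pos; positivity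
  set x := 1 - (p : ℝ)⁻¹ with hx
  have hx0 : 0 < x := by linarith
  have hx1 : x ≤ 1 := by linarith
  obtain ⟨m, rfl⟩ := Nat.exists_eq_add_of_le' hk
  have h1 : x * (x ^ (m + 1))⁻¹ = (x ^ m)⁻¹ := by rw [pow_succ]; field_simp
  have h2 : ∀ n : ℕ, 1 ≤ (x ^ n)⁻¹ := fun n => (one_le_inv₀ (by positivity)).mpr (pow_le_one₀ hx0.le hx1)
  rw [h1]
  linarith [h2 m, h2 j]

/-- The identity holds on a neighbourhood of (1, 0), where the denominators at p ∣ h stay nonzero.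
Iterated neighbourhoods are what is needed to differentiate first in w and then in s. -/
lemma eventually_LSeries_betaFn_eq (h k j : ℕ) (hh : h ≠ 0) (hk : 1 ≤ k) :
    ∀ᶠ s : ℂ in 𝓝 1, ∀ᶠ w : ℂ in 𝓝 0,
      LSeries (betaFn h k j s) (1 + w) = eulerC k (j + 1) s w * eulerF h k (j + 1) s w := by
  refine Filter.Eventually.curry_nhds (p := fun x : ℂ × ℂ => LSeries (betaFn h k j x.1) (1 + x.2)
    = eulerC k (j + 1) x.1 x.2 * eulerF h k (j + 1) x.1 x.2) ?_
  have hne : ∀ᶠ x : ℂ × ℂ in 𝓝 (1, 0), ∀ p ∈ h.primeFactors,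
      (1 - (p : ℂ)⁻¹) * ((1 - (p : ℂ) ^ (-x.1)) ^ k)⁻¹ + ((1 - (p : ℂ) ^ (-x.2 - 1)) ^ j)⁻¹ - 1 ≠ 0 := by
    refine (Filter.eventually_all_finset _).mpr fun p hp => ?_
    have hpp := Nat.prime_of_mem_primeFactors hp
    have hp0 : (p : ℂ) ≠ 0 := by exact_mod_cast hpp.ne_zero
    have hP := one_sub_inv_prime_ne_zero hpp
    have e1 : (p : ℂ) ^ (-(1 : ℂ)) = (p : ℂ)⁻¹ := Complex.cpow_neg_one _
    have e2 : (p : ℂ) ^ (-(0 : ℂ) - 1) = (p : ℂ)⁻¹ := by rw [neg_zero, zero_sub, e1]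
    have c1 : ContinuousAt (fun x : ℂ × ℂ => (p : ℂ) ^ (-x.1)) (1, 0) :=
      continuousAt_fst.neg.const_cpow (Or.inl hp0)
    have c2 : ContinuousAt (fun x : ℂ × ℂ => (p : ℂ) ^ (-x.2 - 1)) (1, 0) :=
      (continuousAt_snd.neg.sub continuousAt_const).const_cpow (Or.inl hp0)
    refine ContinuousAt.eventually_ne (((continuousAt_const.mul
      (((continuousAt_const.sub c1).pow k).inv₀ ?_)).add
      (((continuousAt_const.sub c2).pow j).inv₀ ?_)).sub continuousAt_const) ?_
    · change (1 - (p : ℂ) ^ (-(1 : ℂ))) ^ k ≠ 0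
      rw [e1]; exact pow_ne_zero k hP
    · change (1 - (p : ℂ) ^ (-(0 : ℂ) - 1)) ^ j ≠ 0
      rw [e2]; exact pow_ne_zero j hP
    · simp only [e1, e2]
      have := Complex.ofReal_ne_zero.mpr (eulerF_denom_pos k j hk hpp).ne'
      push_cast at this
      exact this
  have hs : ∀ᶠ x : ℂ × ℂ in 𝓝 (1, 0), x.1 ∈ Metric.closedBall (1 : ℂ) (1 / 4) :=
    continuousAt_fst.eventually (Metric.closedBall_mem_nhds _ (by norm_num))
  have hw : ∀ᶠ x : ℂ × ℂ in 𝓝 (1, 0), -(1 / 4) ≤ x.2.re := by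
    have c : ContinuousAt (fun x : ℂ × ℂ => x.2.re) (1, 0) :=
      Complex.continuous_re.continuousAt.comp continuousAt_snd
    exact c.eventually (Ici_mem_nhds (by norm_num))
  filter_upwards [hne, hs, hw] with x h1 h2 h3 using lseries_betaFn_eq h k j hh h2 h3 h1

lemma mixedDeriv_eq (h k j : ℕ) (hh : h ≠ 0) (hk : 1 ≤ k) (r i : ℕ) :
    mixedDeriv h k (j + 1) r i = iteratedDeriv r (betaMoment h k j i) 1 := by
  rw [mixedDeriv]
  refine Filter.EventuallyEq.iteratedDeriv_eq r ?_
  filter_upwards [eventually_LSeries_betaFn_eq h k j hh hk,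
    Metric.closedBall_mem_nhds (1 : ℂ) (ε := 1 / 4) (by norm_num)] with s hs hs'
  rw [← betaMoment_eq_iteratedDeriv hh i hs']
  have h1 := Filter.EventuallyEq.iteratedDeriv_eq i hs
  rw [← h1, iteratedDeriv_comp_const_add]
  simp only [add_zero]

lemma taylorCoeff_mul {f g : ℂ → ℂ} {c : ℂ} (n : ℕ) (hf : AnalyticAt ℂ f c) (hg : AnalyticAt ℂ g c) :
    taylorCoeff (fun s => f s * g s) c n
      = ∑ i ∈ Finset.range (n + 1), taylorCoeff f c i * taylorCoeff g c (n - i) := by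
  rw [taylorCoeff, iteratedDeriv_fun_mul hf.contDiffAt hg.contDiffAt, Finset.sum_div]
  refine Finset.sum_congr rfl fun i hi => ?_
  have hi' : i ≤ n := by simpa [Nat.lt_succ_iff] using hi
  have h1 : ((n.choose i : ℕ) : ℂ) * (i ! : ℂ) * ((n - i)! : ℂ) = (n ! : ℂ) := by
    exact_mod_cast Nat.choose_mul_factorial_mul_factorial hi'
  have e1 : (i ! : ℂ) ≠ 0 := by exact_mod_cast i.factorial_ne_zero
  have e2 : ((n - i)! : ℂ) ≠ 0 := by exact_mod_cast (n - i).factorial_ne_zero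
  have e3 : (n ! : ℂ) ≠ 0 := by exact_mod_cast n.factorial_ne_zero
  rw [taylorCoeff, taylorCoeff, div_mul_div_comm, div_eq_div_iff e3 (mul_ne_zero e1 e2), ← h1]
  ring

lemma taylorCoeff_cpow {x : ℝ} (hx : 0 < x) (n : ℕ) :
    taylorCoeff (fun s => (x : ℂ) ^ s) 1 n = x * (Real.log x : ℂ) ^ n / (n ! : ℂ) := by
  have h1 : (fun s : ℂ => (x : ℂ) ^ s) = fun s => Complex.exp ((Real.log x : ℂ) * s) := by
    ext s
    rw [Complex.cpow_def_of_ne_zero (by exact_mod_cast hx.ne'), Complex.ofReal_log hx.le]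
  rw [taylorCoeff, h1, iteratedDeriv_cexp_const_mul]
  simp only [mul_one]
  rw [← Complex.ofReal_exp, Real.exp_log hx,
    mul_comm]

lemma taylorCoeff_inv (n : ℕ) : taylorCoeff (fun s => s⁻¹) 1 n = (-1) ^ n := by
  have h1 : (fun s : ℂ => s⁻¹) = Inv.inv := rfl
  rw [taylorCoeff, h1, iteratedDeriv_eq_iterate, iter_deriv_inv, one_zpow, mul_one, mul_div_assoc,
    div_self (by exact_mod_cast n.factorial_ne_zero), mul_one]

lemma taylorCoeff_id (n : ℕ) : taylorCoeff (fun s => s) 1 n = if n ≤ 1 then 1 else 0 := by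
  rcases n with _ | _ | n
  · simp [taylorCoeff]
  · simp [taylorCoeff, iteratedDeriv_one]
  · rw [if_neg (by omega), taylorCoeff, iteratedDeriv_succ']
    simp [iteratedDeriv_const]

lemma analyticAt_zetaReg_pow_div (k : ℕ) : AnalyticAt ℂ (fun s => zetaReg s ^ k * s⁻¹) 1 :=
  (analyticAt_zetaReg.fun_pow k).mul (analyticAt_inv one_ne_zero)

lemma cCoeff_eq (n k : ℕ) : taylorCoeff (fun s => zetaReg s ^ k * s⁻¹) 1 n = cCoeff n k := by
  rw [taylorCoeff_mul n (analyticAt_zetaReg.fun_pow k) (analyticAt_inv one_ne_zero), cCoeff]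
  refine Finset.sum_congr rfl fun r _ => ?_
  rw [taylorCoeff_inv, taylorCoeff, aCoeff]
  ring

/-! ### The main term in a residue class. -/

/-- The polynomial in the main term for the sum of `d_k` over `n ≡ h (mod q)`. -/
def residuePoly (h k q : ℕ) : ℂ[X] :=
  ∑ m ∈ Finset.range k, Polynomial.C (taylorCoeff
    (fun s => (gcdFactor h k s q / q) * (zetaReg s ^ k * s⁻¹)) 1 (k - 1 - m) / (m ! : ℂ)) * Polynomial.X ^ m

lemma analyticAt_gcdFactor_div (h k q : ℕ) (c : ℂ) : AnalyticAt ℂ (fun s => gcdFactor h k s q / q) c :=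
  (analyticAt_gcdFactor h k q c).div_const

lemma analyticAt_residueFactor (h k q : ℕ) :
    AnalyticAt ℂ (fun s => (gcdFactor h k s q / q) * (zetaReg s ^ k * s⁻¹)) 1 :=
  (analyticAt_gcdFactor_div h k q 1).mul (analyticAt_zetaReg_pow_div k)

/-- The m-th Taylor coefficient of x^s at 1 is x (log x)^m / m!, so this is Leibniz's rule for a
product with x^s. -/
lemma mul_eval_residuePoly (h k q : ℕ) (hk : 1 ≤ k) {x : ℝ} (hx : 0 < x) :
    (x : ℂ) * (residuePoly h k q).eval (Real.log x : ℂ) = taylorCoeff (fun s => (x : ℂ) ^ s *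
      ((gcdFactor h k s q / q) * (zetaReg s ^ k * s⁻¹))) 1 (k - 1) := by
  have hc : AnalyticAt ℂ (fun s : ℂ => (x : ℂ) ^ s) 1 :=
    analyticAt_const.cpow analyticAt_id (by
      exact Complex.ofReal_mem_slitPlane.mpr hx)
  rw [taylorCoeff_mul _ hc (analyticAt_residueFactor h k q), residuePoly, eval_finsetSum,
    Finset.mul_sum, Nat.sub_add_cancel hk]
  refine Finset.sum_congr rfl fun m _ => ?_
  rw [taylorCoeff_cpow hx]
  simp only [eval_mul, eval_C, eval_pow, eval_X]
  ring

/-- The summatory function of `d_k` over a residue class. -/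
def residueSum (h k q : ℕ) (y : ℝ) : ℂ :=
  ((∑ n ∈ Finset.Icc 1 ⌊y⌋₊ with n ≡ h [MOD q], d k n : ℕ) : ℂ)

lemma exists_residueSum_of_not_dvd {h k g : ℕ} (hh : h ≠ 0) (hk : 1 ≤ k) {θ A : ℝ}
    (hθ : IsExponentOfDistribution g k θ) (hA : A < θ) :
    ∃ δ : ℝ, 0 < δ ∧ ∃ K : ℝ, ∀ y : ℝ, 1 ≤ y → ∀ q : ℕ, 1 ≤ q → (q : ℝ) ≤ y ^ A → h.gcd q = g →
      ¬ q ∣ h → ‖residueSum h k q y - y * (residuePoly h k q).eval (Real.log y : ℂ)‖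
        ≤ K * (y ^ (1 - δ) / (Nat.totient (q / h.gcd q) : ℝ)) := by
  -- With ε = θ - A the admissible range becomes q ≤ y^A.
  obtain ⟨δ, hδ, K, hK⟩ := hθ.2.2 (θ - A) (by linarith)
  refine ⟨δ, hδ, K, fun y hy q hq hqy hg hqh => ?_⟩
  rw [sub_sub_cancel] at hK
  have hq0 : q ≠ 0 := by omega
  have hφ : ((Nat.totient (q / g) : ℕ) : ℂ) ≠ 0 := by
    have : 0 < q / g := Nat.div_pos (Nat.le_of_dvd hq (hg ▸ Nat.gcd_dvd_right h q))
      (hg ▸ Nat.gcd_pos_of_pos_right h hq)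
    exact_mod_cast (Nat.totient_pos.mpr this).ne'
  set V : ℂ → ℂ := fun s => (Nat.totient (q / g) : ℂ) * (gcdFactor h k s q / q) with hV
  have hVan : AnalyticAt ℂ V 1 := analyticAt_const.mul (analyticAt_gcdFactor_div h k q 1)
  set F : ℂ → ℂ := fun s => zetaReg s ^ k * V s / (s - 1) ^ k with hF
  have hmer : MeromorphicAt F 1 :=
    ((analyticAt_zetaReg.fun_pow k).mul hVan).meromorphicAt.div
      ((analyticAt_id.sub analyticAt_const).pow k).meromorphicAt
  have hcont : IsContinuation k g q F := by
    refine ⟨hmer, fun s hs => ?_⟩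
    have hs1 : s ≠ 1 := by rintro rfl; simp at hs
    have hs1' : s - 1 ≠ 0 := sub_ne_zero.mpr hs1
    have h1 := LSeries_gcd_eq h k hh hk hq0 hs
    rw [hg] at h1
    rw [h1, hF]
    simp only [hV]
    rw [zetaReg_of_ne hs1, mul_pow, mul_assoc, mul_div_cancel_left₀ _ (pow_ne_zero k hs1')]
  have hy0 : 0 < y := by linarith
  have hc : AnalyticAt ℂ (fun s : ℂ => (y : ℂ) ^ s) 1 :=
    analyticAt_const.cpow analyticAt_id (Complex.ofReal_mem_slitPlane.mpr hy0)
  set G : ℂ → ℂ := fun s => (y : ℂ) ^ s * ((gcdFactor h k s q / q) * (zetaReg s ^ k * s⁻¹)) with hG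
  have hGan : AnalyticAt ℂ G 1 := hc.mul (analyticAt_residueFactor h k q)
  have hres : HasResidueAt (fun s => (y : ℂ) ^ s / s * F s) 1
      ((Nat.totient (q / g) : ℂ) * taylorCoeff G 1 (k - 1)) := by
    -- The pole has order at most k, so the residue is the Taylor coefficient of index k - 1. Its
    -- factor φ(q/g) will cancel the one in the hypothesis.
    refine ⟨k - 1, fun s => (Nat.totient (q / g) : ℂ) * G s, analyticAt_const.mul hGan,
      Eventually.of_forall fun s => ?_, ?_⟩
    · rw [Nat.sub_add_cancel hk, hG, hF]
      simp only [hV, div_eq_mul_inv]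
      ring
    · rw [← taylorCoeff_const_mul, taylorCoeff]
  have h2 := hK y hy q hq hqy h hg hqh F _ hcont hres
  rw [mul_div_cancel_left₀ _ hφ, hG, ← mul_eval_residuePoly h k q hk hy0] at h2
  rw [hg]
  exact h2

/-- Here the class is 0 modulo q, which the distribution hypothesis excludes. `powLog_dRes` gives
the sum with weights 1/n, partial summation removes the weights, and the Dirichlet series identifies
the polynomial with `residuePoly`. -/
lemma exists_residueSum_of_dvd {h k q : ℕ} (hh : h ≠ 0) (hk : 1 ≤ k) (hq : q ∣ h) :
    ∃ δ : ℝ, 0 < δ ∧ ∃ K : ℝ, ∀ y : ℝ, 1 ≤ y →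
      ‖residueSum h k q y - y * (residuePoly h k q).eval (Real.log y : ℂ)‖ ≤ K * y ^ (1 - δ) := by
  have hq0 : q ≠ 0 := ne_zero_of_dvd_ne_zero hh hq
  have hqc : (q : ℂ) ≠ 0 := by exact_mod_cast hq0
  obtain ⟨Q, δ, hδ, hQ⟩ := powLog_dRes (Nat.pos_of_ne_zero hq0) 0 k
  have hgcd : h.gcd q = q := Nat.gcd_eq_right hq
  have hterm : ∀ w : ℂ, ∀ n, LSeries.term (dRes q 0 k) w n
      = LSeries.term (fun n => if n.gcd q = h.gcd q then (d k n : ℂ) else 0) (1 + w) n := fun w n => by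
    rcases eq_or_ne n 0 with rfl | hn
    · simp
    · rw [LSeries.term_of_ne_zero hn, LSeries.term_of_ne_zero hn, dRes_apply,
        Complex.cpow_add _ _ (by exact_mod_cast hn), Complex.cpow_one, ← div_div, hgcd]
      simp only [Nat.gcd_eq_right_iff_dvd, Nat.modEq_zero_iff_dvd]
      split_ifs <;> simp
  have hre : ∀ w : ℝ, 0 < w → 1 < (1 + (w : ℂ)).re := fun w hw => by simpa using hw
  have hsum : ∀ w : ℝ, 0 < w → LSeriesSummable (dRes q 0 k) w := fun w hw => by
    refine Summable.of_norm_bounded ((lseriesSummable_divId (dC k) w).mpr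
      (dC_lseriesSummable k (hre w hw))).norm fun n => ?_
    refine LSeries.norm_term_le _ ?_
    refine (norm_dRes_le q 0 k n).trans (le_of_eq ?_)
    rw [divId_apply, dC_apply, norm_div, Complex.norm_natCast, Complex.norm_natCast]
  set H : ℂ → ℂ := fun s => (gcdFactor h k s q / q) with hH
  have hcoeff := hQ.coeff_eq hδ hsum (Y := fun w => (fun s => H s * zetaReg s ^ k) (1 + w)) (j := k)
    (by
      have h2 : AnalyticAt ℂ (fun s => H s * zetaReg s ^ k) (1 + 0) := by
        rw [add_zero]; exact (analyticAt_gcdFactor_div h k q 1).mul (analyticAt_zetaReg.fun_pow k)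
      exact h2.fun_comp_of_eq (analyticAt_const.add analyticAt_id) rfl)
    (fun w hw => by
      have hw' : (1 : ℂ) + w ≠ 1 := by simpa using hw.ne'
      have h3 : LSeries (dRes q 0 k) w = riemannZeta (1 + w) ^ k * H (1 + w) := by
        rw [LSeries, tsum_congr (hterm w)]
        refine (LSeries_gcd_eq h k hh hk hq0 (hre w hw)).trans ?_
        rw [hgcd, Nat.div_self (Nat.pos_of_ne_zero hq0), Nat.totient_one, Nat.cast_one, one_mul]
      simp only [h3]
      rw [zetaReg_of_ne hw', mul_pow, add_sub_cancel_left]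
      ring)
  simp only [taylorCoeff_comp_const_add (fun s => H s * zetaReg s ^ k)] at hcoeff
  set N := residuePoly h k q with hN
  set g : ℕ → ℂ := fun n => taylorCoeff (fun s => H s * (zetaReg s ^ k * s⁻¹)) 1 n with hg
  have hNc : ∀ m, N.coeff m * (m ! : ℂ) = if m < k then g (k - 1 - m) else 0 := fun m => by
    rw [hN, residuePoly, finsetSum_coeff]
    simp only [coeff_C_mul, coeff_X_pow, mul_ite, mul_one, mul_zero]
    rw [Finset.sum_ite_eq]
    simp only [Finset.mem_range]
    split_ifs
    · rw [div_mul_cancel₀ _ (by exact_mod_cast m.factorial_ne_zero)]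
    · rw [zero_mul]
  -- `residuePoly` involves ζ^k/s and Q involves ζ^k; writing s = 1 + (s - 1) adds adjacent Taylor
  -- coefficients.
  have hgr : ∀ n, taylorCoeff (fun s => H s * zetaReg s ^ k) 1 n = g n + if 1 ≤ n then g (n - 1) else 0 := by
    intro n
    have h1 : (fun s => H s * zetaReg s ^ k) =ᶠ[𝓝 1] fun s => s * (H s * (zetaReg s ^ k * s⁻¹)) := by
      filter_upwards [isOpen_ne.mem_nhds (one_ne_zero : (1 : ℂ) ≠ 0)] with s hs
      have : s ≠ 0 := hs
      field_simp
    rw [taylorCoeff, h1.iteratedDeriv_eq, ← taylorCoeff,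
      taylorCoeff_mul (f := fun s => s) n analyticAt_id (analyticAt_residueFactor h k q)]
    simp only [taylorCoeff_id, ite_mul, one_mul, zero_mul]
    rcases n with _ | n
    · simp [hg, hH]
    · rw [Finset.sum_range_succ', Finset.sum_range_succ', Finset.sum_eq_zero]
      · simp [hg, hH, add_comm]
      · intro i _; rw [if_neg (by omega)]
  -- Both sides are the density of the main term: y N(log y) has derivative (N + N')(log y), and
  -- removing the weight 1/n from Q(log y) gives Q'(log y).
  have hNQ : N + derivative N = derivative Q := by
    ext m
    have e1 : ((m + 1 : ℕ) : ℂ) ≠ 0 := by exact_mod_cast m.succ_ne_zero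
    have e2 : (m ! : ℂ) ≠ 0 := by exact_mod_cast m.factorial_ne_zero
    have h1 := hcoeff (m + 1)
    have h2 := hNc m
    have h3 := hNc (m + 1)
    have h4 : (((m + 1)! : ℕ) : ℂ) = (m + 1) * (m ! : ℂ) := by push_cast [Nat.factorial_succ]; ring
    rw [h4] at h1 h3
    rw [coeff_add, coeff_derivative, coeff_derivative]
    refine mul_right_cancel₀ e2 ?_
    have h5 : (if m + 1 ≤ k then taylorCoeff (fun s => H s * zetaReg s ^ k) 1 (k - (m + 1)) else 0)
        = (if m < k then g (k - 1 - m) else 0) + if m + 1 < k then g (k - 1 - (m + 1)) else 0 := by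
      by_cases hm : m + 1 ≤ k
      · rw [if_pos hm, if_pos (show m < k from hm), hgr, show k - (m + 1) = k - 1 - m by omega]
        congr 1
        by_cases hm2 : m + 1 < k
        · rw [if_pos hm2, if_pos (by omega)]
          congr 1
        · rw [if_neg hm2, if_neg (by omega)]
      · rw [if_neg hm, if_neg (by omega), if_neg (by omega), add_zero]
    linear_combination h2 + h3 - h1 - h5
  -- One index, κ = 1 and p = 1, so the weight is y - n. By `hNQ`, Q - N solves the required
  -- equation, its sum with its derivative being Q.
  obtain ⟨δ', hδ', K, hK⟩ := exists_sum_mul_powEval_sub_le (Finset.univ : Finset Unit)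
    (a := fun _ => dRes q 0 k) (p := fun _ => 1) (Q := fun _ => Q) (P := Q - N) (κ := 1) hδ one_pos
    (fun _ _ => hQ) (by
      simp only [Finset.univ_unique, Finset.sum_singleton, derivative_one, add_zero, one_mul,
        Complex.ofReal_one, inv_one, Polynomial.C_1, comp_X, derivative_sub]
      linear_combination (-1 : ℂ[X]) * hNQ)
  obtain ⟨L, hL⟩ := hQ
  refine ⟨min δ δ', lt_min hδ hδ', |L| + |K|, fun y hy => ?_⟩
  have hy0 : 0 < y := by linarith
  have h1 := hK y hy
  have h2 := hL y hy
  simp only [Finset.univ_unique, Finset.sum_singleton, powEval, Real.rpow_one, eval_one, mul_one,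
    Complex.ofReal_one, one_mul] at h1
  have h3 : residueSum h k q y = ∑ n ∈ Finset.Icc 1 ⌊y⌋₊, dRes q 0 k n * n := by
    rw [residueSum, Nat.cast_sum, Finset.sum_filter]
    refine Finset.sum_congr rfl fun n hn => ?_
    have hn0 : (n : ℂ) ≠ 0 := by
      have := (Finset.mem_Icc.mp hn).1
      exact_mod_cast (by omega : n ≠ 0)
    have h4 : n ≡ h [MOD q] ↔ n ≡ 0 [MOD q] := by
      have : h ≡ 0 [MOD q] := (Nat.modEq_zero_iff_dvd).mpr hq
      exact ⟨fun hx => hx.trans this, fun hx => hx.trans this.symm⟩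
    rw [dRes_apply]
    simp only [h4]
    split_ifs
    · rw [div_mul_cancel₀ _ hn0]
    · rw [zero_mul]
  have h5 : residueSum h k q y - y * N.eval (Real.log y : ℂ)
      = y * (partialSum (dRes q 0 k) y - Q.eval (Real.log y : ℂ))
        - (∑ n ∈ Finset.Icc 1 ⌊y⌋₊, dRes q 0 k n * ((y : ℂ) - n) - y * (Q - N).eval (Real.log y : ℂ)) := by
    simp only [h3, partialSum, mul_sub, Finset.sum_sub_distrib, eval_sub, ← Finset.sum_mul]
    ring
  rw [h5, add_mul]
  refine (norm_sub_le _ _).trans (add_le_add ?_ ?_)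
  · rw [norm_mul, Complex.norm_real, Real.norm_of_nonneg hy0.le]
    calc y * _ ≤ y * (|L| * y ^ (-δ)) := by
          gcongr
          exact h2.trans (by gcongr; exact le_abs_self L)
      _ = |L| * y ^ (1 - δ) := by rw [Real.rpow_sub hy0, Real.rpow_one, Real.rpow_neg hy0.le]; ring
      _ ≤ _ := by gcongr; exact min_le_left _ _
  · calc _ ≤ K * y ^ (1 - δ') := by simpa using h1
      _ ≤ |K| * y ^ (1 - min δ δ') := by
          gcongr
          · exact le_abs_self K
          · exact min_le_right _ _

/-- The hypothesis gives δ and K for each g separately; only the divisors of h occur as g, so common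
values exist. -/
lemma exists_uniform_of_finset {ι : Type*} (s : Finset ι) {p : ι → ℝ → ℝ → Prop}
    (hmono : ∀ i δ δ' K K', δ' ≤ δ → K ≤ K' → 0 ≤ K' → p i δ K → p i δ' K')
    (h : ∀ i ∈ s, ∃ δ : ℝ, 0 < δ ∧ ∃ K, p i δ K) :
    ∃ δ : ℝ, 0 < δ ∧ ∃ K, 0 ≤ K ∧ ∀ i ∈ s, p i δ K := by
  classical
  induction s using Finset.induction_on with
  | empty => exact ⟨1, one_pos, 0, le_rfl, by simp⟩
  | insert i s hi ih =>
    obtain ⟨δ, hδ, K, hK0, hK⟩ := ih fun j hj => h j (by simp [hj])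
    obtain ⟨δ', hδ', K', hK'⟩ := h i (by simp)
    refine ⟨min δ δ', lt_min hδ hδ', max K K', le_max_of_le_left hK0, fun j hj => ?_⟩
    rcases Finset.mem_insert.mp hj with rfl | hj
    · exact hmono _ _ _ _ _ (min_le_right _ _) (le_max_right _ _) (le_max_of_le_left hK0) hK'
    · exact hmono _ _ _ _ _ (min_le_left _ _) (le_max_left _ _) (le_max_of_le_left hK0) (hK j hj)

lemma exists_residueSum_sub_le {h k : ℕ} (hh : h ≠ 0) (hk : 1 ≤ k) {θ A : ℝ}
    (hθ : ∀ g : ℕ, 1 ≤ g → IsExponentOfDistribution g k θ) (hA : A < θ) :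
    ∃ δ : ℝ, 0 < δ ∧ ∃ K : ℝ, 0 ≤ K ∧ ∀ y : ℝ, 1 ≤ y → ∀ q : ℕ, 1 ≤ q → (q : ℝ) ≤ y ^ A →
      ‖residueSum h k q y - y * (residuePoly h k q).eval (Real.log y : ℂ)‖
        ≤ K * (y ^ (1 - δ) / (Nat.totient (q / h.gcd q) : ℝ)) := by
  obtain ⟨δ, hδ, K, hK0, hK⟩ := exists_uniform_of_finset h.divisors
    (p := fun g δ K => ∀ y : ℝ, 1 ≤ y → ∀ q : ℕ, 1 ≤ q → (q : ℝ) ≤ y ^ A → h.gcd q = g →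
      ‖residueSum h k q y - y * (residuePoly h k q).eval (Real.log y : ℂ)‖
        ≤ K * (y ^ (1 - δ) / (Nat.totient (q / h.gcd q) : ℝ)))
    (fun g δ δ' K K' hδδ hKK hK0 hp y hy q hq hqy hg => (hp y hy q hq hqy hg).trans (by gcongr))
    fun g hg => by
      obtain ⟨δ, hδ, K, hK⟩ := exists_residueSum_of_not_dvd hh hk
        (hθ g (Nat.pos_of_mem_divisors hg)) hA
      obtain ⟨δ', hδ', K', hK'⟩ := exists_residueSum_of_dvd hh hk (Nat.dvd_of_mem_divisors hg)
      refine ⟨min δ δ', lt_min hδ hδ', |K| + |K'|, fun y hy q hq hqy hgq => ?_⟩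
      by_cases hqh : q ∣ h
      · have hqg : q = g := by rw [← hgq, Nat.gcd_eq_right hqh]
        subst hqg
        rw [hgq, Nat.div_self hq, Nat.totient_one, Nat.cast_one, div_one]
        refine (hK' y hy).trans ?_
        gcongr
        · exact (le_abs_self _).trans (le_add_of_nonneg_left (abs_nonneg _))
        · exact min_le_right _ _
      · refine (hK y hy q hq hqy hgq hqh).trans ?_
        gcongr
        · exact (le_abs_self _).trans (le_add_of_nonneg_right (abs_nonneg _))
        · exact min_le_left _ _
  exact ⟨δ, hδ, K, hK0, fun y hy q hq hqy =>
    hK _ (Nat.mem_divisors.mpr ⟨Nat.gcd_dvd_left h q, hh⟩) y hy q hq hqy rfl⟩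

/-- m is the sum of φ(i) over i ∣ m, and each φ(i) ≤ φ(m). -/
lemma inv_totient_le {m : ℕ} (hm : m ≠ 0) : ((Nat.totient m : ℝ))⁻¹ ≤ (d 2 m : ℝ) / m := by
  have h1 : m ≤ d 2 m * Nat.totient m := by
    have h2 : d 2 m = m.divisors.card := by
      rw [d_succ, Finset.sum_congr rfl fun i hi => (show d 1 i = 1 by
        rw [d, pow_one, ArithmeticFunction.zeta_apply_ne (Nat.pos_of_mem_divisors hi).ne'])]
      simp
    calc m = ∑ i ∈ m.divisors, Nat.totient i := (Nat.sum_totient m).symm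
      _ ≤ ∑ i ∈ m.divisors, Nat.totient m := Finset.sum_le_sum fun i hi =>
          Nat.le_of_dvd (Nat.totient_pos.mpr (Nat.pos_of_ne_zero hm))
            (Nat.totient_dvd_of_dvd (Nat.dvd_of_mem_divisors hi))
      _ = d 2 m * Nat.totient m := by rw [Finset.sum_const, h2, smul_eq_mul]
  have hφ : (0 : ℝ) < Nat.totient m := by exact_mod_cast Nat.totient_pos.mpr (Nat.pos_of_ne_zero hm)
  have hm0 : (0 : ℝ) < m := by exact_mod_cast Nat.pos_of_ne_zero hm
  rw [inv_eq_one_div, div_le_div_iff₀ hφ hm0, one_mul]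
  exact_mod_cast h1

/-- Since (h, q) ≤ h, the summand is q^{-1} up to constants and divisor functions, and the latter
cost only q^{ε/2} in total. -/
lemma exists_sum_d_div_totient_le (h j : ℕ) (hh : h ≠ 0) {ε : ℝ} (hε : 0 < ε) :
    ∃ K : ℝ, 0 ≤ K ∧ ∀ u : ℝ, 1 ≤ u →
      ∑ q ∈ Finset.Icc 1 ⌊u⌋₊, (d j q : ℝ) / (Nat.totient (q / h.gcd q) : ℝ) ≤ K * u ^ ε := by
  have hε4 : 0 < ε / 4 := by positivity
  obtain ⟨K1, hK10, hK1⟩ := exists_d_le j hε4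
  obtain ⟨K2, hK20, hK2⟩ := exists_d_le 2 hε4
  obtain ⟨L, hL0, hL⟩ := exists_sum_rpow_le (half_pos hε)
  refine ⟨K1 * K2 * h * L, by positivity, fun u hu => ?_⟩
  calc _ ≤ ∑ q ∈ Finset.Icc 1 ⌊u⌋₊, K1 * K2 * h * (q : ℝ) ^ (ε / 2 - 1) := by
        refine Finset.sum_le_sum fun q hq => ?_
        have hq1 : 1 ≤ q := (Finset.mem_Icc.mp hq).1
        have hq0 : (0 : ℝ) < q := by exact_mod_cast hq1
        have hg : h.gcd q ∣ q := Nat.gcd_dvd_right h q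
        have hg0 : 0 < h.gcd q := Nat.gcd_pos_of_pos_right h hq1
        have hm0 : q / h.gcd q ≠ 0 := (Nat.div_pos (Nat.le_of_dvd hq1 hg) hg0).ne'
        have hgh : h.gcd q ≤ h := Nat.gcd_le_left q (Nat.pos_of_ne_zero hh)
        have e1 := inv_totient_le hm0
        have e2 : (d 2 (q / h.gcd q) : ℝ) ≤ K2 * (q : ℝ) ^ (ε / 4) := by
          refine (hK2 _).trans ?_
          gcongr
          exact Nat.div_le_self _ _
        have e3 : (q : ℝ) = (q / h.gcd q : ℕ) * (h.gcd q : ℝ) := by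
          exact_mod_cast (Nat.div_mul_cancel hg).symm
        have hm0' : (0 : ℝ) < ((q / h.gcd q : ℕ) : ℝ) := by exact_mod_cast Nat.pos_of_ne_zero hm0
        have e4 : (((q / h.gcd q : ℕ) : ℝ))⁻¹ ≤ h * (q : ℝ)⁻¹ := by
          rw [inv_eq_one_div, ← div_eq_mul_inv, div_le_div_iff₀ hm0' hq0, one_mul]
          calc (q : ℝ) = (h.gcd q : ℝ) * (q / h.gcd q : ℕ) := by rw [mul_comm]; exact e3
            _ ≤ h * (q / h.gcd q : ℕ) := by gcongr
        calc (d j q : ℝ) / (Nat.totient (q / h.gcd q) : ℝ)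
            = (d j q : ℝ) * ((Nat.totient (q / h.gcd q) : ℝ))⁻¹ := div_eq_mul_inv _ _
          _ ≤ (K1 * (q : ℝ) ^ (ε / 4)) * ((K2 * (q : ℝ) ^ (ε / 4)) * (h * (q : ℝ)⁻¹)) := by
              have e5 := hK1 q
              gcongr
              refine e1.trans ?_
              rw [div_eq_mul_inv]
              gcongr
          _ = K1 * K2 * h * ((q : ℝ) ^ (ε / 4) * (q : ℝ) ^ (ε / 4) * (q : ℝ) ^ (-1 : ℝ)) := by
              rw [Real.rpow_neg_one]; ring
          _ = _ := by
              rw [← Real.rpow_add hq0, ← Real.rpow_add hq0]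
              congr 2; ring
    _ = K1 * K2 * h * ∑ q ∈ Finset.Icc 1 ⌊u⌋₊, (q : ℝ) ^ (ε / 2 - 1) := by rw [Finset.mul_sum]
    _ ≤ K1 * K2 * h * (L * u ^ ε) := by
        have := hL u hu
        rw [mul_div_cancel₀ _ (two_ne_zero)] at this
        gcongr
    _ = _ := by ring

/-! ### Reduction of the shifted sum to sums over residue classes. -/

/-- The shifted divisor sum over the multiples of `q` in `[z, x]`. -/
def shiftSum (h k q : ℕ) (z x : ℝ) : ℂ :=
  ∑ n ∈ Finset.Icc 1 ⌊x⌋₊, if q ∣ n ∧ z ≤ n then (d k (n + h) : ℂ) else 0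

/-- The shift n ↦ n + h moves each endpoint by h, so the discrepancy consists of two intervals of at
most h terms. The ceiling appears because z ≤ n is inclusive. -/
lemma shiftSum_sub_eq {h k q : ℕ} {z x : ℝ} (hh : 1 ≤ h) (hz : 1 ≤ z) (hzx : z ≤ x)
    {f : ℕ → ℂ} (hf : f = fun n => if n ≡ h [MOD q] then (d k n : ℂ) else 0) :
    shiftSum h k q z x - (residueSum h k q x - residueSum h k q z)
      = ∑ n ∈ Finset.Ico (⌊x⌋₊ + 1) (⌊x⌋₊ + 1 + h), f n
        - ∑ n ∈ Finset.Ico (⌊z⌋₊ + 1) (⌈z⌉₊ + h), f n := by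
  have hD : ∀ y : ℝ, residueSum h k q y = ∑ n ∈ Finset.Ico 1 (⌊y⌋₊ + 1), f n := fun y => by
    rw [residueSum, Nat.cast_sum, Finset.sum_filter, hf]
    rfl
  have ha1 : 1 ≤ ⌈z⌉₊ := Nat.one_le_ceil_iff.mpr (by linarith)
  have hac : ⌈z⌉₊ ≤ ⌊z⌋₊ + 1 := Nat.ceil_le_floor_add_one z
  have hca : ⌊z⌋₊ ≤ ⌈z⌉₊ := Nat.floor_le_ceil z
  have hcb : ⌊z⌋₊ ≤ ⌊x⌋₊ := Nat.floor_le_floor hzx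
  have hB : shiftSum h k q z x = ∑ n ∈ Finset.Ico (⌈z⌉₊ + h) (⌊x⌋₊ + 1 + h), f n := by
    rw [← Finset.sum_Ico_add' f, shiftSum, ← Finset.sum_filter]
    have h1 : (Finset.Icc 1 ⌊x⌋₊).filter (fun n : ℕ => q ∣ n ∧ z ≤ n)
        = (Finset.Ico ⌈z⌉₊ (⌊x⌋₊ + 1)).filter (fun n : ℕ => q ∣ n) := by
      ext n
      simp only [Finset.mem_filter, Finset.mem_Icc, Finset.mem_Ico, ← Nat.ceil_le]
      constructor
      · rintro ⟨⟨a, b⟩, c, e⟩; exact ⟨⟨e, by omega⟩, c⟩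
      · rintro ⟨⟨a, b⟩, c⟩; exact ⟨⟨by omega, by omega⟩, c, a⟩
    rw [h1, Finset.sum_filter, hf]
    refine Finset.sum_congr rfl fun n _ => ?_
    have h2 : n + h ≡ h [MOD q] ↔ q ∣ n := by
      rw [← Nat.modEq_zero_iff_dvd]
      constructor
      · intro hx; exact Nat.ModEq.add_right_cancel' h (by simpa using hx)
      · intro hx; simpa using hx.add_right h
    simp only [h2]
  have e1 := Finset.sum_Ico_consecutive f (show 1 ≤ ⌊z⌋₊ + 1 by omega) (show ⌊z⌋₊ + 1 ≤ ⌊x⌋₊ + 1 by omega)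
  have e2 := Finset.sum_Ico_consecutive f (show ⌊z⌋₊ + 1 ≤ ⌊x⌋₊ + 1 by omega)
    (show ⌊x⌋₊ + 1 ≤ ⌊x⌋₊ + 1 + h by omega)
  have e3 := Finset.sum_Ico_consecutive f (show ⌊z⌋₊ + 1 ≤ ⌈z⌉₊ + h by omega)
    (show ⌈z⌉₊ + h ≤ ⌊x⌋₊ + 1 + h by omega)
  rw [hB, hD, hD]
  linear_combination e3 - e2 + e1

lemma exists_shiftSum_sub_le (h k : ℕ) (hh : 1 ≤ h) {ε : ℝ} (hε : 0 < ε) :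
    ∃ K : ℝ, 0 ≤ K ∧ ∀ (q : ℕ) (z x : ℝ), 1 ≤ z → z ≤ x →
      ‖shiftSum h k q z x - (residueSum h k q x - residueSum h k q z)‖ ≤ K * x ^ ε := by
  obtain ⟨K, hK0, hK⟩ := exists_d_le k hε
  refine ⟨2 * (h * (K * (h + 1 : ℝ) ^ ε)), by positivity, fun q z x hz hzx => ?_⟩
  have hx0 : 0 < x := by linarith
  set f : ℕ → ℂ := fun n => if n ≡ h [MOD q] then (d k n : ℂ) else 0 with hf
  rw [shiftSum_sub_eq hh hz hzx hf]
  have hac : ⌈z⌉₊ ≤ ⌊z⌋₊ + 1 := Nat.ceil_le_floor_add_one z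
  have hcb : ⌊z⌋₊ ≤ ⌊x⌋₊ := Nat.floor_le_floor hzx
  have hfb : ∀ n < ⌊x⌋₊ + 1 + h, ‖f n‖ ≤ K * (h + 1 : ℝ) ^ ε * x ^ ε := fun n hn => by
    have h1 : ‖f n‖ ≤ (d k n : ℝ) := by
      simp only [hf]
      split_ifs
      · rw [Complex.norm_natCast]
      · simp
    have h2 : (n : ℝ) ≤ (h + 1) * x := by
      have h3 : (n : ℝ) ≤ ⌊x⌋₊ + h := by exact_mod_cast (by omega : n ≤ ⌊x⌋₊ + h)
      have h4 := Nat.floor_le hx0.le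
      have h5 : (h : ℝ) * 1 ≤ h * x := by gcongr; linarith
      linarith
    calc ‖f n‖ ≤ K * (n : ℝ) ^ ε := h1.trans (hK n)
      _ ≤ K * ((h + 1) * x) ^ ε := by gcongr
      _ = _ := by rw [Real.mul_rpow (by positivity) hx0.le, mul_assoc]
  have hS : ∀ a b : ℕ, b ≤ ⌊x⌋₊ + 1 + h → b ≤ a + h →
      ‖∑ n ∈ Finset.Ico a b, f n‖ ≤ h * (K * (h + 1 : ℝ) ^ ε * x ^ ε) := fun a b hb hab => by
    calc _ ≤ ∑ n ∈ Finset.Ico a b, K * (h + 1 : ℝ) ^ ε * x ^ ε :=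
          norm_sum_le_of_le _ fun n hn => hfb n (by have := (Finset.mem_Ico.mp hn).2; omega)
      _ = ((b - a : ℕ) : ℝ) * (K * (h + 1 : ℝ) ^ ε * x ^ ε) := by
          rw [Finset.sum_const, Nat.card_Ico, nsmul_eq_mul]
      _ ≤ _ := by
          gcongr
          omega
  calc _ ≤ h * (K * (h + 1 : ℝ) ^ ε * x ^ ε) + h * (K * (h + 1 : ℝ) ^ ε * x ^ ε) :=
        (norm_sub_le _ _).trans (add_le_add (hS _ _ le_rfl le_rfl) (hS _ _ (by omega) (by omega)))
    _ = _ := by ring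

lemma sum_d_mul_dPartial_eq (h k l : ℕ) {A : ℝ} (hA : 0 < A) {x : ℝ} (hx : 1 ≤ x) :
    (((∑ n ∈ Finset.Icc 1 ⌊x⌋₊, (d k (n + h) : ℝ) * (dPartial l A n : ℝ) : ℝ)) : ℂ)
      = ∑ q ∈ Finset.Icc 1 ⌊x ^ A⌋₊, (d (l - 1) q : ℂ) * shiftSum h k q ((q : ℝ) ^ A⁻¹) x := by
  have h1 : ∀ n ∈ Finset.Icc 1 ⌊x⌋₊, dPartial l A n
      = ∑ q ∈ Finset.Icc 1 ⌊x ^ A⌋₊, if q ∣ n ∧ (q : ℝ) ^ A⁻¹ ≤ n then d (l - 1) q else 0 := fun n hn => by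
    obtain ⟨hn1, hn2⟩ := Finset.mem_Icc.mp hn
    have hnx : (n : ℝ) ≤ x := (Nat.le_floor_iff (by linarith)).mp hn2
    rw [dPartial, ← Finset.sum_filter]
    refine Finset.sum_congr ?_ fun _ _ => rfl
    ext q
    simp only [Finset.mem_filter, Nat.mem_divisors, Finset.mem_Icc]
    rw [Real.rpow_inv_le_iff_of_pos (by positivity) (by positivity) hA]
    constructor
    · rintro ⟨⟨hq, hn0⟩, hqn⟩
      refine ⟨⟨Nat.pos_of_dvd_of_pos hq hn1, Nat.le_floor (hqn.trans ?_)⟩, hq, hqn⟩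
      gcongr
    · rintro ⟨_, hq, hqn⟩
      exact ⟨⟨hq, by omega⟩, hqn⟩
  push_cast
  rw [Finset.sum_congr rfl fun n hn => by rw [h1 n hn]]
  push_cast
  simp only [Finset.mul_sum, shiftSum]
  rw [Finset.sum_comm]
  refine Finset.sum_congr rfl fun q _ => Finset.sum_congr rfl fun n _ => ?_
  split_ifs <;> ring

/-- Two errors arise: the endpoint terms, O(x^ε) for each of at most x^A moduli, and the
distribution errors at x and at q^{1/A}, summed by `exists_sum_d_div_totient_le`. -/
lemma exists_sum_d_mul_dPartial_sub_le {h k l : ℕ} (hh : 1 ≤ h) (hk : 1 ≤ k) {θ A : ℝ}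
    (hθ : ∀ g : ℕ, 1 ≤ g → IsExponentOfDistribution g k θ) (hA0 : 0 < A) (hA : A < θ) :
    ∃ δ : ℝ, 0 < δ ∧ ∃ K : ℝ, 0 ≤ K ∧ ∀ x : ℝ, 1 ≤ x →
      ‖(((∑ n ∈ Finset.Icc 1 ⌊x⌋₊, (d k (n + h) : ℝ) * (dPartial l A n : ℝ) : ℝ)) : ℂ)
        - ∑ q ∈ Finset.Icc 1 ⌊x ^ A⌋₊, (d (l - 1) q : ℂ) *
          (x * (residuePoly h k q).eval (Real.log x : ℂ)
            - ((q : ℝ) ^ A⁻¹ : ℝ) * (residuePoly h k q).eval (Real.log ((q : ℝ) ^ A⁻¹) : ℂ))‖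
        ≤ K * x ^ (1 - δ) := by
  have hθ1 := (hθ 1 le_rfl).2.1
  obtain ⟨δ₀, hδ₀, K₀, hK₀0, hK₀'⟩ := exists_residueSum_sub_le (by omega : h ≠ 0) hk hθ hA
  -- δ ≤ 1 makes y ↦ y^{1-δ} monotone, so the error at y = q^{1/A} is bounded by the one at x.
  set δ := min δ₀ 1 with hδdef
  have hδ : 0 < δ := lt_min hδ₀ one_pos
  have hδ1 : δ ≤ 1 := min_le_right _ _
  have hK₀ : ∀ y : ℝ, 1 ≤ y → ∀ q : ℕ, 1 ≤ q → (q : ℝ) ≤ y ^ A →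
      ‖residueSum h k q y - y * (residuePoly h k q).eval (Real.log y : ℂ)‖
        ≤ K₀ * (y ^ (1 - δ) / (Nat.totient (q / h.gcd q) : ℝ)) := fun y hy q hq hqy =>
    (hK₀' y hy q hq hqy).trans (by gcongr; exact min_le_left _ _)
  have hε1 : 0 < δ / (2 * A) := by positivity
  obtain ⟨K₁, hK₁0, hK₁⟩ := exists_sum_d_div_totient_le h (l - 1) (by omega : h ≠ 0) hε1
  -- Positive because A < θ ≤ 1; chosen so that x^A · x^η · x^η = x^{1-2η}.
  set η := (1 - A) / 4 with hη
  have hη0 : 0 < η := by rw [hη]; linarith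
  obtain ⟨K₂, hK₂0, hK₂⟩ := exists_shiftSum_sub_le h k hh hη0
  obtain ⟨K₃, hK₃0, hK₃⟩ := exists_d_le (l - 1) hη0
  refine ⟨min (δ / 2) (2 * η), lt_min (by positivity) (by positivity), K₃ * K₂ + 2 * K₀ * K₁,
    by positivity, fun x hx => ?_⟩
  have hx0 : 0 < x := by linarith
  have hX1 : 1 ≤ x ^ A := Real.one_le_rpow hx hA0.le
  have hqx : ∀ q ∈ Finset.Icc 1 ⌊x ^ A⌋₊, 1 ≤ q ∧ (q : ℝ) ≤ x ^ A := fun q hq =>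
    ⟨(Finset.mem_Icc.mp hq).1, (Nat.le_floor_iff (by positivity)).mp (Finset.mem_Icc.mp hq).2⟩
  have hz : ∀ q ∈ Finset.Icc 1 ⌊x ^ A⌋₊, 1 ≤ (q : ℝ) ^ A⁻¹ ∧ (q : ℝ) ^ A⁻¹ ≤ x := fun q hq =>
    ⟨Real.one_le_rpow (by exact_mod_cast (hqx q hq).1) (by positivity),
      (Real.rpow_inv_le_iff_of_pos (by positivity) hx0.le hA0).mpr (hqx q hq).2⟩
  rw [sum_d_mul_dPartial_eq h k l hA0 hx, ← Finset.sum_sub_distrib]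
  set E1 : ℕ → ℂ := fun q => shiftSum h k q ((q : ℝ) ^ A⁻¹) x
    - (residueSum h k q x - residueSum h k q ((q : ℝ) ^ A⁻¹)) with hE1
  set E2 : ℝ → ℕ → ℂ := fun y q => residueSum h k q y - y * (residuePoly h k q).eval (Real.log y : ℂ) with hE2
  have hsplit : ∀ q ∈ Finset.Icc 1 ⌊x ^ A⌋₊, (d (l - 1) q : ℂ) * shiftSum h k q ((q : ℝ) ^ A⁻¹) x
      - (d (l - 1) q : ℂ) * (x * (residuePoly h k q).eval (Real.log x : ℂ)
        - ((q : ℝ) ^ A⁻¹ : ℝ) * (residuePoly h k q).eval (Real.log ((q : ℝ) ^ A⁻¹) : ℂ))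
      = (d (l - 1) q : ℂ) * E1 q + (d (l - 1) q : ℂ) * (E2 x q - E2 ((q : ℝ) ^ A⁻¹) q) := fun q _ => by
    simp only [hE1, hE2]; ring
  rw [Finset.sum_congr rfl hsplit, Finset.sum_add_distrib, add_mul]
  refine (norm_add_le _ _).trans (add_le_add ?_ ?_)
  · calc _ ≤ ∑ q ∈ Finset.Icc 1 ⌊x ^ A⌋₊, (K₃ * x ^ η) * (K₂ * x ^ η) := by
          refine norm_sum_le_of_le _ fun q hq => ?_
          rw [norm_mul, Complex.norm_natCast]
          have h1 := hK₂ q _ x (hz q hq).1 (hz q hq).2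
          have h2 : (d (l - 1) q : ℝ) ≤ K₃ * x ^ η := by
            refine (hK₃ q).trans ?_
            gcongr
            refine (hqx q hq).2.trans ?_
            calc x ^ A ≤ x ^ (1 : ℝ) := Real.rpow_le_rpow_of_exponent_le hx (by linarith)
              _ = x := Real.rpow_one x
          gcongr
      _ = ⌊x ^ A⌋₊ * ((K₃ * x ^ η) * (K₂ * x ^ η)) := by simp
      _ ≤ x ^ A * ((K₃ * x ^ η) * (K₂ * x ^ η)) := by
          gcongr
          exact Nat.floor_le (by positivity)
      _ = K₃ * K₂ * (x ^ A * x ^ η * x ^ η) := by ring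
      _ = K₃ * K₂ * x ^ (1 - 2 * η) := by
          rw [← Real.rpow_add hx0, ← Real.rpow_add hx0]
          congr 2; rw [hη]; ring
      _ ≤ _ := by
          gcongr
          exact min_le_right _ _
  · calc _ ≤ ∑ q ∈ Finset.Icc 1 ⌊x ^ A⌋₊, 2 * K₀ * x ^ (1 - δ) *
          ((d (l - 1) q : ℝ) / (Nat.totient (q / h.gcd q) : ℝ)) := by
          refine norm_sum_le_of_le _ fun q hq => ?_
          rw [norm_mul, Complex.norm_natCast]
          have h1 := hK₀ x hx q (hqx q hq).1 (hqx q hq).2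
          -- At y = q^{1/A} the condition q ≤ y^A is an equality, so the hypothesis still just
          -- applies.
          have h2 := hK₀ _ (hz q hq).1 q (hqx q hq).1 (by
            rw [← Real.rpow_mul (by positivity), inv_mul_cancel₀ hA0.ne', Real.rpow_one])
          have h3 : ((q : ℝ) ^ A⁻¹) ^ (1 - δ) ≤ x ^ (1 - δ) :=
            Real.rpow_le_rpow (by positivity) (hz q hq).2 (by linarith)
          calc (d (l - 1) q : ℝ) * ‖E2 x q - E2 ((q : ℝ) ^ A⁻¹) q‖
              ≤ (d (l - 1) q : ℝ) * (K₀ * (x ^ (1 - δ) / (Nat.totient (q / h.gcd q) : ℝ))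
                + K₀ * (x ^ (1 - δ) / (Nat.totient (q / h.gcd q) : ℝ))) := by
                gcongr
                refine (norm_sub_le _ _).trans (add_le_add h1 (h2.trans ?_))
                gcongr
            _ = _ := by ring
      _ = 2 * K₀ * x ^ (1 - δ) * ∑ q ∈ Finset.Icc 1 ⌊x ^ A⌋₊,
          ((d (l - 1) q : ℝ) / (Nat.totient (q / h.gcd q) : ℝ)) := by rw [Finset.mul_sum]
      _ ≤ 2 * K₀ * x ^ (1 - δ) * (K₁ * (x ^ A) ^ (δ / (2 * A))) := by
          gcongr
          exact hK₁ _ hX1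
      _ = 2 * K₀ * K₁ * (x ^ (1 - δ) * x ^ (δ / 2)) := by
          rw [← Real.rpow_mul hx0.le, show A * (δ / (2 * A)) = δ / 2 by field_simp]; ring
      _ = 2 * K₀ * K₁ * x ^ (1 - δ / 2) := by
          rw [← Real.rpow_add hx0]; congr 2; ring
      _ ≤ _ := by
          gcongr
          exact min_le_left _ _

/-! ### The differential equation satisfied by the explicit polynomial. -/

lemma descPochhammer_eval_sub (j M : ℕ) :
    (descPochhammer ℂ j).eval ((j : ℂ) - 1 - M) = (-1) ^ j * (M.descFactorial j : ℂ) := by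
  rw [descPochhammer_eval_eq_ascPochhammer, show (j : ℂ) - 1 - M - j + 1 = -(M : ℂ) by ring,
    ascPochhammer_eval_neg_eq_descPochhammer, descPochhammer_eval_eq_descFactorial]

lemma bCoeff_eq_zero_of_le {h k l m n : ℕ} (hmn : k ≤ m ∨ l ≤ n) : bCoeff h k l m n = 0 := by
  rw [bCoeff]
  rcases hmn with hm | hn
  · rw [Nat.sub_eq_zero_of_le hm, Finset.sum_range_zero]
  · simp [Nat.sub_eq_zero_of_le hn]

/-- The terms of `secCoeff`. -/
def secTerm (A : ℝ) (h k l j t v : ℕ) : ℂ :=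
  (-(A : ℂ)) ^ ((l : ℤ) - 1 - t - v) * aCoeff v (l - 1) / ((v ! : ℂ) * (t ! : ℂ))
        * (descPochhammer ℂ j).eval ((v : ℂ) + t + 1 - l)
        * ∑ i ∈ Finset.Ico j k,
            (i.choose j : ℂ) * cCoeff (k - 1 - i) k / (i ! : ℂ) * mixedDeriv h k l (i - j) t

/-- The alternating sign turns the sum of adjacent coefficients into a difference, and the ranges M
+ t + v + 2 ≤ j + l for M and M + 1 differ exactly where equality holds. -/
lemma secCoeff_add_succ (A : ℝ) (h k l M : ℕ) :
    secCoeff A h k l M + secCoeff A h k l (M + 1) = (-1) ^ M * ∑ j ∈ Finset.range k,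
      ∑ t ∈ Finset.range (j + l), ∑ v ∈ Finset.range (j + l),
        if M + t + v + 2 = j + l then secTerm A h k l j t v else 0 := by
  simp only [secCoeff, secTerm]
  rw [pow_succ, mul_neg_one, neg_mul, ← sub_eq_add_neg, ← mul_sub]
  simp only [← Finset.sum_sub_distrib]
  congr 1
  refine Finset.sum_congr rfl fun j _ => Finset.sum_congr rfl fun t _ => Finset.sum_congr rfl fun v _ => ?_
  by_cases h1 : M + t + v + 2 = j + l
  · rw [if_pos h1.le, if_neg (by omega), if_pos h1, sub_zero]
  · by_cases h2 : M + t + v + 2 ≤ j + l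
    · rw [if_pos h2, if_pos (by omega), if_neg h1, sub_self]
    · rw [if_neg h2, if_neg (by omega), if_neg h1, sub_zero]

lemma sum_Ico_choose_eq (h k l j t : ℕ) :
    ∑ i ∈ Finset.Ico j k, (i.choose j : ℂ) * cCoeff (k - 1 - i) k / (i ! : ℂ) * mixedDeriv h k l (i - j) t
      = (j ! : ℂ)⁻¹ * ∑ i ∈ Finset.range (k - j), cCoeff (k - 1 - j - i) k / (i ! : ℂ) * mixedDeriv h k l i t := by
  rw [Finset.sum_Ico_eq_sum_range, Finset.mul_sum]
  refine Finset.sum_congr rfl fun i _ => ?_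
  have h1 : (((j + i).choose j : ℕ) : ℂ) * (j ! : ℂ) * (i ! : ℂ) = ((j + i)! : ℂ) := by
    have := Nat.choose_mul_factorial_mul_factorial (Nat.le_add_right j i)
    rw [Nat.add_sub_cancel_left] at this
    exact_mod_cast this
  have e1 : (i ! : ℂ) ≠ 0 := by exact_mod_cast i.factorial_ne_zero
  have e2 : (j ! : ℂ) ≠ 0 := by exact_mod_cast j.factorial_ne_zero
  have e3 : (((j + i).choose j : ℕ) : ℂ) ≠ 0 := by
    exact_mod_cast (Nat.choose_pos (Nat.le_add_right j i)).ne'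
  rw [← h1, Nat.add_sub_cancel_left, ← Nat.sub_sub]
  field_simp

/-- On the line M + t + v + 2 = j + l the falling factorial is evaluated at j - 1 - M. It equals
(-1)^j times that of M, so it vanishes for j > M. Otherwise v is determined by t and the remaining
sum is `bCoeff`. -/
lemma sum_secTerm_eq (A : ℝ) (h k l M j : ℕ) :
    (-1) ^ M * ∑ t ∈ Finset.range (j + l), ∑ v ∈ Finset.range (j + l),
        (if M + t + v + 2 = j + l then secTerm A h k l j t v else 0)
      = if j ≤ M then -((A : ℂ) ^ (M + 1 - j) * (M.choose j : ℂ) * bCoeff h k l j (M + 1 - j)) else 0 := by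
  have hv : ∀ t v : ℕ, M + t + v + 2 = j + l → (descPochhammer ℂ j).eval ((v : ℂ) + t + 1 - l)
      = (-1) ^ j * (M.descFactorial j : ℂ) := fun t v hv => by
    have e : (M : ℂ) + t + v + 2 = j + l := by exact_mod_cast hv
    rw [← descPochhammer_eval_sub]
    congr 1
    linear_combination e
  split_ifs with hjM
  · have h1 : ∀ t, ∑ v ∈ Finset.range (j + l),
        (if M + t + v + 2 = j + l then secTerm A h k l j t v else 0)
        = if t < l - (M + 1 - j) then secTerm A h k l j t (l - 1 - (M + 1 - j) - t) else 0 := fun t => by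
      split_ifs with ht
      · rw [Finset.sum_eq_single_of_mem (l - 1 - (M + 1 - j) - t) (Finset.mem_range.mpr (by omega))]
        · rw [if_pos (by omega)]
        · intro v _ hne; rw [if_neg (by omega)]
      · exact Finset.sum_eq_zero fun v _ => if_neg (by omega)
    simp only [h1]
    rw [← Finset.sum_filter]
    have h2 : (Finset.range (j + l)).filter (fun t => t < l - (M + 1 - j)) = Finset.range (l - (M + 1 - j)) := by
      ext t; simp only [Finset.mem_filter, Finset.mem_range]; omega
    rw [h2, bCoeff, Finset.sum_comm, Finset.mul_sum, Finset.mul_sum, ← Finset.sum_neg_distrib]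
    refine Finset.sum_congr rfl fun t ht => ?_
    have ht' := Finset.mem_range.mp ht
    have hsum : M + t + (l - 1 - (M + 1 - j) - t) + 2 = j + l := by omega
    set v := l - 1 - (M + 1 - j) - t with hvdef
    -- On this line the integer exponent of -A is the natural number M + 1 - j, so no negative
    -- powers remain.
    have hexp : (l : ℤ) - 1 - t - v = ((M + 1 - j : ℕ) : ℤ) := by
      have : (M : ℤ) + t + v + 2 = j + l := by exact_mod_cast hsum
      push_cast [Nat.cast_sub (by omega : j ≤ M + 1)]
      linarith
    rw [secTerm, hv t v hsum, sum_Ico_choose_eq, hexp, zpow_natCast, Nat.descFactorial_eq_factorial_mul_choose]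
    have e1 : (t ! : ℂ) ≠ 0 := by exact_mod_cast t.factorial_ne_zero
    have e2 : (j ! : ℂ) ≠ 0 := by exact_mod_cast j.factorial_ne_zero
    have e3 : (v ! : ℂ) ≠ 0 := by exact_mod_cast v.factorial_ne_zero
    have hs : ∑ i ∈ Finset.range (k - j), aCoeff v (l - 1) * cCoeff (k - 1 - j - i) k / (v ! : ℂ)
        * (mixedDeriv h k l i t / ((i ! : ℂ) * (t ! : ℂ)))
        = aCoeff v (l - 1) / ((v ! : ℂ) * (t ! : ℂ)) *
          ∑ i ∈ Finset.range (k - j), cCoeff (k - 1 - j - i) k / (i ! : ℂ) * mixedDeriv h k l i t := by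
      rw [Finset.mul_sum]
      refine Finset.sum_congr rfl fun i _ => ?_
      have e4 : (i ! : ℂ) ≠ 0 := by exact_mod_cast i.factorial_ne_zero
      field_simp
    rw [hs]
    have hsign : (-1 : ℂ) ^ M * ((-1) ^ (M + 1 - j) * (-1) ^ j) = -1 := by
      rw [← pow_add, Nat.sub_add_cancel (by omega), ← pow_add, show M + (M + 1) = 2 * M + 1 by ring,
        pow_succ, pow_mul]
      simp
    rw [neg_pow (A : ℂ)]
    push_cast
    set E := ∑ i ∈ Finset.range (k - j), cCoeff (k - 1 - j - i) k / (i ! : ℂ) * mixedDeriv h k l i t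
    calc _ = ((-1 : ℂ) ^ M * ((-1) ^ (M + 1 - j) * (-1) ^ j)) * ((j ! : ℂ) * (j ! : ℂ)⁻¹) *
          ((A : ℂ) ^ (M + 1 - j) * (M.choose j : ℂ) * (aCoeff v (l - 1) / ((v ! : ℂ) * (t ! : ℂ)) * E)) := by
          ring
      _ = _ := by rw [hsign, mul_inv_cancel₀ e2]; ring
  · rw [Finset.sum_eq_zero fun t _ => Finset.sum_eq_zero fun v _ => ?_, mul_zero]
    split_ifs with h1
    · rw [secTerm, hv t v h1, Nat.descFactorial_eq_zero_iff_lt.mpr (by omega)]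
      simp
    · rfl

lemma secCoeff_add_succ_eq (A : ℝ) (h k l M : ℕ) :
    secCoeff A h k l M + secCoeff A h k l (M + 1) = -∑ j ∈ Finset.range (M + 1),
      (A : ℂ) ^ (M + 1 - j) * (M.choose j : ℂ) * bCoeff h k l j (M + 1 - j) := by
  rw [secCoeff_add_succ, Finset.mul_sum, Finset.sum_congr rfl fun j _ => sum_secTerm_eq A h k l M j,
    ← Finset.sum_filter, ← Finset.sum_neg_distrib]
  refine (Finset.sum_subset (fun j hj => ?_) fun j hj hj' => ?_)
  · have := (Finset.mem_filter.mp hj).2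
    exact Finset.mem_range.mpr (by omega)
  · have h1 := Finset.mem_range.mp hj
    have h2 : k ≤ j := by
      by_contra hc
      exact hj' (Finset.mem_filter.mpr ⟨Finset.mem_range.mpr (by omega), by omega⟩)
    rw [bCoeff_eq_zero_of_le (Or.inl h2), mul_zero, neg_zero]

lemma secCoeff_eq_zero (A : ℝ) {h k l m : ℕ} (hm : k + l - 2 ≤ m) : secCoeff A h k l m = 0 := by
  rw [secCoeff, Finset.sum_eq_zero, mul_zero]
  intro j hj
  have := Finset.mem_range.mp hj
  exact Finset.sum_eq_zero fun t _ => Finset.sum_eq_zero fun v _ => if_neg (by omega)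

/-- The polynomial multiplying the `i`-th Taylor coefficients of `gcdFactor` in the main term. -/
def cPoly (k i : ℕ) : ℂ[X] :=
  ∑ m ∈ Finset.range k, Polynomial.C ((if m + i < k then cCoeff (k - 1 - m - i) k else 0) / (m ! : ℂ))
    * Polynomial.X ^ m

lemma sum_if_add_lt {M : Type*} [AddCommMonoid M] (k m : ℕ) (f : ℕ → M) :
    ∑ i ∈ Finset.range k, (if m + i < k then f i else 0) = ∑ i ∈ Finset.range (k - m), f i := by
  rw [← Finset.sum_filter]
  refine Finset.sum_congr ?_ fun _ _ => rfl
  ext i; simp only [Finset.mem_filter, Finset.mem_range]; omega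

/-- Leibniz's rule separates the q-dependence, carried by `gcdTaylor`, from the polynomials in log
y. The guard m + i < k in `cPoly` discards the indices where truncated subtraction would give
spurious terms. -/
lemma C_mul_residuePoly (h k j q : ℕ) :
    Polynomial.C (d j q : ℂ) * residuePoly h k q
      = ∑ i ∈ Finset.range k, Polynomial.C (gcdTaylor h k j i q) * cPoly k i := by
  simp only [residuePoly, cPoly, Finset.mul_sum]
  rw [Finset.sum_comm]
  refine Finset.sum_congr rfl fun m hm => ?_
  have hm' := Finset.mem_range.mp hm
  simp only [← mul_assoc (Polynomial.C _) (Polynomial.C _), ← Polynomial.C_mul]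
  rw [← Finset.sum_mul, ← map_sum]
  congr 2
  rw [taylorCoeff_mul _ (analyticAt_gcdFactor_div h k q 1) (analyticAt_zetaReg_pow_div k),
    show k - 1 - m + 1 = k - m by omega, ← sum_if_add_lt, mul_div_assoc', Finset.mul_sum, Finset.sum_div]
  refine Finset.sum_congr rfl fun i _ => ?_
  split_ifs
  · have h1 : taylorCoeff (fun s => gcdFactor h k s q / q) 1 i
        = (q : ℂ)⁻¹ * taylorCoeff (fun s => gcdFactor h k s q) 1 i := by
      rw [← taylorCoeff_const_mul]
      congr 1; ext s; ring
    rw [cCoeff_eq, h1, gcdTaylor]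
    ring
  · simp

section Identity

variable {A : ℝ} {h k l : ℕ} {Q : ℕ → ℂ[X]}

lemma comp_C_mul_X_eq_sum {P : ℂ[X]} {l : ℕ} (hP : ∀ n, l ≤ n → P.coeff n = 0) (a : ℂ) :
    P.comp (Polynomial.C a * Polynomial.X)
      = ∑ n ∈ Finset.range l, Polynomial.C (a ^ n * P.coeff n) * Polynomial.X ^ n := by
  ext n
  rw [comp_C_mul_X_coeff, finsetSum_coeff]
  simp only [coeff_C_mul, coeff_X_pow, mul_ite, mul_one, mul_zero]
  rw [Finset.sum_ite_eq]
  split_ifs with hn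
  · rw [mul_comm]
  · rw [hP n (by simpa using hn), zero_mul]

lemma sum_cCoeff_mul_coeff (hQ : ∀ i n, (Q i).coeff n = ∑ t ∈ Finset.range (l - n),
      aCoeff (l - 1 - n - t) (l - 1) / (((l - 1 - n - t)! : ℂ) * (n ! : ℂ) * (t ! : ℂ))
          * (mixedDeriv h k l i t / (i ! : ℂ))) (m n : ℕ) :
    ∑ i ∈ Finset.range k, (if m + i < k then cCoeff (k - 1 - m - i) k else 0) * (Q i).coeff n
      = bCoeff h k l m n / (n ! : ℂ) := by
  simp only [ite_mul, zero_mul]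
  rw [sum_if_add_lt, bCoeff, Finset.sum_div]
  refine Finset.sum_congr rfl fun i _ => ?_
  rw [hQ, Finset.mul_sum, Finset.sum_div]
  refine Finset.sum_congr rfl fun t _ => ?_
  have e1 : (t ! : ℂ) ≠ 0 := by exact_mod_cast t.factorial_ne_zero
  have e2 : (i ! : ℂ) ≠ 0 := by exact_mod_cast i.factorial_ne_zero
  have e3 : (n ! : ℂ) ≠ 0 := by exact_mod_cast n.factorial_ne_zero
  have e4 : ((l - 1 - n - t)! : ℂ) ≠ 0 := by exact_mod_cast (l - 1 - n - t).factorial_ne_zero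
  field_simp

/-- Write R_i(z) = Q_i(Az) and the polynomial as B + S with B = ∑ c_i R_i, the part with `bCoeff`.
Then B + B' exceeds the right-hand side by ∑ c_i R_i', so S, the part with `secCoeff`, must satisfy
S + S' = -∑ c_i R_i'. -/
lemma mainPoly_add_derivative (hQ : ∀ i n, (Q i).coeff n = ∑ t ∈ Finset.range (l - n),
      aCoeff (l - 1 - n - t) (l - 1) / (((l - 1 - n - t)! : ℂ) * (n ! : ℂ) * (t ! : ℂ))
          * (mixedDeriv h k l i t / (i ! : ℂ))) :
    mainPoly A h k l + derivative (mainPoly A h k l)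
      = ∑ i ∈ Finset.range k, (cPoly k i + derivative (cPoly k i)) *
        (Q i).comp (Polynomial.C (A : ℂ) * Polynomial.X) := by
  set R : ℕ → ℂ[X] := fun i => (Q i).comp (Polynomial.C (A : ℂ) * Polynomial.X) with hR
  have hQ0 : ∀ i n, l ≤ n → (Q i).coeff n = 0 := fun i n hn => by
    rw [hQ, Nat.sub_eq_zero_of_le hn, Finset.sum_range_zero]
  have hRs : ∀ i, R i = ∑ n ∈ Finset.range l, Polynomial.C ((A : ℂ) ^ n * (Q i).coeff n) * Polynomial.X ^ n :=
    fun i => comp_C_mul_X_eq_sum (hQ0 i) _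
  -- One expansion for two uses: z = 1, e = id expands B, while z(n) = n, e(n) = n - 1 expands ∑ c_i
  -- R_i'.
  have hgen : ∀ (z : ℕ → ℂ) (e : ℕ → ℕ), ∑ i ∈ Finset.range k, cPoly k i *
      ∑ n ∈ Finset.range l, Polynomial.C ((A : ℂ) ^ n * (Q i).coeff n * z n) * Polynomial.X ^ e n
      = ∑ m ∈ Finset.range k, ∑ n ∈ Finset.range l,
        Polynomial.C ((A : ℂ) ^ n * bCoeff h k l m n / ((m ! : ℂ) * (n ! : ℂ)) * z n)
          * Polynomial.X ^ (m + e n) := fun z e => by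
    simp only [cPoly, Finset.sum_mul_sum]
    rw [Finset.sum_comm]
    refine Finset.sum_congr rfl fun m _ => ?_
    rw [Finset.sum_comm]
    refine Finset.sum_congr rfl fun n _ => ?_
    have h1 : ∀ i, Polynomial.C ((if m + i < k then cCoeff (k - 1 - m - i) k else 0) / (m ! : ℂ))
        * Polynomial.X ^ m * (Polynomial.C ((A : ℂ) ^ n * (Q i).coeff n * z n) * Polynomial.X ^ e n)
        = Polynomial.C ((A : ℂ) ^ n * z n / (m ! : ℂ) *
          ((if m + i < k then cCoeff (k - 1 - m - i) k else 0) * (Q i).coeff n)) * Polynomial.X ^ (m + e n) := by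
      intro i
      rw [pow_add, mul_mul_mul_comm, ← Polynomial.C_mul]
      congr 2
      ring
    simp only [h1]
    rw [← Finset.sum_mul, ← map_sum, ← Finset.mul_sum, sum_cCoeff_mul_coeff hQ]
    congr 2
    rw [← div_div]
    ring
  set S : ℂ[X] := ∑ m ∈ Finset.range (k + l - 2), Polynomial.C (secCoeff A h k l m / (m ! : ℂ)) * Polynomial.X ^ m
    with hS
  have hB : mainPoly A h k l = ∑ i ∈ Finset.range k, cPoly k i * R i + S := by
    rw [mainPoly]
    congr 1
    have := hgen (fun _ => 1) id
    simp only [mul_one, id] at this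
    simp only [hRs]
    exact this.symm
  have hder : ∑ i ∈ Finset.range k, cPoly k i * derivative (R i)
      = ∑ m ∈ Finset.range k, ∑ n ∈ Finset.range l,
        Polynomial.C ((A : ℂ) ^ n * bCoeff h k l m n / ((m ! : ℂ) * (n ! : ℂ)) * n)
          * Polynomial.X ^ (m + (n - 1)) := by
    rw [← hgen (fun n => n) (fun n => n - 1)]
    refine Finset.sum_congr rfl fun i _ => ?_
    rw [hRs, derivative_sum]
    congr 1
    refine Finset.sum_congr rfl fun n _ => ?_
    rw [derivative_C_mul_X_pow]
  have hScoeff : ∀ m, S.coeff m = secCoeff A h k l m / (m ! : ℂ) := fun m => by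
    rw [hS, finsetSum_coeff]
    simp only [coeff_C_mul, coeff_X_pow, mul_ite, mul_one, mul_zero]
    rw [Finset.sum_ite_eq]
    split_ifs with hm
    · rfl
    · rw [secCoeff_eq_zero A (by simpa using hm), zero_div]
  -- Compared coefficientwise: because of the factors 1/m!, the M-th coefficient of S + S' is a sum
  -- of adjacent `secCoeff` divided by M!, evaluated by `secCoeff_add_succ_eq`.
  have hSS : S + derivative S = -∑ i ∈ Finset.range k, cPoly k i * derivative (R i) := by
    rw [hder]
    ext M
    rw [coeff_add, coeff_derivative, hScoeff, hScoeff, coeff_neg, finsetSum_coeff]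
    simp only [finsetSum_coeff, coeff_C_mul, coeff_X_pow, mul_ite, mul_one, mul_zero]
    have e0 : (M ! : ℂ) ≠ 0 := by exact_mod_cast M.factorial_ne_zero
    have e1 : (M : ℂ) + 1 ≠ 0 := by exact_mod_cast M.succ_ne_zero
    have h1 : secCoeff A h k l M / (M ! : ℂ) + secCoeff A h k l (M + 1) / ((M + 1)! : ℂ) * ((M : ℂ) + 1)
        = (secCoeff A h k l M + secCoeff A h k l (M + 1)) / (M ! : ℂ) := by
      rw [Nat.factorial_succ]; push_cast; field_simp
    rw [h1, secCoeff_add_succ_eq, neg_div, Finset.sum_div]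
    congr 1
    have h2 : ∀ m ∈ Finset.range k, ∑ n ∈ Finset.range l, (if M = m + (n - 1) then
        (A : ℂ) ^ n * bCoeff h k l m n / ((m ! : ℂ) * (n ! : ℂ)) * n else 0)
        = if m < M + 1 then (A : ℂ) ^ (M + 1 - m) * (M.choose m : ℂ) * bCoeff h k l m (M + 1 - m) / (M ! : ℂ)
          else 0 := fun m _ => by
      split_ifs with hm
      · have h3 : ∑ n ∈ Finset.range l, (if M = m + (n - 1) then
          (A : ℂ) ^ n * bCoeff h k l m n / ((m ! : ℂ) * (n ! : ℂ)) * n else 0)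
          = ∑ n ∈ Finset.range l, (if M + 1 - m = n then
          (A : ℂ) ^ n * bCoeff h k l m n / ((m ! : ℂ) * (n ! : ℂ)) * n else 0) := by
          refine Finset.sum_congr rfl fun n _ => ?_
          -- For n = 0 the truncated n - 1 is harmless, since the weight n vanishes.
          rcases Nat.eq_zero_or_pos n with rfl | hn
          · simp
          · by_cases hc : M = m + (n - 1)
            · rw [if_pos hc, if_pos (by omega)]
            · rw [if_neg hc, if_neg (by omega)]
        rw [h3, Finset.sum_ite_eq]
        obtain ⟨r, rfl⟩ := Nat.exists_eq_add_of_le (Nat.lt_succ_iff.mp hm)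
        have hr : m + r + 1 - m = r + 1 := by omega
        rw [hr]
        have h4 : (((m + r).choose m : ℕ) : ℂ) * (m ! : ℂ) * (r ! : ℂ) = ((m + r)! : ℂ) := by
          have := Nat.choose_mul_factorial_mul_factorial (Nat.le_add_right m r)
          rw [Nat.add_sub_cancel_left] at this
          exact_mod_cast this
        have h5 : (A : ℂ) ^ (r + 1) * bCoeff h k l m (r + 1) / ((m ! : ℂ) * ((r + 1)! : ℂ)) * ((r + 1 : ℕ) : ℂ)
            = (A : ℂ) ^ (r + 1) * ((m + r).choose m : ℂ) * bCoeff h k l m (r + 1) / ((m + r)! : ℂ) := by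
          have f1 : (m ! : ℂ) ≠ 0 := by exact_mod_cast m.factorial_ne_zero
          have f2 : (r ! : ℂ) ≠ 0 := by exact_mod_cast r.factorial_ne_zero
          have f3 : (((m + r).choose m : ℕ) : ℂ) ≠ 0 := by
            exact_mod_cast (Nat.choose_pos (Nat.le_add_right m r)).ne'
          have f4 : (r : ℂ) + 1 ≠ 0 := by exact_mod_cast r.succ_ne_zero
          rw [← h4, Nat.factorial_succ]
          push_cast
          field_simp
        split_ifs with hn
        · exact h5
        · rw [bCoeff_eq_zero_of_le (Or.inr (by simpa using hn))]
          simp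
      · exact Finset.sum_eq_zero fun n _ => if_neg (by omega)
    rw [Finset.sum_congr rfl h2, ← Finset.sum_filter]
    refine (Finset.sum_subset (fun m hm => ?_) fun m hm hm' => ?_).symm
    · exact Finset.mem_range.mpr (Finset.mem_filter.mp hm).2
    · have h3 := Finset.mem_range.mp hm
      have h4 : k ≤ m := by
        by_contra hc
        exact hm' (Finset.mem_filter.mpr ⟨Finset.mem_range.mpr (by omega), h3⟩)
      rw [bCoeff_eq_zero_of_le (Or.inl h4)]
      simp
  have hdB : derivative (∑ i ∈ Finset.range k, cPoly k i * R i)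
      = ∑ i ∈ Finset.range k, derivative (cPoly k i) * R i
        + ∑ i ∈ Finset.range k, cPoly k i * derivative (R i) := by
    rw [derivative_sum, ← Finset.sum_add_distrib]
    exact Finset.sum_congr rfl fun i _ => derivative_mul
  have hfin : ∑ i ∈ Finset.range k, (cPoly k i + derivative (cPoly k i)) * R i
      = ∑ i ∈ Finset.range k, cPoly k i * R i + ∑ i ∈ Finset.range k, derivative (cPoly k i) * R i := by
    rw [← Finset.sum_add_distrib]
    exact Finset.sum_congr rfl fun i _ => add_mul _ _ _
  rw [hfin, hB, derivative_add, hdB]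
  linear_combination hSS

end Identity

/-! ### Assembly of the asymptotic formula. -/

/-- The asymptotic formula, with complex coefficients. -/
lemma exists_sum_d_mul_dPartial_sub_mainPoly_le {h k l : ℕ} (hh : 1 ≤ h) (hk : 1 ≤ k) (hl : 1 ≤ l) {θ A : ℝ}
    (hθ : ∀ g : ℕ, 1 ≤ g → IsExponentOfDistribution g k θ) (hA0 : 0 < A) (hA : A < θ) :
    ∃ δ : ℝ, 0 < δ ∧ ∃ K : ℝ, ∀ x : ℝ, 1 ≤ x →
      ‖(((∑ n ∈ Finset.Icc 1 ⌊x⌋₊, (d k (n + h) : ℝ) * (dPartial l A n : ℝ) : ℝ)) : ℂ)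
        - x * (mainPoly A h k l).eval (Real.log x : ℂ)‖ ≤ K * x ^ (1 - δ) := by
  obtain ⟨j, rfl⟩ := Nat.exists_eq_add_of_le' hl
  have hh0 : h ≠ 0 := by omega
  obtain ⟨δ₁, hδ₁, K₁, hK₁0, hK₁⟩ := exists_sum_d_mul_dPartial_sub_le (l := j + 1) hh hk hθ hA0 hA
  choose Q δ hδ hQ hQc using fun i => exists_logAsymp_gcdTaylor h k j hh0 i
  -- Only a common exponent is wanted here; the constant slot is a dummy, as `LogAsymp` already
  -- quantifies its own constant.
  obtain ⟨δ₂, hδ₂, _, _, hQ2⟩ := exists_uniform_of_finset (Finset.range k)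
    (p := fun i δ _ => LogAsymp (partialSum (gcdTaylor h k j i)) (Q i) δ)
    (fun i δ δ' _ _ hδδ _ _ hp => hp.mono hδδ) (fun i _ => ⟨δ i, hδ i, 0, hQ i⟩)
  have hid := mainPoly_add_derivative (A := A) (h := h) (k := k) (l := j + 1) (Q := Q) (fun i n => by
    rw [hQc]
    refine Finset.sum_congr rfl fun t _ => ?_
    rw [mixedDeriv_eq h k j hh0 hk, taylorCoeff, Nat.add_sub_cancel])
  -- Applied at X = x^A with κ = 1/A, so that X^κ = x and κ log X = log x.
  obtain ⟨δ₃, hδ₃, K₃, hK₃⟩ := exists_sum_mul_powEval_sub_le (Finset.range k)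
    (a := fun i => gcdTaylor h k j i) (p := fun i => cPoly k i) (Q := Q) (P := mainPoly A h k (j + 1))
    (κ := A⁻¹) hδ₂ (inv_pos.mpr hA0) hQ2 (by
      rw [hid]
      push_cast
      rw [inv_inv])
  refine ⟨min δ₁ (A * δ₃), lt_min hδ₁ (by positivity), K₁ + |K₃|, fun x hx => ?_⟩
  have hx0 : 0 < x := by linarith
  have hX1 : 1 ≤ x ^ A := Real.one_le_rpow hx hA0.le
  have h1 := hK₁ x hx
  have h2 := hK₃ (x ^ A) hX1
  have hXx : (x ^ A) ^ A⁻¹ = x := by rw [← Real.rpow_mul hx0.le, mul_inv_cancel₀ hA0.ne', Real.rpow_one]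
  have hpow : ∀ (p : ℂ[X]) (t : ℝ), 0 < t →
      powEval A⁻¹ p t = ((t ^ A⁻¹ : ℝ) : ℂ) * p.eval (Real.log (t ^ A⁻¹) : ℂ) := fun p t ht => by
    rw [powEval, Real.log_rpow ht]; push_cast; rfl
  have hmain : ∑ q ∈ Finset.Icc 1 ⌊x ^ A⌋₊, (d (j + 1 - 1) q : ℂ) *
          (x * (residuePoly h k q).eval (Real.log x : ℂ)
            - ((q : ℝ) ^ A⁻¹ : ℝ) * (residuePoly h k q).eval (Real.log ((q : ℝ) ^ A⁻¹) : ℂ))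
      = ∑ i ∈ Finset.range k, ∑ q ∈ Finset.Icc 1 ⌊x ^ A⌋₊, gcdTaylor h k j i q *
          (powEval A⁻¹ (cPoly k i) (x ^ A) - powEval A⁻¹ (cPoly k i) q) := by
    rw [Finset.sum_comm]
    refine Finset.sum_congr rfl fun q hq => ?_
    have hq0 : (0 : ℝ) < q := by exact_mod_cast (Finset.mem_Icc.mp hq).1
    have h3 : ∀ z : ℂ, (d j q : ℂ) * (residuePoly h k q).eval z
        = ∑ i ∈ Finset.range k, gcdTaylor h k j i q * (cPoly k i).eval z := fun z => by
      have := congrArg (Polynomial.eval z) (C_mul_residuePoly h k j q)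
      simpa only [eval_mul, eval_C, eval_finsetSum] using this
    simp only [hpow _ _ (by positivity : (0 : ℝ) < x ^ A), hpow _ _ hq0, hXx, Nat.add_sub_cancel]
    rw [mul_sub, mul_left_comm, h3, mul_left_comm (d j q : ℂ), h3, Finset.mul_sum, Finset.mul_sum,
      ← Finset.sum_sub_distrib]
    exact Finset.sum_congr rfl fun i _ => by ring
  rw [hmain] at h1
  rw [hpow _ _ (by positivity), hXx] at h2
  have hexp : (x ^ A) ^ (A⁻¹ - δ₃) = x ^ (1 - A * δ₃) := by
    rw [← Real.rpow_mul hx0.le, mul_sub, mul_inv_cancel₀ hA0.ne']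
  rw [hexp] at h2
  rw [add_mul]
  refine (norm_sub_le_norm_sub_add_norm_sub _ _ _).trans (add_le_add (h1.trans ?_) (h2.trans ?_))
  · gcongr
    exact min_le_left _ _
  · gcongr
    · exact le_abs_self _
    · exact min_le_right _ _

/-! ### Real coefficients -/

/-- The sum is real, so conjugation shows that the conjugate polynomial has the same asymptotics. At
v = log x the two differ by O(e^{-δv}), so they coincide. -/
lemma map_conj_mainPoly {P : ℂ[X]} {S : ℝ → ℝ} {δ K : ℝ} (hδ : 0 < δ)
    (h : ∀ x : ℝ, 1 ≤ x → ‖(S x : ℂ) - x * P.eval (Real.log x : ℂ)‖ ≤ K * x ^ (1 - δ)) :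
    P.map (starRingEnd ℂ) = P := by
  rw [← sub_eq_zero]
  refine eq_zero_of_tendsto_eval ?_
  have hlim : Tendsto (fun v : ℝ => 2 * K * Real.exp (-(δ * v))) atTop (𝓝 0) := by
    have h1 : Tendsto (fun v : ℝ => Real.exp (-(δ * v))) atTop (𝓝 0) :=
      Real.tendsto_exp_neg_atTop_nhds_zero.comp (tendsto_id.const_mul_atTop hδ)
    simpa using h1.const_mul (2 * K)
  refine squeeze_zero_norm' ?_ hlim
  filter_upwards [eventually_ge_atTop 0] with v hv
  have hx := h (Real.exp v) (Real.one_le_exp hv)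
  rw [Real.log_exp] at hx
  have hconj : (P.map (starRingEnd ℂ)).eval (v : ℂ) = starRingEnd ℂ (P.eval (v : ℂ)) := by
    conv_lhs => rw [← Complex.conj_ofReal v]
    rw [eval_map_apply]
  set z := P.eval (v : ℂ) with hz
  have hx' : ‖(S (Real.exp v) : ℂ) - Real.exp v * starRingEnd ℂ z‖ ≤ K * Real.exp v ^ (1 - δ) := by
    have h2 : (S (Real.exp v) : ℂ) - Real.exp v * starRingEnd ℂ z
        = starRingEnd ℂ ((S (Real.exp v) : ℂ) - Real.exp v * z) := by
      rw [map_sub, map_mul, Complex.conj_ofReal, Complex.conj_ofReal]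
    rw [h2, RCLike.norm_conj]
    exact hx
  have hpos := Real.exp_pos v
  have h3 : ‖(Real.exp v : ℂ) * (starRingEnd ℂ z - z)‖ ≤ 2 * (K * Real.exp v ^ (1 - δ)) := by
    have h4 : (Real.exp v : ℂ) * (starRingEnd ℂ z - z) = ((S (Real.exp v) : ℂ) - Real.exp v * z)
      - ((S (Real.exp v) : ℂ) - Real.exp v * starRingEnd ℂ z) := by ring
    rw [h4, two_mul]
    exact (norm_sub_le _ _).trans (add_le_add hx hx')
  rw [norm_mul, Complex.norm_real, Real.norm_of_nonneg hpos.le] at h3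
  rw [eval_sub, hconj]
  have h5 : Real.exp v ^ (1 - δ) = Real.exp v * Real.exp (-(δ * v)) := by
    rw [← Real.exp_mul, ← Real.exp_add]; congr 1; ring
  rw [h5] at h3
  have h6 : Real.exp v * ‖starRingEnd ℂ z - z‖ ≤ Real.exp v * (2 * K * Real.exp (-(δ * v))) := by
    linarith
  exact le_of_mul_le_mul_left h6 hpos

lemma exists_map_eq_of_map_conj {P : ℂ[X]} (h : P.map (starRingEnd ℂ) = P) :
    ∃ R : ℝ[X], R.map (algebraMap ℝ ℂ) = P := by
  have h1 : P ∈ Polynomial.lifts (algebraMap ℝ ℂ) := by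
    rw [Polynomial.lifts_iff_coeff_lifts]
    intro n
    have h2 := congrArg (fun p : ℂ[X] => p.coeff n) h
    simp only [coeff_map] at h2
    obtain ⟨r, hr⟩ := Complex.conj_eq_iff_real.mp h2
    exact ⟨r, hr.symm⟩
  exact (Polynomial.mem_lifts P).mp h1

/-! ### The leading coefficient -/

lemma mainPoly_natDegree_le (A : ℝ) {h k l : ℕ} (hk : 1 ≤ k) (hl : 1 ≤ l) :
    (mainPoly A h k l).natDegree ≤ k + l - 2 := by
  refine (natDegree_add_le _ _).trans (max_le ?_ ?_)
  · refine natDegree_sum_le_of_forall_le _ _ fun m hm => natDegree_sum_le_of_forall_le _ _ fun n hn => ?_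
    have h1 := Finset.mem_range.mp hm
    have h2 := Finset.mem_range.mp hn
    exact (natDegree_C_mul_X_pow_le _ _).trans (by omega)
  · refine natDegree_sum_le_of_forall_le _ _ fun m hm => ?_
    have h1 := Finset.mem_range.mp hm
    exact (natDegree_C_mul_X_pow_le _ _).trans (by omega)

/-- Only i = j = 0 survives, and the Taylor coefficients of zeta there are 1. -/
lemma bCoeff_top (h : ℕ) {k l : ℕ} (hk : 1 ≤ k) (hl : 1 ≤ l) :
    bCoeff h k l (k - 1) (l - 1) = eulerC k l 1 0 * eulerF h k l 1 0 := by
  rw [bCoeff, show k - (k - 1) = 1 by omega, show l - (l - 1) = 1 by omega]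
  simp [aCoeff, cCoeff, mixedDeriv, zetaReg_one]

lemma mainPoly_coeff_top (A : ℝ) (h : ℕ) {k l : ℕ} (hk : 1 ≤ k) (hl : 1 ≤ l) :
    (mainPoly A h k l).coeff (k + l - 2)
      = (A : ℂ) ^ (l - 1) * (eulerC k l 1 0 * eulerF h k l 1 0) / (((k - 1)! : ℂ) * ((l - 1)! : ℂ)) := by
  rw [mainPoly, coeff_add, ← bCoeff_top h hk hl]
  have h1 : (∑ m ∈ Finset.range (k + l - 2), Polynomial.C (secCoeff A h k l m / (m ! : ℂ))
      * Polynomial.X ^ m).coeff (k + l - 2) = 0 := by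
    rw [finsetSum_coeff]
    refine Finset.sum_eq_zero fun m hm => ?_
    have := Finset.mem_range.mp hm
    rw [coeff_C_mul, coeff_X_pow, if_neg (by omega), mul_zero]
  rw [h1, add_zero, finsetSum_coeff, Finset.sum_eq_single_of_mem (k - 1) (Finset.mem_range.mpr (by omega)),
    finsetSum_coeff, Finset.sum_eq_single_of_mem (l - 1) (Finset.mem_range.mpr (by omega))]
  · rw [coeff_C_mul, coeff_X_pow, if_pos (by omega), mul_one]
  · intro n hn hne
    have := Finset.mem_range.mp hn
    rw [coeff_C_mul, coeff_X_pow, if_neg (by omega), mul_zero]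
  · intro m hm hne
    have h2 := Finset.mem_range.mp hm
    rw [finsetSum_coeff]
    refine Finset.sum_eq_zero fun n hn => ?_
    have h3 := Finset.mem_range.mp hn
    rw [coeff_C_mul, coeff_X_pow, if_neg (by omega), mul_zero]

lemma inv_prime_bounds {p : ℕ} (hp : p.Prime) : 0 < (p : ℝ)⁻¹ ∧ (p : ℝ)⁻¹ < 1 :=
  ⟨inv_pos.mpr (by exact_mod_cast hp.pos), inv_lt_one_of_one_lt₀ (by exact_mod_cast hp.one_lt)⟩

/-- The factors of `leadC`. -/
def leadCFactor (k l p : ℕ) : ℝ :=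
  (1 - (p : ℝ)⁻¹) ^ (l - 1) + (1 - (p : ℝ)⁻¹) ^ (k - 1) - (1 - (p : ℝ)⁻¹) ^ (k + l - 2)

/-- Each of the two brackets is O(1/p), which displays the factor as 1 + O(p^{-2}). -/
lemma leadCFactor_eq {k l : ℕ} (hk : 1 ≤ k) (hl : 1 ≤ l) (p : ℕ) :
    leadCFactor k l p = 1 + -((1 - (1 - (p : ℝ)⁻¹) ^ (l - 1)) * (1 - (1 - (p : ℝ)⁻¹) ^ (k - 1))) := by
  rw [leadCFactor, show k + l - 2 = (k - 1) + (l - 1) by omega, pow_add]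
  ring

lemma leadCFactor_pos {k l p : ℕ} (hk : 1 ≤ k) (hl : 1 ≤ l) (hp : p.Prime) : 0 < leadCFactor k l p := by
  obtain ⟨h0, h1⟩ := inv_prime_bounds hp
  rw [leadCFactor, show k + l - 2 = (k - 1) + (l - 1) by omega, pow_add]
  have hx0 : 0 < 1 - (p : ℝ)⁻¹ := by linarith
  have hx1 : 1 - (p : ℝ)⁻¹ ≤ 1 := by linarith
  have h2 : 0 < (1 - (p : ℝ)⁻¹) ^ (l - 1) := by positivity
  have h3 : 0 < (1 - (p : ℝ)⁻¹) ^ (k - 1) := by positivity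
  have h4 : (1 - (p : ℝ)⁻¹) ^ (l - 1) ≤ 1 := pow_le_one₀ hx0.le hx1
  nlinarith

lemma one_sub_pow_nonneg_le (n : ℕ) {y : ℝ} (hy0 : 0 ≤ y) (hy1 : y ≤ 1) :
    0 ≤ 1 - (1 - y) ^ n ∧ 1 - (1 - y) ^ n ≤ n * y := by
  refine ⟨by have := pow_le_one₀ (n := n) (by linarith : 0 ≤ 1 - y) (by linarith); linarith, ?_⟩
  have := one_add_mul_le_pow (a := -y) (by linarith) n
  rw [← sub_eq_add_neg] at this
  linarith

lemma summable_leadCFactor_sub_one (k l : ℕ) : Summable fun p : Nat.Primes =>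
    -((1 - (1 - ((p : ℕ) : ℝ)⁻¹) ^ (l - 1)) * (1 - (1 - ((p : ℕ) : ℝ)⁻¹) ^ (k - 1))) := by
  have h1 : Summable fun p : Nat.Primes => ((l - 1 : ℕ) : ℝ) * ((k - 1 : ℕ) : ℝ) * (1 / ((p : ℕ) : ℝ) ^ 2) :=
    ((Real.summable_one_div_nat_pow.mpr one_lt_two).comp_injective
      Nat.Primes.coe_nat_injective).mul_left _
  refine Summable.of_norm_bounded h1 fun p => ?_
  obtain ⟨h0, h1⟩ := inv_prime_bounds p.2
  obtain ⟨a1, a2⟩ := one_sub_pow_nonneg_le (l - 1) h0.le h1.le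
  obtain ⟨b1, b2⟩ := one_sub_pow_nonneg_le (k - 1) h0.le h1.le
  rw [norm_neg, Real.norm_of_nonneg (mul_nonneg a1 b1)]
  calc _ ≤ (((l - 1 : ℕ) : ℝ) * ((p : ℕ) : ℝ)⁻¹) * (((k - 1 : ℕ) : ℝ) * ((p : ℕ) : ℝ)⁻¹) := by gcongr
    _ = _ := by rw [one_div, ← inv_pow]; ring

lemma multipliable_leadCFactor {k l : ℕ} (hk : 1 ≤ k) (hl : 1 ≤ l) :
    Multipliable fun p : Nat.Primes => leadCFactor k l p := by
  simp only [leadCFactor_eq hk hl]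
  exact Real.multipliable_one_add_of_summable (summable_leadCFactor_sub_one k l)

/-- Positive factors alone do not prevent an infinite product from vanishing; summability of the
logarithms writes it as an exponential. -/
lemma leadC_pos {k l : ℕ} (hk : 1 ≤ k) (hl : 1 ≤ l) : 0 < leadC k l := by
  have h1 : Summable fun p : Nat.Primes => Real.log (leadCFactor k l p) := by
    simp only [leadCFactor_eq hk hl]
    exact Real.summable_log_one_add_of_summable (summable_leadCFactor_sub_one k l)
  have h2 := Real.rexp_tsum_eq_tprod (fun p : Nat.Primes => leadCFactor_pos hk hl p.2) h1
  have h3 : leadC k l = ∏' p : Nat.Primes, leadCFactor k l p := rfl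
  rw [h3, ← h2]
  exact Real.exp_pos _

lemma cpow_zero_sub_one (p : ℕ) : (p : ℂ) ^ (-(0 : ℂ) - 1) = (p : ℂ)⁻¹ := by
  rw [neg_zero, zero_sub, Complex.cpow_neg_one]

lemma eulerC_one_zero {k l : ℕ} (hk : 1 ≤ k) (hl : 1 ≤ l) : eulerC k l 1 0 = (leadC k l : ℂ) := by
  have h1 := ((multipliable_leadCFactor hk hl).hasProd.map Complex.ofRealHom Complex.continuous_ofReal).tprod_eq
  have h3 : leadC k l = ∏' p : Nat.Primes, leadCFactor k l p := rfl
  rw [h3]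
  refine Eq.trans ?_ h1
  rw [eulerC]
  refine tprod_congr fun p => ?_
  have hP := one_sub_inv_prime_ne_zero p.2
  have h4 : ∀ z : ℂ, z ≠ 0 → z ^ k / z = z ^ (k - 1) := fun z hz => by
    obtain ⟨m, rfl⟩ := Nat.exists_eq_add_of_le' hk
    rw [pow_succ, Nat.add_sub_cancel, mul_div_cancel_right₀ _ hz]
  have h5 : (1 - ((p : ℕ) : ℂ)⁻¹) ^ k * (1 - ((p : ℕ) : ℂ)⁻¹) ^ (l - 1) / (1 - ((p : ℕ) : ℂ)⁻¹)
      = (1 - ((p : ℕ) : ℂ)⁻¹) ^ (k + l - 2) := by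
    rw [mul_div_right_comm, h4 _ hP, ← pow_add]
    congr 1; omega
  rw [cpow_zero_sub_one, Complex.cpow_neg_one, h5, h4 _ hP]
  simp [leadCFactor]

/-- Strict positivity of the series in `leadF` requires convergence, because a divergent `tsum`
takes the default value 0. -/
lemma summable_d_prime_pow (k : ℕ) {p : ℕ} (hp : p.Prime) (α : ℕ) :
    Summable fun β : ℕ => (d k (p ^ (α + β)) : ℝ) * (p : ℝ)⁻¹ ^ (α + β) := by
  have hz : ‖(p : ℂ)⁻¹‖ < 1 := by
    rw [norm_inv, Complex.norm_natCast]; exact (inv_prime_bounds hp).2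
  have h1 := (hasSum_dC_shift k hp hz α).summable
  refine Complex.summable_ofReal.mp (h1.congr fun β => ?_)
  push_cast
  rfl

lemma leadF_denom_eq (k : ℕ) {l : ℕ} (hl : 1 ≤ l) {p : ℕ} (hp : p.Prime) :
    (1 - (p : ℝ)⁻¹) ^ (1 - (k : ℤ)) + (1 - (p : ℝ)⁻¹) ^ (1 - (l : ℤ)) - 1
      = (1 - (p : ℝ)⁻¹) * ((1 - (p : ℝ)⁻¹) ^ k)⁻¹ + ((1 - (p : ℝ)⁻¹) ^ (l - 1))⁻¹ - 1 := by
  obtain ⟨h0, h1⟩ := inv_prime_bounds hp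
  have hx : 1 - (p : ℝ)⁻¹ ≠ 0 := by linarith
  have e1 : (1 - (l : ℤ)) = -((l - 1 : ℕ) : ℤ) := by push_cast [Nat.cast_sub hl]; ring
  rw [zpow_sub₀ hx, zpow_one, zpow_natCast, div_eq_mul_inv, e1, zpow_neg, zpow_natCast]

lemma leadF_pos {h k l : ℕ} (hk : 1 ≤ k) (hl : 1 ≤ l) : 0 < leadF k l h := by
  refine Finset.prod_pos fun p hp => ?_
  have hpp := Nat.prime_of_mem_primeFactors hp
  obtain ⟨h0, h1⟩ := inv_prime_bounds hpp
  have hx : 0 < 1 - (p : ℝ)⁻¹ := by linarith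
  rw [leadF_denom_eq k hl hpp]
  refine div_pos (add_pos_of_pos_of_nonneg (mul_pos hx ?_) ?_) (eulerF_denom_pos k (l - 1) hk hpp)
  · have hnn : ∀ α, 0 ≤ (d (l - 1) (p ^ α) : ℝ) *
        ∑' β : ℕ, (d k (p ^ (α + β)) : ℝ) * (p : ℝ)⁻¹ ^ (α + β) := fun α =>
      mul_nonneg (by positivity) (tsum_nonneg fun β => by positivity)
    refine Finset.sum_pos' (fun α _ => hnn α) ⟨0, by simp, ?_⟩
    rw [pow_zero, d_one_right, Nat.cast_one, one_mul]
    refine (summable_d_prime_pow k hpp 0).tsum_pos (fun β => by positivity) 0 ?_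
    simp [d_one_right]
  · exact mul_nonneg (by positivity) (tsum_nonneg fun β => by positivity)

lemma eulerF_one_zero (h k : ℕ) {l : ℕ} (hl : 1 ≤ l) : eulerF h k l 1 0 = (leadF k l h : ℂ) := by
  rw [eulerF, leadF, Complex.ofReal_prod]
  refine Finset.prod_congr rfl fun p hp => ?_
  have hpp := Nat.prime_of_mem_primeFactors hp
  rw [leadF_denom_eq k hl hpp]
  have e1 : ∀ n : ℕ, (p : ℂ) ^ (-(n : ℂ)) = (p : ℂ)⁻¹ ^ n := fun n => by
    rw [Complex.cpow_neg, Complex.cpow_natCast, inv_pow]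
  have e2 : ∀ α β : ℕ, (p : ℂ) ^ (-((α : ℂ) + β) * 1 - α * 0) = (p : ℂ)⁻¹ ^ (α + β) := fun α β => by
    rw [← e1]; congr 1; push_cast; ring
  have e3 : ∀ β : ℕ, (p : ℂ) ^ (-((h.factorization p : ℂ) + 1 + β) * (0 + 1))
      = (p : ℂ)⁻¹ ^ (h.factorization p + 1 + β) := fun β => by
    rw [← e1]; congr 1; push_cast; ring
  have e4 : (p : ℂ) ^ ((h.factorization p : ℂ) * (1 - 1)) = 1 := by simp
  simp only [e2, e3, e4, cpow_zero_sub_one, Complex.cpow_neg_one]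
  simp only [mul_one]
  push_cast [Complex.ofReal_tsum]
  rfl

end

end AdditiveDivisor


theorem theorem3 (h k l : ℕ) (hh : 1 ≤ h) (hk : 1 ≤ k) (hl : 1 ≤ l) (θ A : ℝ)
    (hθ : ∀ g : ℕ, 1 ≤ g → AdditiveDivisor.IsExponentOfDistribution g k θ)
    (hA0 : 0 < A) (hA : A < θ) :
    ∃ P : ℝ[X],
      P.map (algebraMap ℝ ℂ) = AdditiveDivisor.mainPoly A h k l ∧
      P.degree = ((k + l - 2 : ℕ) : WithBot ℕ) ∧
      P.leadingCoeff = A ^ (l - 1) * AdditiveDivisor.leadC k l * AdditiveDivisor.leadF k l h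
        / (((k - 1)! : ℝ) * ((l - 1)! : ℝ)) ∧
      ∃ δ : ℝ, 0 < δ ∧
        (fun x : ℝ => (∑ n ∈ Finset.Icc 1 ⌊x⌋₊,
            (AdditiveDivisor.d k (n + h) : ℝ) * (AdditiveDivisor.dPartial l A n : ℝ))
          - x * P.eval (Real.log x)) =O[atTop] fun x : ℝ => x ^ (1 - δ) := by
  obtain ⟨δ, hδ, K, hK⟩ := AdditiveDivisor.exists_sum_d_mul_dPartial_sub_mainPoly_le hh hk hl hθ hA0 hA
  obtain ⟨P, hP⟩ := AdditiveDivisor.exists_map_eq_of_map_conj (AdditiveDivisor.map_conj_mainPoly hδ hK)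
  have hdeg : P.natDegree ≤ k + l - 2 := by
    rw [← Polynomial.natDegree_map (algebraMap ℝ ℂ), hP]
    exact AdditiveDivisor.mainPoly_natDegree_le A hk hl
  have hcoeff : P.coeff (k + l - 2) = A ^ (l - 1) * AdditiveDivisor.leadC k l *
      AdditiveDivisor.leadF k l h / (((k - 1)! : ℝ) * ((l - 1)! : ℝ)) := by
    have h1 := AdditiveDivisor.mainPoly_coeff_top A h hk hl
    rw [← hP, Polynomial.coeff_map, AdditiveDivisor.eulerC_one_zero hk hl,
      AdditiveDivisor.eulerF_one_zero h k hl, ← mul_assoc] at h1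
    apply Complex.ofReal_injective
    push_cast
    exact h1
  -- Nonvanishing of this coefficient upgrades the degree bound to an equality.
  have hne : P.coeff (k + l - 2) ≠ 0 := by
    have h1 := AdditiveDivisor.leadC_pos hk hl
    have h2 := AdditiveDivisor.leadF_pos (h := h) hk hl
    rw [hcoeff]
    positivity
  have hnat : P.natDegree = k + l - 2 := Polynomial.natDegree_eq_of_le_of_coeff_ne_zero hdeg hne
  have hP0 : P ≠ 0 := fun h0 => hne (by rw [h0, Polynomial.coeff_zero])
  refine ⟨P, hP, ?_, ?_, δ, hδ, ?_⟩
  · rw [Polynomial.degree_eq_natDegree hP0, hnat]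
  · rw [Polynomial.leadingCoeff, hnat, hcoeff]
  · refine Asymptotics.IsBigO.of_bound K ?_
    filter_upwards [eventually_ge_atTop 1] with x hx
    have h1 := hK x hx
    have h2 : (AdditiveDivisor.mainPoly A h k l).eval (Real.log x : ℂ) = ((P.eval (Real.log x) : ℝ) : ℂ) := by
      rw [← hP]
      exact Polynomial.eval_map_apply (algebraMap ℝ ℂ) (Real.log x)
    rw [h2, ← Complex.ofReal_mul, ← Complex.ofReal_sub, Complex.norm_real] at h1
    rw [Real.norm_of_nonneg (by positivity : 0 ≤ x ^ (1 - δ))]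
    exact h1
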